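/- Let $K$ be a field, $n\ge 1$, and let $a_i,b_i,c_i$ ($1\le i\le n$) be natural numbers with $a_i\neq 0$ and $(b_i,c_i)\ne(0,0)$ for all $i$, $b=(b_1,\dots,b_n)\neq 0$, $c=(c_1,\dots,c_n)\ne 0$. Let $A$ be a finite abelian group generated by elements $h_1,\dots,h_{n+2}$, and let $e_1,\dots,e_n$ be the canonical basis of $\mathbb Z^n$. In $R=K[y,z,x_1,\dots,x_n]$ give $x_i$ the degree $(a_ie_i,h_i)$, $z$ the degree $(b,h_{n+1})$ and $y$ the degree $(c,h_{n+2})$ in $\mathbb Z^n\oplus A$. Let $L\subset\mathbb Z^{n+2}$ be the lattice of integer relations between these degrees and $I_L\subset R$ its lattice ideal, i.e. the ideal generated by all binomials $X^{u_+}-X^{u_-}$, $u\in L$ (a simplicial lattice ideal of height two). Assume that the $x_i$ are indexed so that the slopes $b_i/c_i\in[0,\infty]$ are nondecreasing. Let $\tilde L$ be the rank two lattice of all $(s,p)\in\mathbb Z^2$ such that $s\,(b,h_{n+1})-p\,(c,h_{n+2})\in\sum_i\mathbb Z(a_ie_i,h_i)$. Let $\varepsilon_{-1}=(s_{-1},0)$,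 $\varepsilon_0=(s_0,p_0)$ be its basis with $0\le s_0<s_{-1}$ and $p_0>0$; put $p_{-1}=0$. Run the Euclidean algorithm with quotients rounded up, $s_{i-2}=q_{i}s_{i-1}-s_{i}$ with $q_i=\lceil s_{i-2}/s_{i-1}\rceil\geq 2$ for $1\le i\le m+1$, until $s_{m+1}=0$ (with $m=-1$ if $s_0=0$), and put $p_{i}=q_{i}p_{i-1}-p_{i-2}$, $\varepsilon_i=(s_i,p_i)\in\tilde L$. For $-1\le i\le m+1$ let ${\bf r}_i\in\mathbb Z^n$ be the vector with coordinates $(s_ib_j-p_ic_j)/a_j$, and let ${\bf r}_{i,+},{\bf r}_{i,-}$ be its positive and negative parts, so that ${\bf r}_i={\bf r}_{i,+}-{\bf r}_{i,-}$. Let $\nu$ be the greatest index with ${\bf r}_\nu\ge 0$ (coordinatewise), and let $\mu$ be the smallest index $\geq\nu$ with ${\bf r}_{\mu+1}\le 0$; then $-1\le\nu\le\mu\le m$. 1) The ring $R/I_L$ is Cohen–Macaulay if and only if $\mu=\nu$. In this case $I_L$ is generated by $$F=z^{s_\nu}-y^{p_\nu}{\underline x}^{{\bf r}_\nu},\quad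 G=y^{p_{\nu+1}}-z^{s_{\nu+1}}{\underline x}^{-{\bf r}_{\nu+1}},\quad H=z^{s_\nu-s_{\nu+1}}y^{p_{\nu+1}-p_\nu}-{\underline x}^{{\bf r}_\nu-{\bf r}_{\nu+1}}.$$ 2) If $R/I_L$ is not Cohen–Macaulay, then $I_L$ is generated by the following $\tau=3+\sum_{i=\nu+2}^{\mu+1}(q_i-1)$ distinct binomials: $F$, $H$, $z^{s_{\nu+1}}{\underline x}^{{\bf r}_{\nu+1,-}}-y^{p_{\nu+1}}{\underline x}^{{\bf r}_{\nu+1,+}}$, and, for every $i$ with $\nu+2\le i\le\mu+1$, the binomials $$y^{tp_{i-1}-p_{i-2}}z^{s_{i-2}-ts_{i-1}}-{\underline x}^{{\bf r}_{i-2}-t{\bf r}_{i-1}}\quad(2\le t\le q_i-1)\qquad\text{and}\qquad z^{s_i}{\underline x}^{{\bf r}_{i,-}}-y^{p_i}{\underline x}^{{\bf r}_{i,+}}.$$ In both cases these generators form a Gröbner basis of $I_L$ for the reverse lexicographic order with variables $z>y>x_1>\dots>x_n$, graded by any positive integer weights of the variables for which $I_L$ is homogeneous: of two monomials of equal weight,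 the one with the smaller exponent at the last variable (in the order $z,y,x_1,\dots,x_n$) where they differ is the larger one. -/

import Mathlib

open MvPolynomial

noncomputable section

/-! ### Cohen–Macaulay rings -/

/-- A local ring `A` is Cohen–Macaulay if its maximal ideal contains an `A`-regular sequence
whose length is the Krull dimension of `A`. (Used for Noetherian rings only.) -/
def IsCohenMacaulayLocal (A : Type*) [CommRing A] [IsLocalRing A] : Prop :=
  ∃ rs : List A, (∀ x ∈ rs, x ∈ IsLocalRing.maximalIdeal A) ∧
    RingTheory.Sequence.IsRegular A rs ∧ (rs.length : WithBot ℕ∞) = ringKrullDim A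

/-- A ring is Cohen–Macaulay if it is Noetherian and all its localizations at maximal ideals
are Cohen–Macaulay local rings. -/
def IsCohenMacaulay (A : Type*) [CommRing A] : Prop :=
  IsNoetherianRing A ∧
    ∀ (m : Ideal A) [m.IsMaximal], IsCohenMacaulayLocal (Localization.AtPrime m)

/-! ### Gröbner bases -/

/-- The strict degree reverse lexicographic order on exponent vectors, graded by the weights `w`,
for variables `X 0 > X 1 > ⋯ > X (N - 1)`: the vector of smaller weight is smaller, and among
vectors of equal weight `α < β` holds if, at the last index where they differ (the smallest
variable), `α` has the larger exponent. -/
def RevLexLT {N : ℕ} (w : Fin N → ℕ) (α β : Fin N →₀ ℕ) : Prop :=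
  ∑ i, w i * α i < ∑ i, w i * β i ∨
    (∑ i, w i * α i = ∑ i, w i * β i ∧ ∃ i, β i < α i ∧ ∀ j, i < j → α j = β j)

/-- `α` is the leading exponent of `f` for the strict order `lt`. -/
def IsLeadingExp {σ K : Type*} [Field K] (lt : (σ →₀ ℕ) → (σ →₀ ℕ) → Prop)
    (f : MvPolynomial σ K) (α : σ →₀ ℕ) : Prop :=
  α ∈ f.support ∧ ∀ β ∈ f.support, β ≠ α → lt β α

/-- The finite set `G` is a Gröbner basis of the ideal `I`: it lies in `I`, and the leading
monomial of every nonzero element of `I` is divisible by the leading monomial of an element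
of `G`. -/
def IsGroebnerBasis {σ K : Type*} [Field K] (lt : (σ →₀ ℕ) → (σ →₀ ℕ) → Prop)
    (G : Set (MvPolynomial σ K)) (I : Ideal (MvPolynomial σ K)) : Prop :=
  G.Finite ∧ G ⊆ (I : Set (MvPolynomial σ K)) ∧
    ∀ f ∈ I, f ≠ 0 → ∃ g ∈ G, ∃ α β, IsLeadingExp lt f α ∧ IsLeadingExp lt g β ∧ β ≤ α

/-! ### Lattice ideals -/

/-- The monomial whose exponents are the positive parts of the entries of `u`. -/
def posMonomial (K : Type*) [Field K] {N : ℕ} (u : Fin N → ℤ) : MvPolynomial (Fin N) K :=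
  ∏ i, X i ^ (u i).toNat

/-- The lattice ideal of `L`, generated by the binomials `X ^ u₊ - X ^ u₋` for `u ∈ L`. -/
def latticeIdeal (K : Type*) [Field K] {N : ℕ} (L : AddSubgroup (Fin N → ℤ)) :
    Ideal (MvPolynomial (Fin N) K) :=
  Ideal.span {f | ∃ u ∈ L, f = posMonomial K u - posMonomial K (-u)}

/-! ### Simplicial lattice ideals of height two -/

/-- The data defining a simplicial lattice ideal of height two: natural numbers `a i`, `b i`,
`c i` and elements of an abelian group `H` that generate it. The variable `x i` has degree
`(a i • e i, hx i)`, the variable `z` has degree `(b, hz)` and `y` has degree `(c, hy)`. -/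
structure SimplicialData (n : ℕ) (H : Type*) [AddCommGroup H] where
  a : Fin n → ℕ
  b : Fin n → ℕ
  c : Fin n → ℕ
  hx : Fin n → H
  hz : H
  hy : H
  a_ne_zero : ∀ i, a i ≠ 0
  bc_ne_zero : ∀ i, b i ≠ 0 ∨ c i ≠ 0
  b_ne_zero : ∃ i, b i ≠ 0
  c_ne_zero : ∃ i, c i ≠ 0
  generates : AddSubgroup.closure (Set.range hx ∪ {hz, hy}) = ⊤

namespace SimplicialData

variable {n : ℕ} {H : Type*} [AddCommGroup H] (D : SimplicialData n H)

/-- The degree `(a i • e i, hx i)` of `x i`. -/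
def degX (i : Fin n) : (Fin n → ℤ) × H := (Pi.single i (D.a i : ℤ), D.hx i)

/-- The degree of `z`. -/
def degZ : (Fin n → ℤ) × H := (fun i => (D.b i : ℤ), D.hz)

/-- The degree of `y`. -/
def degY : (Fin n → ℤ) × H := (fun i => (D.c i : ℤ), D.hy)

/-- The degrees of all variables. The polynomial ring is `K[z, y, x₁, …, xₙ]`, where `z = X 0`,
`y = X 1`, and the remaining variables are the `x i`, in this order. -/
def deg : Fin (n + 2) → (Fin n → ℤ) × H := Fin.cons D.degZ (Fin.cons D.degY D.degX)

/-- The lattice of relations between the degrees of the variables. -/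
def lattice : AddSubgroup (Fin (n + 2) → ℤ) where
  carrier := {w | ∑ i, w i • D.deg i = 0}
  zero_mem' := by simp
  add_mem' := by
    intro u v hu hv
    simp only [Set.mem_ofPred_eq, Pi.add_apply, add_smul, Finset.sum_add_distrib] at *
    rw [hu, hv, add_zero]
  neg_mem' := by
    intro u hu
    simp only [Set.mem_ofPred_eq, Pi.neg_apply, neg_smul, Finset.sum_neg_distrib] at *
    rw [hu, neg_zero]

/-- The simplicial lattice ideal of height two. -/
def ideal (K : Type*) [Field K] : Ideal (MvPolynomial (Fin (n + 2)) K) :=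
  latticeIdeal K D.lattice

/-- The rank two lattice of all `(s, p)` such that `s • deg z - p • deg y` lies in the group
generated by the degrees of the `x i`. -/
def planeLattice : Set (ℤ × ℤ) :=
  {e | ∃ v : Fin n → ℤ, e.1 • D.degZ - e.2 • D.degY = ∑ i, v i • D.degX i}

/-! #### The fan

The sequences `ε`, `s`, `p`, `r`, `q` start at index `-1` in the usual notation; here they are
indexed by `ℕ`, with the index shifted by one: `fan k` is `ε_{k-1}`, `quot k` is `q_{k+1}`. -/

/-- The first vector `ε_{-1} = (s_{-1}, 0)`: the smallest `s > 0` with `(s, 0)` in the lattice. -/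
def fanStart : ℤ × ℤ := ((sInf {s : ℕ | 0 < s ∧ ((s : ℤ), (0 : ℤ)) ∈ D.planeLattice} : ℕ), 0)

/-- The number `p_0`: the smallest `p > 0` that occurs as a second coordinate. -/
def fanP : ℕ := sInf {p : ℕ | 0 < p ∧ ∃ s : ℤ, (s, (p : ℤ)) ∈ D.planeLattice}

/-- The second vector `ε_0 = (s_0, p_0)`, with the smallest possible `s_0 ≥ 0`. (Thus
`ε_{-1}, ε_0` is the basis of the lattice with `0 ≤ s_0 < s_{-1}` and `p_0 > 0`.) -/
def fanSecond : ℤ × ℤ :=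
  ((sInf {s : ℕ | ((s : ℤ), (D.fanP : ℤ)) ∈ D.planeLattice} : ℕ), (D.fanP : ℤ))

/-- One step of the Euclidean algorithm with quotients rounded up, `ε_{i-1} = q ε_i - ε_{i+1}`,
where `q` is the smallest integer with `q s_i ≥ s_{i-1}`. -/
def fanStep (e : (ℤ × ℤ) × (ℤ × ℤ)) : (ℤ × ℤ) × (ℤ × ℤ) :=
  (e.2, ⌈(e.1.1 : ℚ) / (e.2.1 : ℚ)⌉ • e.2 - e.1)

/-- `fan k = ε_{k-1} = (s_{k-1}, p_{k-1})`. Only the terms up to the first one with vanishing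
first coordinate are meaningful. -/
def fan (k : ℕ) : ℤ × ℤ := (fanStep^[k] (D.fanStart, D.fanSecond)).1

/-- `s k` is `s_{k-1}`. -/
def s (k : ℕ) : ℤ := (D.fan k).1

/-- `p k` is `p_{k-1}`. -/
def p (k : ℕ) : ℤ := (D.fan k).2

/-- `quot k` is the Euclidean quotient `q_{k+1}`, with `s_{k-1} = q_{k+1} s_k - s_{k+1}`. -/
def quot (k : ℕ) : ℤ := ⌈(D.s k : ℚ) / (D.s (k + 1) : ℚ)⌉

/-- `r k` is the vector `r_{k-1}`, with coordinates `(s_{k-1} b_j - p_{k-1} c_j) / a_j`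
(the division is exact). -/
def r (k : ℕ) (j : Fin n) : ℤ := (D.s k * D.b j - D.p k * D.c j) / D.a j

/-- The (shifted) index `m + 1` at which the Euclidean algorithm stops, `s_{m+1} = 0`. -/
def last : ℕ := sInf {k | D.s k = 0}

/-- `nu` is `ν + 1`, where `ν` is the greatest index in `-1, …, m + 1` such that all coordinates
of `r_ν` are nonnegative. -/
def nu : ℕ := sSup {k | k ≤ D.last ∧ ∀ j, 0 ≤ D.r k j}

/-- `mu` is `μ + 1`, where `μ` is the smallest index `≥ ν` such that all coordinates of
`r_{μ+1}` are nonpositive. -/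
def mu : ℕ := sInf {k | D.nu ≤ k ∧ ∀ j, D.r (k + 1) j ≤ 0}

/-! #### The explicit binomials -/

/-- The monomial `z ^ s * y ^ p * x ^ v`; negative exponents do not occur where it is used
(they are read as `0`). -/
def mono (n : ℕ) (K : Type*) [Field K] (s p : ℤ) (v : Fin n → ℤ) :
    MvPolynomial (Fin (n + 2)) K :=
  X 0 ^ s.toNat * X 1 ^ p.toNat * ∏ i : Fin n, X i.succ.succ ^ (v i).toNat

/-- The positive part of an integer vector. -/
def plus (v : Fin n → ℤ) : Fin n → ℤ := fun j => max (v j) 0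

/-- The negative part of an integer vector, `v = plus v - minus v`. -/
def minus (v : Fin n → ℤ) : Fin n → ℤ := fun j => max (-v j) 0

variable (K : Type*) [Field K]

/-- `F = z^{s_ν} - y^{p_ν} x^{r_ν}`. -/
def polyF : MvPolynomial (Fin (n + 2)) K :=
  mono n K (D.s D.nu) 0 0 - mono n K 0 (D.p D.nu) (D.r D.nu)

/-- `G = y^{p_{ν+1}} - z^{s_{ν+1}} x^{-r_{ν+1}}`. -/
def polyG : MvPolynomial (Fin (n + 2)) K :=
  mono n K 0 (D.p (D.nu + 1)) 0 - mono n K (D.s (D.nu + 1)) 0 (-D.r (D.nu + 1))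

/-- `H = z^{s_ν - s_{ν+1}} y^{p_{ν+1} - p_ν} - x^{r_ν - r_{ν+1}}`. -/
def polyH : MvPolynomial (Fin (n + 2)) K :=
  mono n K (D.s D.nu - D.s (D.nu + 1)) (D.p (D.nu + 1) - D.p D.nu) 0 -
    mono n K 0 0 (D.r D.nu - D.r (D.nu + 1))

/-- The binomial of `ε_{k-1}`: with `i = k - 1`, it is `z^{s_i} x^{r_{i,-}} - y^{p_i} x^{r_{i,+}}`. -/
def rayBinomial (k : ℕ) : MvPolynomial (Fin (n + 2)) K :=
  mono n K (D.s k) 0 (minus (D.r k)) - mono n K 0 (D.p k) (plus (D.r k))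

/-- The binomial of `ε_{k-1} - t ε_k`: with `i = k - 1`, it is
`y^{t p_{i+1} - p_i} z^{s_i - t s_{i+1}} - x^{r_i - t r_{i+1}}`. -/
def mixedBinomial (k : ℕ) (t : ℤ) : MvPolynomial (Fin (n + 2)) K :=
  mono n K (D.s k - t * D.s (k + 1)) (t * D.p (k + 1) - D.p k) 0 -
    mono n K 0 0 (D.r k - t • D.r (k + 1))

/-- The explicit generators: the three binomials `F`, `H` and the one of `ε_{ν+1}`, and for every
`i` with `ν ≤ i < μ` the mixed binomials `ε_i - t ε_{i+1}`, `2 ≤ t ≤ q_{i+2} - 1`, and the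
binomial of `ε_{i+2}`. -/
def generators : Set (MvPolynomial (Fin (n + 2)) K) :=
  {D.polyF K, D.polyH K, D.rayBinomial K (D.nu + 1)} ∪
    ⋃ k ∈ Set.Ico D.nu D.mu,
      ({f | ∃ t : ℤ, 2 ≤ t ∧ t ≤ D.quot k - 1 ∧ f = D.mixedBinomial K k t} ∪
        {D.rayBinomial K (k + 2)})

/-- The number `τ = 3 + ∑_{i=ν+2}^{μ+1} (q_i - 1)`. -/
def tau : ℤ := 3 + ∑ k ∈ Finset.Ico D.nu D.mu, (D.quot k - 1)

end SimplicialData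

end

/-! Since the `a i` are nonzero, a relation between the degrees is determined by its entries at z
and y. So the lattice of relations is a copy of the plane lattice, (s, p) corresponding to (s, -p,
-r) (`relVec`). A lattice ideal is the kernel of the map to the group algebra of the class group, so
every monomial of an element of the ideal shares its class with another of its monomials. Hence each
leading monomial of the ideal is divisible by that of a single lattice binomial, and a Gröbner basis
is a finite set of such binomials whose leading monomials divide all the others (`IsBinomialBasis`).
No S-pairs are needed.

Consecutive vectors of the fan form a basis of the plane lattice and cut the first quadrant into
cones (`exists_cone`), and every coordinate of r strictly decreases along the fan. Up to sign, a
lattice vector lies in the first or the fourth quadrant. In the first, the slope order makes z^s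
x^{r₋} the leading monomial as soon as r has a positive coordinate. Expanding the vector in its cone
shows that its leading monomial is divisible by that of some ε_k with ν ≤ k ≤ μ+1 (`s_nu_le`,
`exists_ray_le`, `p_mu_succ_le`). In the fourth, the leading monomial is z^s y^{-p}, and it is
divisible by that of ε_ν, of ε_{μ+1} or of some ε_k - tε_{k+1} (`exists_mixed_le`).

If μ = ν, the leading monomials involve z and y only. The quotient is then free over K[x₁, …, xₙ] on
the standard monomials (`free_quotient_latticeIdeal`), and it is integral, hence Cohen–Macaulay
(`isCohenMacaulay_of_flat`). If ν < μ, put r = r_{ν+1}, s = s_{ν+1}, p = p_{ν+1}, u = x^{r₊}, v =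
x^{r₋}. Then v z^s = u y^p in the quotient, while z^s is not a multiple of u locally at the origin
because s < s_ν. So (u, v) kills a nonzero class modulo the regular element u, and
`length_le_ringKrullDim_quotient_add_one` bounds regular sequences by dim K[x]/(u, v) + 1 ≤ n - 1,
as u and v are coprime. The local dimension at the origin is at least n. -/

/-! ### Bounds for the length of regular sequences. -/

section Depth

open RingTheory.Sequence IsLocalRing
open scoped Pointwise

/-- Passing from a prime `P` to `P + (y)`, with `y ∉ P`, lowers the dimension of the quotient. -/
theorem ringKrullDim_quotient_sup_succ_le {A : Type*} [CommRing A] (P : Ideal A) [P.IsPrime]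
    {y : A} (hy : y ∉ P) :
    ringKrullDim (A ⧸ (P ⊔ Ideal.span {y})) + 1 ≤ ringKrullDim (A ⧸ P) := by
  refine ringKrullDim_succ_le_of_surjective
    (Ideal.Quotient.factor (show P ≤ P ⊔ Ideal.span {y} from le_sup_left))
    (Ideal.Quotient.factor_surjective _) (r := Ideal.Quotient.mk P y) ?_ ?_
  · exact mem_nonZeroDivisors_of_ne_zero fun h => hy (Ideal.Quotient.eq_zero_iff_mem.1 h)
  · rw [Ideal.Quotient.factor_mk]
    exact Ideal.Quotient.eq_zero_iff_mem.2
      (Ideal.mem_sup_right (Ideal.mem_span_singleton_self y))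

variable {A : Type*} [CommRing A] [IsNoetherianRing A] [IsLocalRing A]

/-- If an ideal `J` kills a nonzero element of `M` and `y` is an `M`-regular element of the maximal
ideal, then `J` kills an element of `M` outside `y M`. -/
theorem exists_annihilated_notMem_smul_top {M : Type*} [AddCommGroup M] [Module A M]
    [Module.Finite A M] {y : A} (hy : y ∈ maximalIdeal A) (hreg : IsSMulRegular M y)
    {J : Ideal A} {x : M} (hx : x ≠ 0) (hJ : ∀ a ∈ J, a • x = 0) :
    ∃ x' : M, x' ∉ y • (⊤ : Submodule A M) ∧ ∀ a ∈ J, a • x' = 0 := by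
  by_contra! hcon
  let N : Submodule A M :=
    { carrier := {x | ∀ a ∈ J, a • x = 0}
      zero_mem' := by simp
      add_mem' := fun {u v} hu hv a ha => by rw [smul_add, hu a ha, hv a ha, add_zero]
      smul_mem' := fun c u hu a ha => by rw [smul_comm, hu a ha, smul_zero] }
  -- If everything killed by J lay in yM, regularity of y would make the quotients by y killed by J
  -- as well, so N ⊆ yN and Nakayama gives N = 0.
  have hN : N ≤ (Ideal.span {y}) • N := by
    intro u hu
    have h1 : u ∈ y • (⊤ : Submodule A M) := by
      by_contra h
      obtain ⟨a, ha, hne⟩ := hcon u h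
      exact hne (hu a ha)
    obtain ⟨v, -, rfl⟩ := (Submodule.mem_smul_pointwise_iff_exists _ _ _).1 h1
    refine Submodule.smul_mem_smul (Ideal.mem_span_singleton_self y) fun a ha => ?_
    refine hreg.right_eq_zero_of_smul ?_
    rw [smul_comm]
    exact hu a ha
  have hbot : N = ⊥ := Submodule.eq_bot_of_le_smul_of_le_jacobson_bot _ _
    (IsNoetherian.noetherian N) hN
    (by rw [IsLocalRing.jacobson_eq_maximalIdeal _ bot_ne_top]
        exact (Ideal.span_singleton_le_iff_mem _).2 hy)
  exact hx ((Submodule.mem_bot A).1 (hbot ▸ (show x ∈ N from hJ)))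

/-- If an ideal `J` kills a nonzero element of a finite module with a regular sequence of
length `k`, then `k ≤ dim A ⧸ J`. -/
theorem length_le_ringKrullDim_quotient_of_annihilated (rs : List A) :
    ∀ {M : Type*} [AddCommGroup M] [Module A M] [Module.Finite A M],
    (∀ r ∈ rs, r ∈ maximalIdeal A) → IsWeaklyRegular M rs →
    ∀ {J : Ideal A} {x : M}, x ≠ 0 → (∀ a ∈ J, a • x = 0) →
      (rs.length : WithBot ℕ∞) ≤ ringKrullDim (A ⧸ J) := by
  induction rs with
  | nil =>
    intro M _ _ _ _ _ J x hx hJ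
    have : Nontrivial (A ⧸ J) := by
      refine Ideal.Quotient.nontrivial_iff.2 fun h => hx ?_
      have := hJ 1 (h ▸ Submodule.mem_top)
      rwa [one_smul] at this
    simpa using ringKrullDim_nonneg_of_nontrivial (R := A ⧸ J)
  | cons y rs ih =>
    intro M _ _ _ hm hreg J x hx hJ
    rw [isWeaklyRegular_cons_iff] at hreg
    -- Enlarging J to an associated prime P can only lower dim A/J, and an M-regular y lies outside
    -- P. The induction then runs on M/yM with P + (y), whose quotient has dimension smaller by one.
    obtain ⟨P, hP, hle⟩ := exists_le_isAssociatedPrime_of_isNoetherianRing A x hx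
    obtain ⟨hPp, x₁, hx₁⟩ := isAssociatedPrime_iff.1 hP
    have hJP : J ≤ P := fun a ha => hle (by
      rw [Submodule.mem_colon_singleton]; simpa using hJ a ha)
    have hPx : ∀ a, a ∈ P ↔ a • x₁ = 0 := fun a => by
      rw [hx₁, Submodule.mem_colon_singleton]; simp
    have hx₁0 : x₁ ≠ 0 := fun h => hPp.ne_top ((Ideal.eq_top_iff_one _).2 ((hPx 1).2 (by simp [h])))
    have hyP : y ∉ P := fun h => hx₁0 (hreg.1.right_eq_zero_of_smul ((hPx y).1 h))
    have hym := hm y (by simp)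
    obtain ⟨x', hx', hPx'⟩ := exists_annihilated_notMem_smul_top hym hreg.1 hx₁0
      (J := P) fun a ha => (hPx a).1 ha
    have key := ih (fun r hr => hm r (by simp [hr])) hreg.2
      (J := P ⊔ Ideal.span {y}) (x := Submodule.Quotient.mk x') (by
        rwa [ne_eq, Submodule.Quotient.mk_eq_zero]) (by
        intro a ha
        obtain ⟨b, hb, c, hc, rfl⟩ := Submodule.mem_sup.1 ha
        obtain ⟨d, rfl⟩ := Ideal.mem_span_singleton'.1 hc
        rw [← Submodule.Quotient.mk_smul, Submodule.Quotient.mk_eq_zero, add_smul, hPx' b hb,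
          zero_add, mul_comm, mul_smul]
        exact Submodule.smul_mem_pointwise_smul _ _ _ trivial)
    calc (((y :: rs).length : ℕ) : WithBot ℕ∞) = (rs.length : WithBot ℕ∞) + 1 := by simp
      _ ≤ ringKrullDim (A ⧸ (P ⊔ Ideal.span {y})) + 1 := by gcongr
      _ ≤ ringKrullDim (A ⧸ P) := ringKrullDim_quotient_sup_succ_le P hyP
      _ ≤ ringKrullDim (A ⧸ J) :=
        ringKrullDim_le_of_surjective _ (Ideal.Quotient.factor_surjective hJP)

/-- If `u` is a regular element on a finite module `M` with a regular sequence of length `k`, and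
`J` kills a nonzero element of `M ⧸ u M`, then `k ≤ dim A ⧸ J + 1`. -/
theorem length_le_ringKrullDim_quotient_add_one (rs : List A) :
    ∀ {M : Type*} [AddCommGroup M] [Module A M] [Module.Finite A M],
    (∀ r ∈ rs, r ∈ maximalIdeal A) → IsWeaklyRegular M rs →
    ∀ {u : A}, u ∈ maximalIdeal A → IsSMulRegular M u →
    ∀ {J : Ideal A} {x : M}, x ∉ u • (⊤ : Submodule A M) →
      (∀ a ∈ J, a • x ∈ u • (⊤ : Submodule A M)) →
      (rs.length : WithBot ℕ∞) ≤ ringKrullDim (A ⧸ J) + 1 := by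
  induction rs with
  | nil =>
    intro M _ _ _ _ _ u _ _ J x hx hJ
    have : Nontrivial (A ⧸ J) := by
      refine Ideal.Quotient.nontrivial_iff.2 fun h => hx ?_
      have := hJ 1 (h ▸ Submodule.mem_top)
      rwa [one_smul] at this
    refine le_trans (by simp) (le_trans (ringKrullDim_nonneg_of_nontrivial (R := A ⧸ J)) ?_)
    exact le_add_of_nonneg_right zero_le_one
  | cons y rs ih =>
    intro M _ _ _ hm hreg u hu hureg J x hx hJ
    rw [isWeaklyRegular_cons_iff] at hreg
    have hym := hm y (by simp)
    have hm' : ∀ r ∈ rs, r ∈ maximalIdeal A := fun r hr => hm r (by simp [hr])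
    have hx0 : (Submodule.Quotient.mk x : QuotSMulTop u M) ≠ 0 := by
      rwa [ne_eq, Submodule.Quotient.mk_eq_zero]
    obtain ⟨P, hP, hle⟩ := exists_le_isAssociatedPrime_of_isNoetherianRing A _ hx0
    obtain ⟨hPp, x₁, hx₁⟩ := isAssociatedPrime_iff.1 hP
    obtain ⟨f, rfl⟩ := Submodule.Quotient.mk_surjective _ x₁
    have hJP : J ≤ P := fun a ha => hle (by
      rw [Submodule.mem_colon_singleton, ← Submodule.Quotient.mk_smul, Submodule.mem_bot,
        Submodule.Quotient.mk_eq_zero]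
      exact hJ a ha)
    have hPx : ∀ a, a ∈ P ↔ a • f ∈ u • (⊤ : Submodule A M) := fun a => by
      rw [hx₁, Submodule.mem_colon_singleton, ← Submodule.Quotient.mk_smul, Submodule.mem_bot,
        Submodule.Quotient.mk_eq_zero]
    have hf : f ∉ u • (⊤ : Submodule A M) := fun h =>
      hPp.ne_top ((Ideal.eq_top_iff_one _).2 ((hPx 1).2 (by simpa using h)))
    have hJdim : ringKrullDim (A ⧸ P) ≤ ringKrullDim (A ⧸ J) :=
      ringKrullDim_le_of_surjective _ (Ideal.Quotient.factor_surjective hJP)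
    have hlen : (((y :: rs).length : ℕ) : WithBot ℕ∞) = (rs.length : WithBot ℕ∞) + 1 := by simp
    rw [hlen]
    gcongr
    refine le_trans ?_ hJdim
    -- Either P kills something nonzero in M/yM and the previous bound suffices, or prime avoidance
    -- gives v ∈ P regular on M/yM, and v replaces u.
    by_cases hcase : ∃ x : QuotSMulTop y M, x ≠ 0 ∧ ∀ a ∈ P, a • x = 0
    · obtain ⟨x, hx, hax⟩ := hcase
      exact length_le_ringKrullDim_quotient_of_annihilated rs hm' hreg.2 hx hax
    · obtain ⟨v, hvP, hv⟩ : ∃ v ∈ P, IsSMulRegular (QuotSMulTop y M) v := by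
        by_contra! hno
        have hsub : (P : Set A) ⊆ ⋃ p ∈ associatedPrimes A (QuotSMulTop y M), p := by
          rw [biUnion_associatedPrimes_eq_compl_regular]
          exact fun v hv => hno v hv
        have hfin := associatedPrimes.finite A (QuotSMulTop y M)
        obtain ⟨Q, hQ, hPQ⟩ := (Ideal.subset_union_prime_finite hfin (f := fun p => p) ⊥ ⊥
          (fun p hp _ _ => hp.1)).1 hsub
        obtain ⟨-, x, hx⟩ := isAssociatedPrime_iff.1 hQ
        refine hcase ⟨x, ?_, fun a ha => ?_⟩
        · rintro rfl
          refine hQ.1.ne_top ?_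
          rw [hx]
          simp
        · have := hPQ ha
          rw [hx, Submodule.mem_colon_singleton] at this
          simpa using this
      have hvm : v ∈ maximalIdeal A := IsLocalRing.le_maximalIdeal hPp.ne_top hvP
      -- In a local ring regular sequences may be permuted, so v is regular on M and y on M/vM.
      have hvy : IsWeaklyRegular M [v, y] :=
        IsLocalRing.isWeaklyRegular_of_perm_of_subset_maximalIdeal (rs := [y, v])
          ((isWeaklyRegular_cons_iff _ _ _).2 ⟨hreg.1, (isWeaklyRegular_singleton_iff _ _).2 hv⟩)
          (List.Perm.swap _ _ _) (by
            intro r hr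
            simp only [List.mem_cons, List.not_mem_nil, or_false] at hr
            rcases hr with rfl | rfl <;> assumption)
      rw [isWeaklyRegular_cons_iff, isWeaklyRegular_singleton_iff] at hvy
      -- Exchange of u and v: from ug = vf the class of g in M/vM plays the role of that of f in
      -- M/uM. It is nonzero because v is regular, and P kills it because u is.
      obtain ⟨g, -, hg⟩ := (Submodule.mem_smul_pointwise_iff_exists _ _ _).1 ((hPx v).1 hvP)
      have hgv : (Submodule.Quotient.mk g : QuotSMulTop v M) ≠ 0 := by
        rw [ne_eq, Submodule.Quotient.mk_eq_zero]
        intro h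
        obtain ⟨g', -, rfl⟩ := (Submodule.mem_smul_pointwise_iff_exists _ _ _).1 h
        refine hf ?_
        rw [smul_comm] at hg
        rw [← hvy.1 hg]
        exact Submodule.smul_mem_pointwise_smul _ _ _ trivial
      have hPg : ∀ a ∈ P, a • (Submodule.Quotient.mk g : QuotSMulTop v M) = 0 := by
        intro a ha
        rw [← Submodule.Quotient.mk_smul, Submodule.Quotient.mk_eq_zero]
        obtain ⟨h, -, hh⟩ := (Submodule.mem_smul_pointwise_iff_exists _ _ _).1 ((hPx a).1 ha)
        have : a • g = v • h := by
          apply hureg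
          change u • a • g = u • v • h
          rw [smul_comm u a, hg, smul_comm u v, hh, smul_comm]
        rw [this]
        exact Submodule.smul_mem_pointwise_smul _ _ _ trivial
      obtain ⟨x', hx', hPx'⟩ := exists_annihilated_notMem_smul_top hym hvy.2 hgv hPg
      obtain ⟨e, rfl⟩ := Submodule.Quotient.mk_surjective _ x'
      have hyP : y ∉ P := fun h => hgv (hvy.2.right_eq_zero_of_smul (hPg y h))
      have key := ih hm' hreg.2 hvm hv (J := P ⊔ Ideal.span {y})
        (x := Submodule.Quotient.mk e) (by
          intro h
          obtain ⟨w, -, hw⟩ := (Submodule.mem_smul_pointwise_iff_exists _ _ _).1 h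
          obtain ⟨w, rfl⟩ := Submodule.Quotient.mk_surjective _ w
          rw [← Submodule.Quotient.mk_smul, Submodule.Quotient.eq] at hw
          obtain ⟨z, -, hz⟩ := (Submodule.mem_smul_pointwise_iff_exists _ _ _).1 hw
          refine hx' ((Submodule.mem_smul_pointwise_iff_exists _ _ _).2
            ⟨Submodule.Quotient.mk (-z), trivial, ?_⟩)
          rw [← Submodule.Quotient.mk_smul, Submodule.Quotient.eq, smul_neg, hz]
          refine (Submodule.mem_smul_pointwise_iff_exists _ _ _).2 ⟨-w, trivial, ?_⟩
          rw [smul_neg]; abel) (by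
          intro a ha
          obtain ⟨b, hb, c, hc, rfl⟩ := Submodule.mem_sup.1 ha
          obtain ⟨d, rfl⟩ := Ideal.mem_span_singleton'.1 hc
          have h1 := hPx' b hb
          rw [← Submodule.Quotient.mk_smul, Submodule.Quotient.mk_eq_zero] at h1
          obtain ⟨z, -, hz⟩ := (Submodule.mem_smul_pointwise_iff_exists _ _ _).1 h1
          refine (Submodule.mem_smul_pointwise_iff_exists _ _ _).2
            ⟨Submodule.Quotient.mk z, trivial, ?_⟩
          rw [← Submodule.Quotient.mk_smul, ← Submodule.Quotient.mk_smul, Submodule.Quotient.eq,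
            hz, add_smul, sub_add_cancel_left, mul_comm, mul_smul, ← smul_neg]
          exact Submodule.smul_mem_pointwise_smul _ _ _ trivial)
      exact key.trans (ringKrullDim_quotient_sup_succ_le P hyP)

end Depth

/-! ### Regular sequences in polynomial rings and flat extensions. -/

section PolynomialExtensions

open RingTheory.Sequence

/-- Incomparability: contraction of primes along an integral map is strictly monotone. -/
theorem ringKrullDim_le_of_isIntegral (R S : Type*) [CommRing R] [CommRing S] [Algebra R S]
    [Algebra.IsIntegral R S] : ringKrullDim S ≤ ringKrullDim R :=
  Order.krullDim_le_of_strictMono (PrimeSpectrum.comap (algebraMap R S)) fun _ _ h =>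
    Ideal.IsIntegral.comap_lt_comap h

/-- A regular sequence of constants, followed by a monic polynomial, is weakly regular. -/
theorem isWeaklyRegular_map_C_append_monic {A : Type*} [CommRing A] {rs : List A}
    (hrs : IsWeaklyRegular A rs) {f : Polynomial A} (hf : f.Monic) :
    IsWeaklyRegular (Polynomial A) (rs.map Polynomial.C ++ [f]) := by
  rw [isWeaklyRegular_append_iff, isWeaklyRegular_singleton_iff]
  refine ⟨hrs.of_flat (S := Polynomial A), ?_⟩
  rw [isSMulRegular_quotient_iff_mem_of_smul_mem]
  intro h hh
  have hI : (Ideal.ofList (rs.map Polynomial.C) • (⊤ : Submodule (Polynomial A) (Polynomial A)))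
      = (Ideal.ofList rs).map Polynomial.C := by
    rw [Ideal.map_ofList]; simp
  rw [hI, smul_eq_mul] at hh
  rw [hI]
  -- Modulo the constants one works with polynomials over A/(rs), where the image of f is still
  -- monic and hence regular.
  have key : ∀ g : Polynomial A, g ∈ (Ideal.ofList rs).map Polynomial.C ↔
      g.map (Ideal.Quotient.mk (Ideal.ofList rs)) = 0 := fun g => by
    rw [← Polynomial.coe_mapRingHom, ← RingHom.mem_ker, Polynomial.ker_mapRingHom,
      Ideal.mk_ker]
  rw [key] at hh ⊢
  rw [Polynomial.map_mul] at hh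
  exact ((hf.map _).isRegular.left.isSMulRegular).right_eq_zero_of_smul hh

/-- Viewing the ring as polynomials in the first variable, the sequence for the other variables
consists of constants, and the polynomial for the first variable is monic. It is put last. -/
theorem exists_isWeaklyRegular_aeval_X (K : Type*) [CommRing K] (n : ℕ) :
    ∀ g : Fin n → Polynomial K, (∀ i, (g i).Monic) →
      ∃ rs : List (MvPolynomial (Fin n) K), rs.length = n ∧
        IsWeaklyRegular (MvPolynomial (Fin n) K) rs ∧
        ∀ r ∈ rs, ∃ i, r = Polynomial.aeval (X i) (g i) := by
  induction n with
  | zero => exact fun g _ => ⟨[], rfl, IsWeaklyRegular.nil _ _, by simp⟩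
  | succ n ih =>
    intro g hg
    obtain ⟨rs, hlen, hreg, hrs⟩ := ih (fun i => g i.succ) fun i => hg _
    have h0 := isWeaklyRegular_map_C_append_monic hreg
      ((hg 0).map (algebraMap K (MvPolynomial (Fin n) K)))
    let e := (finSuccEquiv K n).symm
    refine ⟨(rs.map Polynomial.C ++
      [(g 0).map (algebraMap K (MvPolynomial (Fin n) K))]).map e, by simp [hlen], ?_, ?_⟩
    · refine (e.toAddEquiv.isWeaklyRegular_congr (List.forall₂_map_right_iff.mpr
        (List.forall₂_same.mpr fun r _ x => ?_))).1 h0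
      exact map_mul e r x
    · intro r hr
      rw [List.map_append, List.mem_append, List.map_map, List.mem_map, List.map_singleton,
        List.mem_singleton] at hr
      rcases hr with ⟨s, hs, rfl⟩ | rfl
      · obtain ⟨i, rfl⟩ := hrs s hs
        refine ⟨i.succ, ?_⟩
        have h1 := Polynomial.aeval_algHom_apply (finSuccEquiv K n).toAlgHom (X i.succ) (g i.succ)
        have h2 := Polynomial.aeval_algHom_apply
          (Polynomial.CAlgHom (R := K) (A := MvPolynomial (Fin n) K)) (X i) (g i.succ)
        rw [AlgEquiv.toAlgHom_apply, finSuccEquiv_X_succ] at h1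
        rw [Function.comp_apply, AlgEquiv.symm_apply_eq]
        exact h2.symm.trans h1
      · refine ⟨0, ?_⟩
        have h1 := Polynomial.aeval_algHom_apply (finSuccEquiv K n).toAlgHom (X 0) (g 0)
        rw [AlgEquiv.toAlgHom_apply, finSuccEquiv_X_zero, Polynomial.aeval_X_left_eq_map] at h1
        rw [AlgEquiv.symm_apply_eq]
        exact h1

/-- A weakly regular sequence of `S` of length `k` that maps into the maximal ideal of a flat
local `S`-algebra `A`, which is Noetherian, shows `k ≤ dim A`, and remains regular. -/
theorem IsWeaklyRegular.isRegular_map_of_flat {S A : Type*} [CommRing S] [CommRing A] [Algebra S A]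
    [IsLocalRing A] [IsNoetherianRing A] [Module.Flat S A] {rs : List S}
    (hrs : IsWeaklyRegular S rs)
    (hmem : ∀ r ∈ rs, algebraMap S A r ∈ IsLocalRing.maximalIdeal A) :
    IsRegular A (rs.map (algebraMap S A)) ∧ (rs.length : WithBot ℕ∞) ≤ ringKrullDim A := by
  have h1 : IsRegular A (rs.map (algebraMap S A)) := by
    refine IsRegular.of_isWeaklyRegular_of_mem_maximalIdeal _ (fun r hr => ?_) hrs.of_flat
    obtain ⟨s, hs, rfl⟩ := List.mem_map.1 hr
    exact hmem s hs
  refine ⟨h1, ?_⟩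
  have h2 := ringKrullDim_add_length_eq_ringKrullDim_of_isRegular _ h1
  rw [List.length_map] at h2
  rw [← h2]
  have : Nontrivial (A ⧸ Ideal.ofList (rs.map (algebraMap S A))) := by
    refine Ideal.Quotient.nontrivial_iff.2 fun h => h1.top_ne_smul ?_
    rw [h]; simp
  exact le_add_of_nonneg_left ringKrullDim_nonneg_of_nontrivial

/-- An algebra of finite type that is integral and flat over a polynomial ring over a field is
Cohen–Macaulay. -/
theorem isCohenMacaulay_of_flat (K : Type*) [Field K] (n : ℕ) (B : Type*) [CommRing B]
    [Algebra K B] [Algebra (MvPolynomial (Fin n) K) B]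
    [IsScalarTower K (MvPolynomial (Fin n) K) B] [Module.Flat (MvPolynomial (Fin n) K) B]
    [Algebra.IsIntegral (MvPolynomial (Fin n) K) B] [Algebra.FiniteType K B] :
    IsCohenMacaulay B := by
  have hN : IsNoetherianRing B := Algebra.FiniteType.isNoetherianRing K B
  refine ⟨hN, fun m hm => ?_⟩
  let _ : Field (B ⧸ m) := Ideal.Quotient.field m
  have hfin : Module.Finite K (B ⧸ m) := finite_of_finite_type_of_isJacobsonRing K (B ⧸ m)
  let t : Fin n → B := fun i => algebraMap (MvPolynomial (Fin n) K) B (X i)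
  -- By the Nullstellensatz B/m is finite over K, so each x_i has a minimal polynomial modulo m.
  -- Evaluating it at x_i gives an element of m even when m is not a rational point.
  let g : Fin n → Polynomial K := fun i => minpoly K (Ideal.Quotient.mkₐ K m (t i))
  have hg : ∀ i, (g i).Monic := fun i => minpoly.monic (Algebra.IsIntegral.isIntegral _)
  obtain ⟨rs, hlen, hreg, hrs⟩ := exists_isWeaklyRegular_aeval_X K n g hg
  have hmem : ∀ r ∈ rs, algebraMap (MvPolynomial (Fin n) K) B r ∈ m := by
    intro r hr
    obtain ⟨i, rfl⟩ := hrs r hr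
    rw [← Polynomial.aeval_algebraMap_apply, ← Ideal.Quotient.eq_zero_iff_mem,
      ← Ideal.Quotient.mkₐ_eq_mk K, ← Polynomial.aeval_algHom_apply]
    exact minpoly.aeval K _
  have : Module.Flat (MvPolynomial (Fin n) K) (Localization.AtPrime m) :=
    Module.Flat.trans (MvPolynomial (Fin n) K) B (Localization.AtPrime m)
  have hmem' : ∀ r ∈ rs, algebraMap (MvPolynomial (Fin n) K) (Localization.AtPrime m) r ∈
      IsLocalRing.maximalIdeal (Localization.AtPrime m) := by
    intro r hr
    rw [IsScalarTower.algebraMap_apply (MvPolynomial (Fin n) K) B]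
    exact (IsLocalization.AtPrime.to_map_mem_maximal_iff _ m _).2 (hmem r hr)
  obtain ⟨h1, h2⟩ := IsWeaklyRegular.isRegular_map_of_flat hreg hmem'
  refine ⟨_, ?_, h1, le_antisymm (by rwa [List.length_map]) ?_⟩
  · intro x hx
    obtain ⟨s, hs, rfl⟩ := List.mem_map.1 hx
    exact hmem' s hs
  -- The n terms found are enough: the height of m is at most dim B, hence at most dim K[x₁, …, xₙ]
  -- = n by integrality.
  · rw [List.length_map, hlen, IsLocalization.AtPrime.ringKrullDim_eq_height m]
    refine (Ideal.height_le_ringKrullDim_of_ne_top hm.ne_top).trans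
      ((ringKrullDim_le_of_isIntegral (MvPolynomial (Fin n) K) B).trans ?_)
    simp

/-- The ideal generated by the variables has height `n`. -/
theorem le_height_ker_constantCoeff (K : Type*) [Field K] (n : ℕ) :
    (n : ℕ∞) ≤ (RingHom.ker (constantCoeff (R := K) (σ := Fin n))).height := by
  obtain ⟨rs, hlen, hreg, hrs⟩ := exists_isWeaklyRegular_aeval_X K n (fun _ => Polynomial.X)
    fun _ => Polynomial.monic_X
  set m := RingHom.ker (constantCoeff (R := K) (σ := Fin n)) with hm
  have hmp : m.IsPrime := RingHom.ker_isPrime _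
  have h := (IsWeaklyRegular.isRegular_map_of_flat (A := Localization.AtPrime m) hreg ?_).2
  · rw [hlen, IsLocalization.AtPrime.ringKrullDim_eq_height m] at h
    exact_mod_cast h
  · intro r hr
    obtain ⟨i, rfl⟩ := hrs r hr
    refine (IsLocalization.AtPrime.to_map_mem_maximal_iff _ m _).2 ?_
    rw [Polynomial.aeval_X, hm, RingHom.mem_ker, constantCoeff_X]

end PolynomialExtensions

/-! ### Lattice ideals and their binomial Gröbner bases. -/

noncomputable section LatticeIdeals

variable {K : Type*} [Field K] {N : ℕ}

/-- The exponent vector with the positive parts of the entries of `u`. -/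
def posExp (u : Fin N → ℤ) : Fin N →₀ ℕ := Finsupp.equivFunOnFinite.symm fun i => (u i).toNat

@[simp] theorem posExp_apply (u : Fin N → ℤ) (i : Fin N) : posExp u i = (u i).toNat := rfl

theorem posMonomial_eq_monomial (u : Fin N → ℤ) : posMonomial K u = monomial (posExp u) 1 := by
  rw [monomial_eq, map_one, one_mul, Finsupp.prod_fintype _ _ (by simp)]
  rfl

/-- The exponent vector with integer entries. -/
def intExp (N : ℕ) : (Fin N →₀ ℕ) →+ (Fin N → ℤ) where
  toFun α i := α i
  map_zero' := by ext; simp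
  map_add' := by intros; ext; simp

@[simp] theorem intExp_apply (α : Fin N →₀ ℕ) (i : Fin N) : intExp N α i = α i := rfl

theorem intExp_injective : Function.Injective (intExp N) := fun α β h => by
  ext i
  simpa using congrFun h i

theorem intExp_posExp_sub (u : Fin N → ℤ) : intExp N (posExp u) - intExp N (posExp (-u)) = u := by
  ext i
  simp only [Pi.sub_apply, intExp_apply, posExp_apply, Pi.neg_apply]
  omega

theorem posExp_intExp_sub_le (α β : Fin N →₀ ℕ) : posExp (intExp N α - intExp N β) ≤ α := by
  intro i
  simp only [posExp_apply, Pi.sub_apply, intExp_apply]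
  omega

theorem posExp_ne_posExp_neg {u : Fin N → ℤ} (hu : u ≠ 0) : posExp u ≠ posExp (-u) := by
  intro h
  apply hu
  rw [← intExp_posExp_sub u, ← h, sub_self]

/-- The binomial of an integer vector. -/
def latticeBinomial (K : Type*) [Field K] (u : Fin N → ℤ) : MvPolynomial (Fin N) K :=
  posMonomial K u - posMonomial K (-u)

theorem latticeBinomial_eq (u : Fin N → ℤ) :
    latticeBinomial K u = monomial (posExp u) 1 - monomial (posExp (-u)) 1 := by
  rw [latticeBinomial, posMonomial_eq_monomial, posMonomial_eq_monomial]

theorem latticeBinomial_neg (u : Fin N → ℤ) : latticeBinomial K (-u) = -latticeBinomial K u := by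
  rw [latticeBinomial, latticeBinomial, neg_neg, neg_sub]

open Classical in
theorem support_latticeBinomial {u : Fin N → ℤ} (hu : u ≠ 0) :
    (latticeBinomial K u).support = {posExp u, posExp (-u)} := by
  have h := posExp_ne_posExp_neg hu
  ext α
  rw [latticeBinomial_eq, mem_support_iff, coeff_sub, coeff_monomial, coeff_monomial,
    Finset.mem_insert, Finset.mem_singleton]
  by_cases h1 : posExp u = α
  · subst h1
    simp [h.symm]
  · by_cases h2 : posExp (-u) = α
    · subst h2
      simp [h]
    · simp [h1, h2, Ne.symm h1, Ne.symm h2]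

/-- Only supports are compared. The sign has to stay open, since in characteristic two u and -u have
the same binomial. -/
theorem eq_or_eq_neg_of_latticeBinomial_eq {u v : Fin N → ℤ} (hu : u ≠ 0) (hv : v ≠ 0)
    (h : latticeBinomial K u = latticeBinomial K v) : u = v ∨ u = -v := by
  classical
  have hs := congrArg MvPolynomial.support h
  rw [support_latticeBinomial hu, support_latticeBinomial hv] at hs
  have h1 : posExp u ∈ ({posExp v, posExp (-v)} : Finset (Fin N →₀ ℕ)) := hs ▸ (by simp)
  have h2 : posExp (-u) ∈ ({posExp v, posExp (-v)} : Finset (Fin N →₀ ℕ)) := hs ▸ (by simp)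
  have hne := posExp_ne_posExp_neg hu
  rw [Finset.mem_insert, Finset.mem_singleton] at h1 h2
  have hv' := intExp_posExp_sub v
  rw [← intExp_posExp_sub u]
  rcases h1 with h1 | h1 <;> rcases h2 with h2 | h2
  · exact absurd (h1.trans h2.symm) hne
  · left; rw [h1, h2, hv']
  · right; rw [h1, h2, ← neg_sub, hv']
  · exact absurd (h1.trans h2.symm) hne

variable {L : AddSubgroup (Fin N → ℤ)}

theorem latticeBinomial_mem {u : Fin N → ℤ} (hu : u ∈ L) :
    latticeBinomial K u ∈ latticeIdeal K L :=
  Ideal.subset_span ⟨u, hu, rfl⟩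

/-- The factor in front is the greatest common divisor of the two monomials. -/
theorem monomial_sub_monomial_eq (α β : Fin N →₀ ℕ) :
    (monomial α 1 - monomial β 1 : MvPolynomial (Fin N) K) =
      monomial (α - posExp (intExp N α - intExp N β)) 1 *
        latticeBinomial K (intExp N α - intExp N β) := by
  rw [latticeBinomial_eq, mul_sub, monomial_mul, monomial_mul, mul_one, neg_sub]
  congr 3
  · rw [tsub_add_cancel_of_le (posExp_intExp_sub_le α β)]
  · ext i
    simp only [Finsupp.add_apply, Finsupp.tsub_apply, posExp_apply, Pi.sub_apply, intExp_apply]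
    omega

theorem monomial_sub_monomial_mem {α β : Fin N →₀ ℕ} (h : intExp N α - intExp N β ∈ L) :
    (monomial α 1 - monomial β 1 : MvPolynomial (Fin N) K) ∈ latticeIdeal K L := by
  rw [monomial_sub_monomial_eq]
  exact Ideal.mul_mem_left _ _ (latticeBinomial_mem h)

/-- The map to the group algebra of the class group `ℤ ^ N ⧸ L`. -/
def classMap (K : Type*) [Field K] (L : AddSubgroup (Fin N → ℤ)) :
    MvPolynomial (Fin N) K →+* AddMonoidAlgebra K ((Fin N → ℤ) ⧸ L) :=
  AddMonoidAlgebra.mapDomainRingHom K ((QuotientAddGroup.mk' L).comp (intExp N))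

theorem classMap_monomial (α : Fin N →₀ ℕ) (c : K) :
    classMap K L (monomial α c) = AddMonoidAlgebra.single ((intExp N α : Fin N → ℤ) : _ ⧸ L) c :=
  AddMonoidAlgebra.mapDomain_single

open Classical in
theorem coeff_classMap (f : MvPolynomial (Fin N) K) (q : (Fin N → ℤ) ⧸ L) :
    (classMap K L f).coeff q =
      ∑ α ∈ f.support with ((intExp N α : Fin N → ℤ) : _ ⧸ L) = q, coeff α f := by
  conv_lhs => rw [f.as_sum]
  rw [map_sum, AddMonoidAlgebra.coeff_sum, Finsupp.finsetSum_apply, Finset.sum_filter]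
  refine Finset.sum_congr rfl fun α _ => ?_
  rw [classMap_monomial, AddMonoidAlgebra.coeff_single, Finsupp.single_apply]

theorem mk_intExp_eq_iff {α β : Fin N →₀ ℕ} :
    ((intExp N α : Fin N → ℤ) : _ ⧸ L) = (intExp N β : Fin N → ℤ) ↔
      intExp N α - intExp N β ∈ L := by
  rw [eq_comm, QuotientAddGroup.eq, neg_add_eq_sub]

theorem latticeIdeal_le_ker_classMap : latticeIdeal K L ≤ RingHom.ker (classMap K L) := by
  refine Ideal.span_le.2 ?_
  rintro _ ⟨u, hu, rfl⟩
  change classMap K L _ = 0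
  rw [posMonomial_eq_monomial, posMonomial_eq_monomial, map_sub, classMap_monomial,
    classMap_monomial, sub_eq_zero]
  congr 1
  rw [mk_intExp_eq_iff, intExp_posExp_sub]
  exact hu

/-- In each class the coefficients of f add up to zero, so no monomial of f is alone in its class.
-/
theorem exists_equiv_of_classMap_eq_zero {f : MvPolynomial (Fin N) K} (hf : classMap K L f = 0)
    {α : Fin N →₀ ℕ} (hα : α ∈ f.support) :
    ∃ β ∈ f.support, β ≠ α ∧ intExp N α - intExp N β ∈ L := by
  classical
  by_contra! hno
  have h1 := coeff_classMap f ((intExp N α : Fin N → ℤ) : _ ⧸ L)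
  rw [hf, Finset.sum_eq_single α] at h1
  · exact (mem_support_iff.1 hα) h1.symm
  · intro β hβ hne
    rw [Finset.mem_filter] at hβ
    exact absurd (mk_intExp_eq_iff.1 hβ.2.symm) (hno β hβ.1 hne)
  · intro h
    refine absurd ?_ h
    exact Finset.mem_filter.2 ⟨hα, rfl⟩

/-- Cancelling a monomial of f against an equivalent monomial of f uses an element of the lattice
ideal and shrinks the support. -/
theorem latticeIdeal_eq_ker_classMap : latticeIdeal K L = RingHom.ker (classMap K L) := by
  refine le_antisymm latticeIdeal_le_ker_classMap fun f hf => ?_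
  classical
  induction hk : f.support.card using Nat.strong_induction_on generalizing f with
  | _ k ih =>
    by_cases hf0 : f = 0
    · rw [hf0]; exact zero_mem _
    obtain ⟨α, hα⟩ := support_nonempty.2 hf0
    obtain ⟨β, hβ, hne, hL⟩ := exists_equiv_of_classMap_eq_zero hf hα
    set g : MvPolynomial (Fin N) K := C (coeff α f) * (monomial α 1 - monomial β 1) with hg
    have hgI : g ∈ latticeIdeal K L := Ideal.mul_mem_left _ _ (monomial_sub_monomial_mem hL)
    have hsub : (f - g).support ⊆ f.support.erase α := by
      intro γ hγ
      rw [mem_support_iff, coeff_sub, hg, coeff_C_mul, coeff_sub, coeff_monomial,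
        coeff_monomial] at hγ
      rw [Finset.mem_erase]
      refine ⟨fun h => ?_, ?_⟩
      · subst h
        simp [hne] at hγ
      · by_cases h1 : α = γ
        · exact h1 ▸ hα
        · by_cases h2 : β = γ
          · exact h2 ▸ hβ
          · rw [mem_support_iff]
            simpa [h1, h2] using hγ
    have := ih _ (hk ▸ (Finset.card_le_card hsub).trans_lt (Finset.card_erase_lt_of_mem hα)) (f - g)
      (Ideal.sub_mem _ hf (latticeIdeal_le_ker_classMap hgI)) rfl
    simpa using Ideal.add_mem _ this hgI

/-! ### The reverse lexicographic order -/

/-- The last nonzero entry of `u` is negative. -/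
def LastNeg (u : Fin N → ℤ) : Prop := ∃ i, u i < 0 ∧ ∀ j, i < j → u j = 0

theorem LastNeg.ne_zero {u : Fin N → ℤ} (h : LastNeg u) : u ≠ 0 := by
  rintro rfl
  obtain ⟨i, hi, -⟩ := h
  exact lt_irrefl _ hi

theorem lastNeg_or_lastNeg_neg {u : Fin N → ℤ} (hu : u ≠ 0) : LastNeg u ∨ LastNeg (-u) := by
  classical
  obtain ⟨i, hi⟩ := Function.ne_iff.1 hu
  have hne : (Finset.univ.filter fun i => u i ≠ 0).Nonempty := ⟨i, by simpa using hi⟩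
  set m := Finset.max' _ hne with hm
  have h1 : u m ≠ 0 := (Finset.mem_filter.1 (Finset.max'_mem _ hne)).2
  have h2 : ∀ j, m < j → u j = 0 := fun j hj => by
    by_contra h
    exact absurd (Finset.le_max' _ j (Finset.mem_filter.2 ⟨Finset.mem_univ _, h⟩)) (not_le.2 hj)
  rcases lt_or_gt_of_ne h1 with h | h
  · exact Or.inl ⟨m, h, h2⟩
  · exact Or.inr ⟨m, by simpa using h, fun j hj => by simp [h2 j hj]⟩

theorem LastNeg.add {u v : Fin N → ℤ} (hu : LastNeg u) (hv : LastNeg v) : LastNeg (u + v) := by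
  obtain ⟨i, hi, hi'⟩ := hu
  obtain ⟨j, hj, hj'⟩ := hv
  rcases lt_trichotomy i j with h | rfl | h
  · exact ⟨j, by simp [hi' j h, hj], fun k hk => by simp [hi' k (h.trans hk), hj' k hk]⟩
  · exact ⟨i, by simp only [Pi.add_apply]; omega, fun k hk => by simp [hi' k hk, hj' k hk]⟩
  · exact ⟨i, by simp [hj' i h, hi], fun k hk => by simp [hi' k hk, hj' k (h.trans hk)]⟩

theorem LastNeg.not_lastNeg_neg {u : Fin N → ℤ} (hu : LastNeg u) : ¬ LastNeg (-u) := fun h =>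
  (hu.add h).ne_zero (by simp)

theorem revLexLT_iff {w : Fin N → ℕ} {α β : Fin N →₀ ℕ} :
    RevLexLT w α β ↔ ∑ i, w i * α i < ∑ i, w i * β i ∨
      (∑ i, w i * α i = ∑ i, w i * β i ∧ LastNeg (intExp N β - intExp N α)) := by
  simp only [RevLexLT, LastNeg, Pi.sub_apply, intExp_apply, sub_neg, sub_eq_zero, Nat.cast_lt,
    Nat.cast_inj]
  simp only [eq_comm]

theorem RevLexLT.trans {w : Fin N → ℕ} {α β γ : Fin N →₀ ℕ} (h1 : RevLexLT w α β)
    (h2 : RevLexLT w β γ) : RevLexLT w α γ := by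
  rw [revLexLT_iff] at *
  rcases h1 with h1 | ⟨h1, h1'⟩ <;> rcases h2 with h2 | ⟨h2, h2'⟩
  · exact Or.inl (h1.trans h2)
  · exact Or.inl (h2 ▸ h1)
  · exact Or.inl (h1 ▸ h2)
  · refine Or.inr ⟨h1.trans h2, ?_⟩
    rw [← sub_add_sub_cancel]
    exact h2'.add h1'

theorem RevLexLT.irrefl {w : Fin N → ℕ} {α : Fin N →₀ ℕ} : ¬ RevLexLT w α α := by
  rw [revLexLT_iff]
  rintro (h | ⟨-, h⟩)
  · exact lt_irrefl _ h
  · exact h.ne_zero (sub_self _)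

theorem RevLexLT.total {w : Fin N → ℕ} {α β : Fin N →₀ ℕ} (h : α ≠ β) :
    RevLexLT w α β ∨ RevLexLT w β α := by
  rw [revLexLT_iff, revLexLT_iff]
  rcases lt_trichotomy (∑ i, w i * α i) (∑ i, w i * β i) with h1 | h1 | h1
  · exact Or.inl (Or.inl h1)
  · rcases lastNeg_or_lastNeg_neg (sub_ne_zero.2 (intExp_injective.ne h.symm)) with h2 | h2
    · exact Or.inl (Or.inr ⟨h1, h2⟩)
    · exact Or.inr (Or.inr ⟨h1.symm, by rwa [neg_sub] at h2⟩)
  · exact Or.inr (Or.inl h1)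

theorem exists_revLexLT_max (w : Fin N → ℕ) (s : Finset (Fin N →₀ ℕ)) (hs : s.Nonempty) :
    ∃ α ∈ s, ∀ β ∈ s, β ≠ α → RevLexLT w β α := by
  classical
  induction hs using Finset.Nonempty.cons_induction with
  | singleton a => exact ⟨a, by simp, by simp⟩
  | cons a s ha hs ih =>
    obtain ⟨α, hα, hmax⟩ := ih
    rcases RevLexLT.total (w := w) (fun h => ha (h ▸ hα) : a ≠ α) with h | h
    · refine ⟨α, by simp [hα], fun β hβ hne => ?_⟩
      rcases Finset.mem_cons.1 hβ with rfl | hβ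
      · exact h
      · exact hmax β hβ hne
    · refine ⟨a, by simp, fun β hβ hne => ?_⟩
      rcases Finset.mem_cons.1 hβ with rfl | hβ
      · exact absurd rfl hne
      · by_cases hβα : β = α
        · exact hβα ▸ h
        · exact (hmax β hβ hβα).trans h

/-- Positive weights bound all exponents, so each monomial has finitely many smaller ones, and their
number is a decreasing measure. -/
theorem wellFounded_revLexLT {w : Fin N → ℕ} (hw : ∀ i, 0 < w i) :
    WellFounded (RevLexLT w) := by
  have hfin : ∀ α : Fin N →₀ ℕ, {β | RevLexLT w β α}.Finite := by
    intro α
    refine (Set.finite_Iic (Finsupp.equivFunOnFinite.symm fun _ => ∑ i, w i * α i)).subset ?_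
    intro β hβ i
    have h1 : ∑ i, w i * β i ≤ ∑ i, w i * α i := by
      rcases hβ with h | h
      · exact h.le
      · exact h.1.le
    calc β i ≤ w i * β i := Nat.le_mul_of_pos_left _ (hw i)
      _ ≤ ∑ i, w i * β i :=
        Finset.single_le_sum (f := fun i => w i * β i) (fun _ _ => Nat.zero_le _)
          (Finset.mem_univ i)
      _ ≤ _ := h1
  refine Subrelation.wf (r := InvImage (· < ·) fun α => {β | RevLexLT w β α}.ncard) ?_
    (InvImage.wf _ wellFounded_lt)
  intro α β h
  refine Set.ncard_lt_ncard ⟨fun γ hγ => RevLexLT.trans hγ h, fun hsub => ?_⟩ (hfin β)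
  exact RevLexLT.irrefl (hsub h)

/-! ### Gröbner bases of lattice ideals -/

/-- For weights orthogonal to `L`, equivalent exponents are compared by their last entries. -/
theorem revLexLT_iff_of_mem {w : Fin N → ℕ} (hL : ∀ u ∈ L, ∑ i, (w i : ℤ) * u i = 0)
    {α β : Fin N →₀ ℕ} (h : intExp N α - intExp N β ∈ L) :
    RevLexLT w β α ↔ LastNeg (intExp N α - intExp N β) := by
  have h1 := hL _ h
  simp only [Pi.sub_apply, intExp_apply, mul_sub, Finset.sum_sub_distrib, sub_eq_zero] at h1
  have h2 : ∑ i, w i * β i = ∑ i, w i * α i := by exact_mod_cast h1.symm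
  rw [revLexLT_iff, h2]
  simp

theorem isLeadingExp_latticeBinomial {w : Fin N → ℕ} (hL : ∀ u ∈ L, ∑ i, (w i : ℤ) * u i = 0)
    {u : Fin N → ℤ} (hu : u ∈ L) (hn : LastNeg u) :
    IsLeadingExp (RevLexLT w) (latticeBinomial K u) (posExp u) := by
  classical
  rw [IsLeadingExp, support_latticeBinomial hn.ne_zero]
  refine ⟨by simp, fun β hβ hne => ?_⟩
  obtain rfl : β = posExp (-u) := by simpa [hne] using hβ
  rw [revLexLT_iff_of_mem hL] <;> rwa [intExp_posExp_sub]

theorem isLeadingExp_neg {lt : (Fin N →₀ ℕ) → (Fin N →₀ ℕ) → Prop} {f : MvPolynomial (Fin N) K}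
    {α : Fin N →₀ ℕ} : IsLeadingExp lt (-f) α ↔ IsLeadingExp lt f α := by
  rw [IsLeadingExp, IsLeadingExp, support_neg]

/-- The set `G` consists of binomials, up to sign, of vectors of `L` with last nonzero entry
negative; their leading exponents generate the initial exponents of the lattice ideal. -/
structure IsBinomialBasis (L : AddSubgroup (Fin N → ℤ)) (G : Set (MvPolynomial (Fin N) K)) :
    Prop where
  finite : G.Finite
  eq_binomial : ∀ g ∈ G, ∃ u ∈ L, LastNeg u ∧ (g = latticeBinomial K u ∨ g = -latticeBinomial K u)
  exists_le : ∀ u ∈ L, LastNeg u → ∃ v ∈ L, LastNeg v ∧ posExp v ≤ posExp u ∧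
    (latticeBinomial K v ∈ G ∨ -latticeBinomial K v ∈ G)

namespace IsBinomialBasis

variable {G : Set (MvPolynomial (Fin N) K)}

theorem subset (hG : IsBinomialBasis L G) : G ⊆ latticeIdeal K L := by
  intro g hg
  obtain ⟨u, hu, -, rfl | rfl⟩ := hG.eq_binomial g hg
  · exact latticeBinomial_mem hu
  · exact neg_mem (latticeBinomial_mem hu)

/-- The leading exponent α of f is equivalent to another exponent β of f, and β < α says that α - β
has last nonzero entry negative. The positive part of α - β is at most α, so the covering property
for this one lattice vector is enough. -/
theorem isGroebnerBasis (hG : IsBinomialBasis L G) {w : Fin N → ℕ}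
    (hL : ∀ u ∈ L, ∑ i, (w i : ℤ) * u i = 0) :
    IsGroebnerBasis (RevLexLT w) G (latticeIdeal K L) := by
  refine ⟨hG.finite, hG.subset, fun f hf hf0 => ?_⟩
  obtain ⟨α, hα, hmax⟩ := exists_revLexLT_max w f.support (support_nonempty.2 hf0)
  obtain ⟨β, hβ, hne, hαβ⟩ :=
    exists_equiv_of_classMap_eq_zero (latticeIdeal_le_ker_classMap hf) hα
  have hn := (revLexLT_iff_of_mem hL hαβ).1 (hmax β hβ hne)
  obtain ⟨v, hv, hvn, hle, hmem⟩ := hG.exists_le _ hαβ hn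
  have hlead := isLeadingExp_latticeBinomial (K := K) hL hv hvn
  have hle' := hle.trans (posExp_intExp_sub_le α β)
  rcases hmem with hmem | hmem
  · exact ⟨_, hmem, α, _, ⟨hα, hmax⟩, hlead, hle'⟩
  · exact ⟨_, hmem, α, _, ⟨hα, hmax⟩, isLeadingExp_neg.2 hlead, hle'⟩

theorem latticeBinomial_mem_span {v : Fin N → ℤ}
    (h : latticeBinomial K v ∈ G ∨ -latticeBinomial K v ∈ G) :
    latticeBinomial K v ∈ Ideal.span G := by
  rcases h with h | h
  · exact Ideal.subset_span h
  · exact neg_mem_iff.1 (Ideal.subset_span h)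

/-- A monomial divisible by a leading monomial is congruent to a smaller one. -/
theorem exists_revLexLT_of_le {w : Fin N → ℕ}
    (hL : ∀ u ∈ L, ∑ i, (w i : ℤ) * u i = 0) {v : Fin N → ℤ} (hv : v ∈ L) (hn : LastNeg v)
    {α : Fin N →₀ ℕ} (hle : posExp v ≤ α) :
    ∃ β, RevLexLT w β α ∧ intExp N α - intExp N β = v ∧
      (monomial α 1 - monomial β 1 : MvPolynomial (Fin N) K) =
        monomial (α - posExp v) 1 * latticeBinomial K v := by
  have h : intExp N α - intExp N (α - posExp v + posExp (-v)) = v := by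
    ext i
    have := hle i
    simp only [Pi.sub_apply, intExp_apply, Finsupp.add_apply, Finsupp.tsub_apply, posExp_apply,
      Pi.neg_apply] at *
    omega
  refine ⟨α - posExp v + posExp (-v), ?_, h, ?_⟩
  · rw [revLexLT_iff_of_mem hL] <;> rwa [h]
  · rw [monomial_sub_monomial_eq, h]

/-- Well-founded induction on the larger of two equivalent monomials: a binomial of G moves it to a
smaller equivalent one. -/
theorem span_eq (hG : IsBinomialBasis L G) {w : Fin N → ℕ} (hw : ∀ i, 0 < w i)
    (hL : ∀ u ∈ L, ∑ i, (w i : ℤ) * u i = 0) : Ideal.span G = latticeIdeal K L := by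
  refine le_antisymm (Ideal.span_le.2 hG.subset) (Ideal.span_le.2 ?_)
  have key : ∀ α : Fin N →₀ ℕ, ∀ β, intExp N α - intExp N β ∈ L → RevLexLT w β α →
      (monomial α 1 - monomial β 1 : MvPolynomial (Fin N) K) ∈ Ideal.span G := by
    intro α
    induction α using (wellFounded_revLexLT hw).induction with
    | _ α ih =>
      intro β hαβ hlt
      obtain ⟨v, hv, hvn, hle, hmem⟩ := hG.exists_le _ hαβ ((revLexLT_iff_of_mem hL hαβ).1 hlt)
      obtain ⟨γ, hγ, hγv, heq⟩ :=
        exists_revLexLT_of_le (K := K) hL hv hvn (hle.trans (posExp_intExp_sub_le α β))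
      have h1 : (monomial α 1 - monomial γ 1 : MvPolynomial (Fin N) K) ∈ Ideal.span G := by
        rw [heq]
        exact Ideal.mul_mem_left _ _ (latticeBinomial_mem_span hmem)
      have hβγ : intExp N γ - intExp N β ∈ L := by
        have : intExp N γ - intExp N β = (intExp N α - intExp N β) - v := by rw [← hγv]; abel
        rw [this]
        exact L.sub_mem hαβ hv
      rw [← sub_add_sub_cancel (monomial α 1) (monomial γ 1) (monomial β 1)]
      refine Ideal.add_mem _ h1 ?_
      -- Both β and γ are below α, so the induction hypothesis applies to whichever of them is
      -- larger.
      by_cases hβγ' : β = γ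
      · rw [hβγ', sub_self]; exact zero_mem _
      · rcases RevLexLT.total (w := w) hβγ' with h | h
        · exact ih γ hγ β hβγ h
        · rw [← neg_sub]
          refine neg_mem (ih β hlt γ ?_ h)
          rw [← neg_sub]; exact L.neg_mem hβγ
  rintro _ ⟨u, hu, rfl⟩
  change latticeBinomial K u ∈ Ideal.span G
  by_cases hu0 : u = 0
  · subst hu0
    rw [latticeBinomial, neg_zero, sub_self]; exact zero_mem _
  have h0 : ∀ u ∈ L, LastNeg u → latticeBinomial K u ∈ Ideal.span G := fun u hu hn => by
    rw [latticeBinomial_eq]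
    refine key _ _ ?_ ?_
    · rwa [intExp_posExp_sub]
    · rw [revLexLT_iff_of_mem hL] <;> rwa [intExp_posExp_sub]
  rcases lastNeg_or_lastNeg_neg hu0 with h | h
  · exact h0 u hu h
  · have := h0 _ (L.neg_mem hu) h
    rwa [latticeBinomial_neg, neg_mem_iff] at this

end IsBinomialBasis

end LatticeIdeals

/-! ### The plane lattice and the fan of the Euclidean algorithm. -/

noncomputable section Fan

namespace SimplicialData

variable {n : ℕ} {H : Type*} [AddCommGroup H] (D : SimplicialData n H)

/-! ### The plane lattice and the lattice of relations -/

/-- The rank two lattice as a subgroup of `ℤ × ℤ`. -/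
def planeSubgroup : AddSubgroup (ℤ × ℤ) where
  carrier := D.planeLattice
  zero_mem' := ⟨0, by simp⟩
  add_mem' := by
    rintro e f ⟨v, hv⟩ ⟨v', hv'⟩
    refine ⟨v + v', ?_⟩
    simp only [Pi.add_apply, add_smul, Finset.sum_add_distrib, ← hv, ← hv', Prod.fst_add,
      Prod.snd_add]
    abel
  neg_mem' := by
    rintro e ⟨v, hv⟩
    refine ⟨-v, ?_⟩
    simp only [Pi.neg_apply, neg_smul, Finset.sum_neg_distrib, ← hv, Prod.fst_neg, Prod.snd_neg]
    abel

/-- The exponents of the variables `x i` that belong to a vector of the plane. -/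
def xPart (e : ℤ × ℤ) (j : Fin n) : ℤ := (e.1 * D.b j - e.2 * D.c j) / D.a j

/-- The vector `(s, -p, -r)` of relations that belongs to `(s, p)`. -/
def relVec (e : ℤ × ℤ) : Fin (n + 2) → ℤ := Fin.cons e.1 (Fin.cons (-e.2) (-D.xPart e))

@[simp] theorem relVec_zero (e : ℤ × ℤ) : D.relVec e 0 = e.1 := rfl

@[simp] theorem relVec_one (e : ℤ × ℤ) : D.relVec e 1 = -e.2 := rfl

@[simp] theorem relVec_succ_succ (e : ℤ × ℤ) (j : Fin n) :
    D.relVec e j.succ.succ = -D.xPart e j := rfl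

theorem sum_smul_degX_fst (v : Fin n → ℤ) (j : Fin n) :
    (∑ i, v i • D.degX i).1 j = v j * D.a j := by
  rw [Prod.fst_sum, Finset.sum_apply, Finset.sum_eq_single j]
  · simp [degX]
  · intro i _ hij
    simp [degX, hij.symm]
  · simp

theorem a_pos (j : Fin n) : (0 : ℤ) < D.a j := by
  have := D.a_ne_zero j
  omega

theorem eq_xPart {e : ℤ × ℤ} {v : Fin n → ℤ}
    (h : e.1 • D.degZ - e.2 • D.degY = ∑ i, v i • D.degX i) : v = D.xPart e := by
  ext j
  have h1 := congrFun (congrArg Prod.fst h) j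
  rw [sum_smul_degX_fst] at h1
  simp only [degZ, degY, Prod.fst_sub, Prod.smul_fst, Pi.sub_apply, Pi.smul_apply, smul_eq_mul]
    at h1
  rw [xPart, h1, Int.mul_ediv_cancel _ (D.a_pos j).ne']

variable {D} in
theorem eq_sum_xPart {e : ℤ × ℤ} (he : e ∈ D.planeSubgroup) :
    e.1 • D.degZ - e.2 • D.degY = ∑ i, D.xPart e i • D.degX i := by
  obtain ⟨v, hv⟩ := he
  rw [← D.eq_xPart hv, hv]

variable {D} in
theorem xPart_mul {e : ℤ × ℤ} (he : e ∈ D.planeSubgroup) (j : Fin n) :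
    D.xPart e j * D.a j = e.1 * D.b j - e.2 * D.c j := by
  rw [← sum_smul_degX_fst, ← eq_sum_xPart he]
  simp [degZ, degY]

variable {D} in
theorem xPart_add {e f : ℤ × ℤ} (he : e ∈ D.planeSubgroup) (hf : f ∈ D.planeSubgroup) :
    D.xPart (e + f) = D.xPart e + D.xPart f := by
  ext j
  have h1 := xPart_mul he j
  have h2 := xPart_mul hf j
  have h3 := xPart_mul (add_mem he hf) j
  refine mul_right_cancel₀ (D.a_pos j).ne' ?_
  rw [h3, Pi.add_apply, add_mul, h1, h2, Prod.fst_add, Prod.snd_add]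
  ring

variable {D} in
theorem xPart_zsmul {e : ℤ × ℤ} (he : e ∈ D.planeSubgroup) (t : ℤ) :
    D.xPart (t • e) = t • D.xPart e := by
  ext j
  have h1 := xPart_mul he j
  have h3 := xPart_mul (zsmul_mem he t) j
  refine mul_right_cancel₀ (D.a_pos j).ne' ?_
  rw [h3, Pi.smul_apply, smul_mul_assoc, h1, Prod.smul_fst, Prod.smul_snd]
  simp only [smul_eq_mul]
  ring

variable {D} in
theorem xPart_sub {e f : ℤ × ℤ} (he : e ∈ D.planeSubgroup) (hf : f ∈ D.planeSubgroup) :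
    D.xPart (e - f) = D.xPart e - D.xPart f := by
  have h := xPart_add he (zsmul_mem hf (-1))
  rw [xPart_zsmul hf] at h
  simpa [sub_eq_add_neg] using h

variable {D} in
theorem xPart_neg {e : ℤ × ℤ} (he : e ∈ D.planeSubgroup) : D.xPart (-e) = -D.xPart e := by
  simpa using xPart_zsmul he (-1)

variable {D} in
theorem relVec_neg {e : ℤ × ℤ} (he : e ∈ D.planeSubgroup) : D.relVec (-e) = -D.relVec e := by
  ext i
  refine Fin.cases ?_ (Fin.cases ?_ fun j => ?_) i
  · rfl
  · rfl
  · simp [xPart_neg he]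

theorem relVec_mem_lattice_iff {e : ℤ × ℤ} : D.relVec e ∈ D.lattice ↔ e ∈ D.planeSubgroup := by
  have h : D.relVec e ∈ D.lattice ↔ e.1 • D.degZ - e.2 • D.degY = ∑ i, D.xPart e i • D.degX i := by
    change ∑ i, D.relVec e i • D.deg i = 0 ↔ _
    rw [Fin.sum_univ_succ, Fin.sum_univ_succ]
    simp only [deg, Fin.cons_zero, Fin.cons_succ, relVec, neg_smul, Pi.neg_apply,
      Finset.sum_neg_distrib]
    rw [← add_assoc, ← sub_eq_add_neg, ← sub_eq_add_neg, sub_eq_zero]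
  rw [h]
  exact ⟨fun h => ⟨_, h⟩, eq_sum_xPart⟩

/-- The vectors a_i e_i are independent, so the entries at z and y determine those at the x_i.
Questions about relations thus become questions about plane vectors. -/
theorem exists_eq_relVec {u : Fin (n + 2) → ℤ} (hu : u ∈ D.lattice) :
    ∃ e ∈ D.planeSubgroup, u = D.relVec e := by
  have h : ∑ i, u i • D.deg i = 0 := hu
  rw [Fin.sum_univ_succ, Fin.sum_univ_succ] at h
  simp only [deg, Fin.cons_zero, Fin.cons_succ] at h
  have h1 : (u 0, -u 1).1 • D.degZ - (u 0, -u 1).2 • D.degY =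
      ∑ i : Fin n, (fun i => -u i.succ.succ) i • D.degX i := by
    simp only [neg_smul, Finset.sum_neg_distrib, sub_neg_eq_add]
    rw [eq_neg_iff_add_eq_zero, ← h, add_assoc]
    rfl
  refine ⟨(u 0, -u 1), ⟨_, h1⟩, ?_⟩
  have h2 := D.eq_xPart h1
  ext i
  refine Fin.cases ?_ (Fin.cases ?_ fun j => ?_) i
  · rfl
  · simp
  · rw [relVec_succ_succ, ← h2, neg_neg]

/-! ### Weights -/

/-- Positive weights for which the lattice ideal is homogeneous. -/
def weight : Fin (n + 2) → ℕ := Fin.cons (∑ i, D.b i) (Fin.cons (∑ i, D.c i) D.a)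

theorem weight_pos (i : Fin (n + 2)) : 0 < D.weight i := by
  refine Fin.cases ?_ (Fin.cases ?_ fun j => ?_) i
  · obtain ⟨j, hj⟩ := D.b_ne_zero
    exact Finset.sum_pos' (fun _ _ => Nat.zero_le _) ⟨j, Finset.mem_univ _, Nat.pos_of_ne_zero hj⟩
  · obtain ⟨j, hj⟩ := D.c_ne_zero
    exact Finset.sum_pos' (fun _ _ => Nat.zero_le _) ⟨j, Finset.mem_univ _, Nat.pos_of_ne_zero hj⟩
  · exact Nat.pos_of_ne_zero (D.a_ne_zero j)

theorem sum_weight_mul {u : Fin (n + 2) → ℤ} (hu : u ∈ D.lattice) :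
    ∑ i, (D.weight i : ℤ) * u i = 0 := by
  obtain ⟨e, he, rfl⟩ := D.exists_eq_relVec hu
  have h : ∀ j, D.xPart e j * D.a j = e.1 * D.b j - e.2 * D.c j := xPart_mul he
  rw [Fin.sum_univ_succ, Fin.sum_univ_succ]
  simp only [weight, Fin.cons_zero, Fin.cons_succ, relVec, Pi.neg_apply, mul_neg]
  simp only [mul_comm ((D.a _ : ℕ) : ℤ), h]
  push_cast
  rw [Finset.sum_neg_distrib, Finset.sum_sub_distrib, ← Finset.mul_sum, ← Finset.mul_sum]
  ring

/-- The lattice contains no nonzero vector without negative entries. -/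
theorem eq_zero_of_nonneg {u : Fin (n + 2) → ℤ} (hu : u ∈ D.lattice) (h0 : ∀ i, 0 ≤ u i) :
    u = 0 := by
  have h := D.sum_weight_mul hu
  rw [Finset.sum_eq_zero_iff_of_nonneg fun i _ => mul_nonneg (by positivity) (h0 i)] at h
  ext i
  rcases mul_eq_zero.1 (h i (Finset.mem_univ _)) with h' | h'
  · exact absurd h' (by exact_mod_cast (D.weight_pos i).ne')
  · exact h'

/-! ### The fan -/

theorem fanStep_iterate (k : ℕ) :
    fanStep^[k] (D.fanStart, D.fanSecond) = (D.fan k, D.fan (k + 1)) := by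
  refine Prod.ext rfl ?_
  change _ = (fanStep^[k + 1] (D.fanStart, D.fanSecond)).1
  rw [Function.iterate_succ_apply']
  rfl

theorem fan_add_two (k : ℕ) : D.fan (k + 2) = D.quot k • D.fan (k + 1) - D.fan k := by
  have h := D.fanStep_iterate (k + 1)
  rw [Function.iterate_succ_apply', fanStep_iterate] at h
  exact (congrArg Prod.snd h).symm

theorem s_add_two (k : ℕ) : D.s (k + 2) = D.quot k * D.s (k + 1) - D.s k := by
  rw [s, fan_add_two]; rfl

theorem p_add_two (k : ℕ) : D.p (k + 2) = D.quot k * D.p (k + 1) - D.p k := by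
  rw [p, fan_add_two]; rfl

theorem r_eq (k : ℕ) : D.r k = D.xPart (D.fan k) := rfl

/-- A step of the Euclidean algorithm. -/
theorem s_step {k : ℕ} (h1 : 0 < D.s (k + 1)) (h2 : D.s (k + 1) < D.s k) :
    2 ≤ D.quot k ∧ 0 ≤ D.s (k + 2) ∧ D.s (k + 2) < D.s (k + 1) := by
  have h1' : (0 : ℚ) < D.s (k + 1) := by exact_mod_cast h1
  have hle : (D.s k : ℚ) ≤ D.quot k * D.s (k + 1) := by
    rw [← div_le_iff₀ h1']; exact Int.le_ceil _
  have hlt : (D.quot k : ℚ) * D.s (k + 1) < D.s k + D.s (k + 1) := by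
    have h := Int.ceil_lt_add_one ((D.s k : ℚ) / D.s (k + 1))
    have h' : (D.quot k : ℚ) * D.s (k + 1) < (D.s k / D.s (k + 1) + 1) * D.s (k + 1) :=
      mul_lt_mul_of_pos_right h h1'
    rwa [add_mul, div_mul_cancel₀ _ h1'.ne', one_mul] at h'
  have hle' : D.s k ≤ D.quot k * D.s (k + 1) := by exact_mod_cast hle
  have hlt' : D.quot k * D.s (k + 1) < D.s k + D.s (k + 1) := by exact_mod_cast hlt
  rw [s_add_two]
  refine ⟨?_, by linarith, by linarith⟩
  by_contra! hq
  nlinarith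

theorem s_ne_zero_of_lt_last {k : ℕ} (hk : k < D.last) : D.s k ≠ 0 := fun h =>
  Nat.notMem_of_lt_sInf (s := {k | D.s k = 0}) hk h

theorem le_nu {k : ℕ} (hk : k ≤ D.last) (h : ∀ j, 0 ≤ D.r k j) : k ≤ D.nu :=
  le_csSup (s := {k | k ≤ D.last ∧ ∀ j, 0 ≤ D.r k j}) ⟨D.last, fun _ h => h.1⟩ ⟨hk, h⟩

theorem exists_r_pos {k : ℕ} (h1 : D.nu ≤ k) (h2 : k < D.mu) : ∃ j, 0 < D.r (k + 1) j := by
  by_contra! h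
  exact absurd (Nat.sInf_le (s := {k | D.nu ≤ k ∧ ∀ j, D.r (k + 1) j ≤ 0}) ⟨h1, h⟩)
    (not_le.2 h2)

section Finite

variable [Finite H]

/-- The order of H kills the torsion part and the product of the `a i` clears the denominators. This
is where finiteness of H enters. -/
theorem exists_pos_smul_mem : ∃ M : ℕ, 0 < M ∧ ∀ e : ℤ × ℤ, (M : ℤ) • e ∈ D.planeSubgroup := by
  classical
  refine ⟨Nat.card H * ∏ i, D.a i, Nat.mul_pos Nat.card_pos
    (Finset.prod_pos fun i _ => Nat.pos_of_ne_zero (D.a_ne_zero i)), fun e => ?_⟩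
  have hH : ∀ x : H, (Nat.card H : ℤ) • x = 0 := fun x => by
    rw [natCast_zsmul, card_nsmul_eq_zero']
  have hP : ∀ j, (∏ i ∈ Finset.univ.erase j, (D.a i : ℤ)) * D.a j = ∏ i, (D.a i : ℤ) := fun j =>
    Finset.prod_erase_mul _ _ (Finset.mem_univ j)
  refine ⟨fun j => (Nat.card H : ℤ) *
    ((∏ i ∈ Finset.univ.erase j, (D.a i : ℤ)) * (e.1 * D.b j - e.2 * D.c j)), ?_⟩
  refine Prod.ext ?_ ?_
  · ext j
    rw [sum_smul_degX_fst]
    simp only [degZ, degY, Prod.fst_sub, Prod.smul_fst, Prod.smul_snd, Pi.sub_apply,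
      Pi.smul_apply, smul_eq_mul]
    push_cast
    rw [← hP j]
    ring
  · rw [Prod.snd_sum]
    simp only [degZ, degY, degX, Prod.snd_sub, Prod.smul_snd, Prod.smul_fst, smul_eq_mul]
    push_cast
    simp only [mul_assoc, mul_zsmul]
    simp only [hH, sub_self, Finset.sum_const_zero]

/-- `sInf` of an empty set of naturals would be 0. A multiple of (1, 0) in the lattice makes the
infimum an attained minimum. -/
theorem fanStart_spec : 0 < D.s 0 ∧ D.p 0 = 0 ∧ D.fan 0 ∈ D.planeSubgroup ∧
    ∀ s : ℤ, 0 < s → (s, (0 : ℤ)) ∈ D.planeSubgroup → D.s 0 ≤ s := by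
  obtain ⟨M, hM, hmem⟩ := D.exists_pos_smul_mem
  have hne : {s : ℕ | 0 < s ∧ ((s : ℤ), (0 : ℤ)) ∈ D.planeLattice}.Nonempty :=
    ⟨M, hM, by simpa using! hmem (1, 0)⟩
  have h := Nat.sInf_mem hne
  refine ⟨Int.natCast_pos.2 h.1, rfl, h.2, fun s hs hs' => ?_⟩
  have : sInf {s : ℕ | 0 < s ∧ ((s : ℤ), (0 : ℤ)) ∈ D.planeLattice} ≤ s.toNat :=
    Nat.sInf_le ⟨by omega, by rwa [Int.toNat_of_nonneg hs.le]⟩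
  change ((sInf {s : ℕ | 0 < s ∧ ((s : ℤ), (0 : ℤ)) ∈ D.planeLattice} : ℕ) : ℤ) ≤ s
  omega

theorem eq_smul_fan_zero {s : ℤ} (hs : (s, (0 : ℤ)) ∈ D.planeSubgroup) :
    ∃ t : ℤ, s = t * D.s 0 := by
  obtain ⟨h0, hp, hmem, hmin⟩ := D.fanStart_spec
  refine ⟨s / D.s 0, ?_⟩
  have h1 : (s % D.s 0, (0 : ℤ)) ∈ D.planeSubgroup := by
    have := sub_mem hs (zsmul_mem hmem (s / D.s 0))
    convert! this using 1
    refine Prod.ext ?_ ?_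
    · change s % D.s 0 = s - (s / D.s 0) * D.s 0
      rw [Int.emod_def]; ring
    · change (0 : ℤ) = 0 - (s / D.s 0) * D.p 0
      rw [hp]; ring
  have h2 := Int.emod_nonneg s h0.ne'
  have h3 := Int.emod_lt_of_pos s h0
  have h4 : s % D.s 0 = 0 := by
    by_contra hne
    exact absurd (hmin _ (lt_of_le_of_ne h2 (Ne.symm hne)) h1) (not_le.2 h3)
  exact (Int.ediv_mul_cancel (Int.dvd_of_emod_eq_zero h4)).symm

theorem fanP_spec : 0 < D.fanP ∧ (∃ s : ℤ, (s, (D.fanP : ℤ)) ∈ D.planeSubgroup) ∧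
    ∀ p : ℤ, 0 < p → (∃ s : ℤ, (s, p) ∈ D.planeSubgroup) → (D.fanP : ℤ) ≤ p := by
  obtain ⟨M, hM, hmem⟩ := D.exists_pos_smul_mem
  have hne : {p : ℕ | 0 < p ∧ ∃ s : ℤ, (s, (p : ℤ)) ∈ D.planeLattice}.Nonempty :=
    ⟨M, hM, 0, by simpa using! hmem (0, 1)⟩
  have h := Nat.sInf_mem hne
  refine ⟨h.1, h.2, fun p hp ⟨s, hs⟩ => ?_⟩
  have : D.fanP ≤ p.toNat :=
    Nat.sInf_le ⟨by omega, s, by rwa [Int.toNat_of_nonneg hp.le]⟩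
  omega

theorem fanSecond_spec : 0 ≤ D.s 1 ∧ D.s 1 < D.s 0 ∧ D.p 1 = D.fanP ∧
    D.fan 1 ∈ D.planeSubgroup := by
  obtain ⟨h0, hp, hmem, hmin⟩ := D.fanStart_spec
  obtain ⟨s, hs⟩ := D.fanP_spec.2.1
  have hne : {s : ℕ | ((s : ℤ), (D.fanP : ℤ)) ∈ D.planeLattice}.Nonempty := by
    refine ⟨(s % D.s 0).toNat, ?_⟩
    change _ ∈ D.planeSubgroup
    rw [Int.toNat_of_nonneg (Int.emod_nonneg s h0.ne')]
    have := sub_mem hs (zsmul_mem hmem (s / D.s 0))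
    convert! this using 1
    refine Prod.ext ?_ ?_
    · change s % D.s 0 = s - (s / D.s 0) * D.s 0
      rw [Int.emod_def]; ring
    · change (D.fanP : ℤ) = D.fanP - (s / D.s 0) * D.p 0
      rw [hp]; ring
  have h := Nat.sInf_mem hne
  have hs1 : D.s 1 = (sInf {s : ℕ | ((s : ℤ), (D.fanP : ℤ)) ∈ D.planeLattice} : ℕ) := rfl
  refine ⟨by rw [hs1]; positivity, ?_, rfl, h⟩
  by_contra! hle
  have hmem1 : D.fan 1 ∈ D.planeSubgroup := h
  -- Subtracting the first fan vector would produce a smaller nonnegative first coordinate.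
  have : sInf {s : ℕ | ((s : ℤ), (D.fanP : ℤ)) ∈ D.planeLattice} ≤ (D.s 1 - D.s 0).toNat := by
    refine Nat.sInf_le ?_
    change _ ∈ D.planeSubgroup
    rw [Int.toNat_of_nonneg (by omega)]
    have := sub_mem hmem1 hmem
    convert! this using 1
  omega

theorem fan_mem (k : ℕ) : D.fan k ∈ D.planeSubgroup := by
  have h : D.fan k ∈ D.planeSubgroup ∧ D.fan (k + 1) ∈ D.planeSubgroup := by
    induction k with
    | zero => exact ⟨D.fanStart_spec.2.2.1, D.fanSecond_spec.2.2.2⟩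
    | succ k ih =>
      refine ⟨ih.2, ?_⟩
      rw [fan_add_two]
      exact sub_mem (zsmul_mem ih.2 _) ih.1
  exact h.1

theorem r_mul (k : ℕ) (j : Fin n) : D.r k j * D.a j = D.s k * D.b j - D.p k * D.c j :=
  xPart_mul (D.fan_mem k) j

/-- Consecutive vectors of the fan generate the lattice. -/
theorem exists_eq_smul_add_smul {e : ℤ × ℤ} (he : e ∈ D.planeSubgroup) (k : ℕ) :
    ∃ α β : ℤ, e = α • D.fan k + β • D.fan (k + 1) := by
  induction k with
  | zero =>
    obtain ⟨hP0, -, hPmin⟩ := D.fanP_spec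
    obtain ⟨-, -, hp1, hmem1⟩ := D.fanSecond_spec
    have hP0' : (0 : ℤ) < D.fanP := by exact_mod_cast hP0
    have hmod : e.2 % D.fanP = 0 := by
      by_contra hne
      refine absurd (hPmin _ (lt_of_le_of_ne (Int.emod_nonneg e.2 hP0'.ne') (Ne.symm hne))
        ⟨(e - (e.2 / D.fanP) • D.fan 1).1, ?_⟩) (not_le.2 (Int.emod_lt_of_pos _ hP0'))
      have := sub_mem he (zsmul_mem hmem1 (e.2 / D.fanP))
      convert! this using 1
      refine Prod.ext rfl ?_
      change e.2 % D.fanP = e.2 - (e.2 / D.fanP) * D.p 1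
      rw [hp1, Int.emod_def]; ring
    have hdiv := Int.ediv_mul_cancel (Int.dvd_of_emod_eq_zero hmod)
    have h1 := sub_mem he (zsmul_mem hmem1 (e.2 / D.fanP))
    have h2 : e - (e.2 / D.fanP) • D.fan 1 = (e.1 - (e.2 / D.fanP) * D.s 1, 0) := by
      refine Prod.ext rfl ?_
      change e.2 - (e.2 / D.fanP) * D.p 1 = 0
      rw [hp1, hdiv, sub_self]
    obtain ⟨t, ht⟩ := D.eq_smul_fan_zero (h2 ▸ h1)
    refine ⟨t, e.2 / D.fanP, ?_⟩
    refine Prod.ext ?_ ?_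
    · change e.1 = t * D.s 0 + (e.2 / D.fanP) * D.s 1
      omega
    · change e.2 = t * D.p 0 + (e.2 / D.fanP) * D.p 1
      rw [hp1, hdiv, D.fanStart_spec.2.1]; ring
  | succ k ih =>
    obtain ⟨α, β, rfl⟩ := ih
    refine ⟨β + α * D.quot k, -α, ?_⟩
    rw [fan_add_two]
    module

theorem exists_s_p_eq {e : ℤ × ℤ} (he : e ∈ D.planeSubgroup) (k : ℕ) :
    ∃ α β : ℤ, e = α • D.fan k + β • D.fan (k + 1) ∧ e.1 = α * D.s k + β * D.s (k + 1) ∧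
      e.2 = α * D.p k + β * D.p (k + 1) := by
  obtain ⟨α, β, h⟩ := D.exists_eq_smul_add_smul he k
  exact ⟨α, β, h, congrArg Prod.fst h, congrArg Prod.snd h⟩

/-- Each step of the algorithm has determinant one. Positivity of this constant is what turns
Cramer's rule into sign statements below. -/
theorem det_eq (k : ℕ) : D.s k * D.p (k + 1) - D.s (k + 1) * D.p k = D.s 0 * D.p 1 := by
  induction k with
  | zero => rw [D.fanStart_spec.2.1]; ring
  | succ k ih => rw [← ih, s_add_two, p_add_two]; ring

theorem det_pos (k : ℕ) : 0 < D.s k * D.p (k + 1) - D.s (k + 1) * D.p k := by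
  rw [det_eq]
  refine mul_pos D.fanStart_spec.1 ?_
  rw [D.fanSecond_spec.2.2.1]
  exact_mod_cast D.fanP_spec.1

theorem exists_s_eq_zero : ∃ k, D.s k = 0 := by
  by_contra! hno
  have h : ∀ k, 0 < D.s (k + 1) ∧ D.s (k + 1) < D.s k ∧ D.s k + k ≤ D.s 0 := by
    intro k
    induction k with
    | zero =>
      obtain ⟨h1, h2, -⟩ := D.fanSecond_spec
      exact ⟨lt_of_le_of_ne h1 (Ne.symm (hno 1)), h2, by simp⟩
    | succ k ih =>
      obtain ⟨-, h2, h3⟩ := D.s_step ih.1 ih.2.1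
      refine ⟨lt_of_le_of_ne h2 (Ne.symm (hno _)), h3, ?_⟩
      have := ih.2.2
      push_cast
      omega
  -- After s₀ strict decreases (Lean index) nothing positive would be left.
  have := h (D.s 0).toNat
  omega

theorem s_last : D.s D.last = 0 := Nat.sInf_mem (s := {k | D.s k = 0}) D.exists_s_eq_zero

theorem s_succ_of_lt_last {k : ℕ} (hk : k < D.last) : 0 ≤ D.s (k + 1) ∧ D.s (k + 1) < D.s k := by
  induction k with
  | zero => exact ⟨D.fanSecond_spec.1, D.fanSecond_spec.2.1⟩
  | succ k ih =>
    have h := ih (by omega)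
    exact (D.s_step (lt_of_le_of_ne h.1 (Ne.symm (D.s_ne_zero_of_lt_last hk))) h.2).2

theorem s_pos {k : ℕ} (hk : k < D.last) : 0 < D.s k := by
  have := D.s_succ_of_lt_last hk
  omega

theorem s_nonneg {k : ℕ} (hk : k ≤ D.last) : 0 ≤ D.s k := by
  rcases hk.lt_or_eq with h | h
  · exact (D.s_pos h).le
  · rw [h, s_last]

theorem two_le_quot {k : ℕ} (hk : k + 1 < D.last) : 2 ≤ D.quot k :=
  (D.s_step (D.s_pos hk) (D.s_succ_of_lt_last (by omega)).2).1

theorem s_antitone {k l : ℕ} (hkl : k ≤ l) (hl : l ≤ D.last) : D.s l ≤ D.s k := by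
  induction l, hkl using Nat.le_induction with
  | base => exact le_rfl
  | succ l _ ih => exact (D.s_succ_of_lt_last (by omega)).2.le.trans (ih (by omega))

theorem last_pos : 0 < D.last := by
  by_contra h
  have h0 : D.last = 0 := by omega
  have := D.s_last
  rw [h0] at this
  exact D.fanStart_spec.1.ne' this

/-- Rounding up makes the quotients at least two, so the differences of consecutive p do not
decrease and stay positive. -/
theorem p_succ_of_lt_last {k : ℕ} (hk : k < D.last) : 0 ≤ D.p k ∧ D.p k < D.p (k + 1) := by
  induction k with
  | zero =>
    rw [D.fanStart_spec.2.1, D.fanSecond_spec.2.2.1]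
    exact ⟨le_rfl, by exact_mod_cast D.fanP_spec.1⟩
  | succ k ih =>
    have h := ih (by omega)
    have h2 := D.two_le_quot hk
    refine ⟨by omega, ?_⟩
    rw [p_add_two]
    nlinarith

theorem p_nonneg {k : ℕ} (hk : k ≤ D.last) : 0 ≤ D.p k := by
  cases k with
  | zero => exact (D.p_succ_of_lt_last D.last_pos).1
  | succ k =>
    have := D.p_succ_of_lt_last (k := k) (by omega)
    omega

theorem p_monotone {k l : ℕ} (hkl : k ≤ l) (hl : l ≤ D.last) : D.p k ≤ D.p l := by
  induction l, hkl using Nat.le_induction with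
  | base => exact le_rfl
  | succ l _ ih => exact (ih (by omega)).trans (D.p_succ_of_lt_last (by omega)).2.le

/-- Along the fan s drops and p grows strictly, and one of b_j, c_j is positive. This monotonicity
is what makes ν and μ thresholds for the signs of all the r_k. -/
theorem r_succ_lt {k : ℕ} (hk : k < D.last) (j : Fin n) : D.r (k + 1) j < D.r k j := by
  have h1 := D.s_succ_of_lt_last hk
  have h2 := D.p_succ_of_lt_last hk
  refine lt_of_mul_lt_mul_right ?_ (D.a_pos j).le
  rw [r_mul, r_mul]
  have hb : (0 : ℤ) ≤ D.b j := by positivity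
  have hc : (0 : ℤ) ≤ D.c j := by positivity
  rcases D.bc_ne_zero j with h | h
  · have : (0 : ℤ) < D.b j := by positivity
    nlinarith
  · have : (0 : ℤ) < D.c j := by positivity
    nlinarith

theorem r_antitone {k l : ℕ} (hkl : k ≤ l) (hl : l ≤ D.last) (j : Fin n) : D.r l j ≤ D.r k j := by
  induction l, hkl using Nat.le_induction with
  | base => exact le_rfl
  | succ l _ ih => exact (D.r_succ_lt (by omega) j).le.trans (ih (by omega))

theorem r_zero_nonneg (j : Fin n) : 0 ≤ D.r 0 j := by
  refine nonneg_of_mul_nonneg_left ?_ (D.a_pos j)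
  rw [r_mul, D.fanStart_spec.2.1, zero_mul, sub_zero]
  exact mul_nonneg D.fanStart_spec.1.le (by positivity)

theorem r_last_nonpos (j : Fin n) : D.r D.last j ≤ 0 := by
  refine nonpos_of_mul_nonpos_left ?_ (D.a_pos j)
  rw [r_mul, D.s_last, zero_mul, zero_sub, neg_nonpos]
  exact mul_nonneg (D.p_nonneg le_rfl) (by positivity)

theorem nu_spec : D.nu ≤ D.last ∧ ∀ j, 0 ≤ D.r D.nu j :=
  Nat.sSup_mem (s := {k | k ≤ D.last ∧ ∀ j, 0 ≤ D.r k j})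
    ⟨0, Nat.zero_le _, D.r_zero_nonneg⟩ ⟨D.last, fun _ h => h.1⟩

theorem r_last_neg : ∃ j, D.r D.last j < 0 := by
  obtain ⟨j, hj⟩ := D.c_ne_zero
  refine ⟨j, neg_of_mul_neg_left ?_ (D.a_pos j).le⟩
  rw [r_mul, D.s_last, zero_mul, zero_sub, neg_lt_zero]
  have h1 := D.p_succ_of_lt_last (k := D.last - 1) (by have := D.last_pos; omega)
  rw [Nat.sub_add_cancel D.last_pos] at h1
  exact mul_pos (by omega) (by positivity)

theorem nu_lt_last : D.nu < D.last := by
  refine lt_of_le_of_ne D.nu_spec.1 fun h => ?_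
  obtain ⟨j, hj⟩ := D.r_last_neg
  have := D.nu_spec.2 j
  rw [h] at this
  omega

theorem mu_set_nonempty : {k | D.nu ≤ k ∧ ∀ j, D.r (k + 1) j ≤ 0}.Nonempty := by
  -- The set defining `mu` tests index `k + 1`, and at `last` all coordinates are nonpositive
  -- because s vanishes there.
  refine ⟨D.last - 1, by have := D.nu_lt_last; omega, ?_⟩
  rw [Nat.sub_add_cancel D.last_pos]
  exact D.r_last_nonpos

theorem nu_le_mu : D.nu ≤ D.mu := (Nat.sInf_mem D.mu_set_nonempty).1

theorem r_mu_succ_nonpos (j : Fin n) : D.r (D.mu + 1) j ≤ 0 := (Nat.sInf_mem D.mu_set_nonempty).2 j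

theorem mu_lt_last : D.mu < D.last := by
  have h : D.mu ≤ D.last - 1 := Nat.sInf_le ⟨by have := D.nu_lt_last; omega, by
    rw [Nat.sub_add_cancel D.last_pos]
    exact D.r_last_nonpos⟩
  have := D.last_pos
  omega

/-- The vectors after `ν` have a negative coordinate. -/
theorem exists_r_neg : ∃ j, D.r (D.nu + 1) j < 0 := by
  by_contra! h
  have := D.le_nu (k := D.nu + 1) (by have := D.nu_lt_last; omega) h
  omega

end Finite

end SimplicialData

end Fan

/-! ### Divisibility of leading monomials, quadrant by quadrant. -/

noncomputable section FanCover

namespace SimplicialData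

variable {n : ℕ} {H : Type*} [AddCommGroup H] {D : SimplicialData n H}

/-- Along the indices the sign of the coordinates changes at most once, from `-` to `+`. -/
theorem xPart_nonneg_of_le (hslope : ∀ i j : Fin n, i ≤ j → D.b i * D.c j ≤ D.b j * D.c i)
    {e : ℤ × ℤ} (he : e ∈ D.planeSubgroup) (h1 : 0 ≤ e.1) (h2 : 0 ≤ e.2) {i j : Fin n}
    (hij : i ≤ j) (hi : 0 < D.xPart e i) : 0 ≤ D.xPart e j := by
  by_contra! hj
  have hi' := mul_pos hi (D.a_pos i)
  have hj' := mul_neg_of_neg_of_pos hj (D.a_pos j)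
  rw [xPart_mul he] at hi' hj'
  have hs : (D.b i : ℤ) * D.c j ≤ D.b j * D.c i := by exact_mod_cast hslope i j hij
  have hci : 0 ≤ e.2 * D.c i := mul_nonneg h2 (by positivity)
  have hbj : 0 ≤ e.1 * D.b j := mul_nonneg h1 (by positivity)
  -- Multiplying p c_i < s b_i by s b_j < p c_j contradicts the slope inequality multiplied by sp.
  have key : (e.2 * D.c i) * (e.1 * D.b j) < (e.1 * D.b i) * (e.2 * D.c j) :=
    mul_lt_mul'' (by linarith) (by linarith) hci hbj
  have := mul_le_mul_of_nonneg_left hs (mul_nonneg h1 h2)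
  linarith

theorem xPart_nonneg_of_nonpos {e : ℤ × ℤ} (he : e ∈ D.planeSubgroup) (h1 : 0 ≤ e.1)
    (h2 : e.2 ≤ 0) (j : Fin n) : 0 ≤ D.xPart e j := by
  refine nonneg_of_mul_nonneg_left ?_ (D.a_pos j)
  rw [xPart_mul he, sub_nonneg]
  exact (mul_nonpos_of_nonpos_of_nonneg h2 (by positivity)).trans
    (mul_nonneg h1 (by positivity))

/-- In this quadrant s b_j and -p c_j are both nonnegative, so each vanishes with their sum; b and c
are nonzero vectors. -/
theorem eq_zero_of_xPart_eq_zero {e : ℤ × ℤ} (he : e ∈ D.planeSubgroup) (h1 : 0 ≤ e.1)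
    (h2 : e.2 ≤ 0) (h : ∀ j, D.xPart e j = 0) : e = 0 := by
  have key : ∀ j, e.1 * D.b j = 0 ∧ e.2 * D.c j = 0 := fun j => by
    have h3 := xPart_mul he j
    rw [h j, zero_mul] at h3
    have hb : 0 ≤ e.1 * D.b j := mul_nonneg h1 (by positivity)
    have hc : e.2 * D.c j ≤ 0 := mul_nonpos_of_nonpos_of_nonneg h2 (by positivity)
    constructor <;> linarith
  obtain ⟨i, hi⟩ := D.b_ne_zero
  obtain ⟨j, hj⟩ := D.c_ne_zero
  refine Prod.ext ?_ ?_
  · exact (mul_eq_zero.1 (key i).1).resolve_right (by exact_mod_cast hi)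
  · exact (mul_eq_zero.1 (key j).2).resolve_right (by exact_mod_cast hj)

/-- The three possible positions of the last nonzero entry. -/
theorem lastNeg_relVec_cases {e : ℤ × ℤ} (h : LastNeg (D.relVec e)) :
    (e.1 < 0 ∧ e.2 = 0 ∧ ∀ j, D.xPart e j = 0) ∨ (0 < e.2 ∧ ∀ j, D.xPart e j = 0) ∨
      ∃ j, 0 < D.xPart e j ∧ ∀ i, j < i → D.xPart e i = 0 := by
  obtain ⟨i, hi, hlast⟩ := h
  revert hi hlast
  refine Fin.cases ?_ (Fin.cases ?_ fun j => ?_) i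
  · intro hi hlast
    refine Or.inl ⟨hi, ?_, fun j => ?_⟩
    · simpa using hlast 1 (by simp)
    · simpa using hlast j.succ.succ (Fin.succ_pos _)
  · intro hi hlast
    refine Or.inr (Or.inl ⟨by simpa using hi, fun j => ?_⟩)
    simpa using hlast j.succ.succ (Fin.succ_lt_succ_iff.2 (Fin.succ_pos _))
  · intro hi hlast
    refine Or.inr (Or.inr ⟨j, by simpa using hi, fun i hji => ?_⟩)
    simpa using hlast i.succ.succ (Fin.succ_lt_succ_iff.2 (Fin.succ_lt_succ_iff.2 hji))

theorem relVec_ne_zero {e : ℤ × ℤ} (h : e ≠ 0) : D.relVec e ≠ 0 := fun h0 => by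
  refine h (Prod.ext ?_ ?_)
  · simpa using congrFun h0 0
  · simpa using congrFun h0 1

/-- If `-e` cannot be of any of the three types, then the last nonzero entry is negative. -/
theorem lastNeg_relVec_of_not_neg {e : ℤ × ℤ} (he : e ∈ D.planeSubgroup) (h0 : e ≠ 0)
    (h1 : ¬ (0 < e.1 ∧ e.2 = 0 ∧ ∀ j, D.xPart e j = 0))
    (h2 : ¬ (e.2 < 0 ∧ ∀ j, D.xPart e j = 0))
    (h3 : ¬ ∃ j, D.xPart e j < 0 ∧ ∀ i, j < i → D.xPart e i = 0) : LastNeg (D.relVec e) := by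
  refine (lastNeg_or_lastNeg_neg (relVec_ne_zero h0)).resolve_right fun h => ?_
  rw [← relVec_neg he] at h
  have := lastNeg_relVec_cases h
  simp only [xPart_neg he, Prod.fst_neg, Prod.snd_neg, Pi.neg_apply, neg_eq_zero, neg_pos,
    neg_lt_zero] at this
  exact this.elim h1 fun h => h.elim h2 h3

theorem lastNeg_relVec_of_nonpos {e : ℤ × ℤ} (he : e ∈ D.planeSubgroup) (h1 : 0 ≤ e.1)
    (h2 : e.2 ≤ 0) (h0 : e ≠ 0) : LastNeg (D.relVec e) := by
  refine lastNeg_relVec_of_not_neg he h0 ?_ ?_ ?_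
  · exact fun h => h0 (eq_zero_of_xPart_eq_zero he h1 h2 h.2.2)
  · exact fun h => h0 (eq_zero_of_xPart_eq_zero he h1 h2 h.2)
  · rintro ⟨j, hj, -⟩
    exact absurd (xPart_nonneg_of_nonpos he h1 h2 j) (not_le.2 hj)

theorem lastNeg_relVec_of_xPart_nonneg {e : ℤ × ℤ} (he : e ∈ D.planeSubgroup) (h1 : 0 ≤ e.1)
    (h2 : 0 ≤ e.2) (h0 : e ≠ 0) (hx : ∀ j, 0 ≤ D.xPart e j) : LastNeg (D.relVec e) := by
  refine lastNeg_relVec_of_not_neg he h0 ?_ ?_ ?_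
  · exact fun h => h0 (eq_zero_of_xPart_eq_zero he h1 h.2.1.le h.2.2)
  · exact fun h => absurd h2 (not_le.2 h.1)
  · rintro ⟨j, hj, -⟩
    exact absurd (hx j) (not_le.2 hj)

/-- The slope order excludes a negative coordinate after a positive one, so the last nonzero
coordinate of the x-part is positive, and `relVec` carries it with a minus sign. The z-side of the
binomial therefore leads. -/
theorem lastNeg_relVec_of_xPart_pos (hslope : ∀ i j : Fin n, i ≤ j → D.b i * D.c j ≤ D.b j * D.c i)
    {e : ℤ × ℤ} (he : e ∈ D.planeSubgroup) (h1 : 0 ≤ e.1)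
    (h2 : 0 ≤ e.2) (hx : ∃ j, 0 < D.xPart e j) : LastNeg (D.relVec e) := by
  obtain ⟨j, hj⟩ := hx
  refine lastNeg_relVec_of_not_neg he ?_ ?_ ?_ ?_
  · rintro rfl
    simp [xPart] at hj
  · exact fun h => hj.ne' (h.2.2 j)
  · exact fun h => hj.ne' (h.2 j)
  · rintro ⟨i, hi, hlast⟩
    by_cases hij : i < j
    · exact hj.ne' (hlast j hij)
    · exact absurd (xPart_nonneg_of_le hslope he h1 h2 (not_lt.1 hij) hj) (not_le.2 hi)

theorem lastNeg_neg_relVec_of_xPart_nonpos {e : ℤ × ℤ} (he : e ∈ D.planeSubgroup)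
    (hx : ∀ j, D.xPart e j ≤ 0) (hx' : ∃ j, D.xPart e j < 0) : LastNeg (-D.relVec e) := by
  obtain ⟨j, hj⟩ := hx'
  have h : LastNeg (D.relVec (-e)) := by
    refine lastNeg_relVec_of_not_neg (neg_mem he) ?_ ?_ ?_ ?_
    · intro h
      rw [neg_eq_zero] at h
      subst h
      simp [xPart] at hj
    · rw [xPart_neg he]
      exact fun h => hj.ne (neg_eq_zero.1 (h.2.2 j))
    · rw [xPart_neg he]
      exact fun h => hj.ne (neg_eq_zero.1 (h.2 j))
    · rw [xPart_neg he]
      rintro ⟨i, hi, -⟩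
      have := hx i
      simp only [Pi.neg_apply] at hi
      omega
  rwa [relVec_neg he] at h

/-! ### Coverings by the vectors of the fan -/

section Finite

variable [Finite H]

/-- Every lattice vector in the first quadrant lies in one of the cones of the fan. -/
theorem exists_cone {e : ℤ × ℤ} (he : e ∈ D.planeSubgroup) (h1 : 0 ≤ e.1) (h2 : 0 ≤ e.2)
    (h0 : e ≠ 0) :
    ∃ k < D.last, ∃ α β : ℤ, 0 ≤ α ∧ 0 ≤ β ∧ 0 < α + β ∧ e.1 = α * D.s k + β * D.s (k + 1) ∧
      e.2 = α * D.p k + β * D.p (k + 1) ∧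
      ∀ j, D.xPart e j = α * D.r k j + β * D.r (k + 1) j := by
  classical
  -- The determinant tests on which side of the ray of `fan (k + 1)` the vector lies. The first such
  -- k gives the cone; the last ray is the p-axis, so the search succeeds.
  have hex : ∃ k, 0 ≤ e.1 * D.p (k + 1) - e.2 * D.s (k + 1) := by
    refine ⟨D.last - 1, ?_⟩
    rw [Nat.sub_add_cancel D.last_pos, s_last, mul_zero, sub_zero]
    exact mul_nonneg h1 (D.p_nonneg le_rfl)
  set k := Nat.find hex with hk
  have hkl : k < D.last := by
    have : k ≤ D.last - 1 := Nat.find_min' hex (by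
      rw [Nat.sub_add_cancel D.last_pos, s_last, mul_zero, sub_zero]
      exact mul_nonneg h1 (D.p_nonneg le_rfl))
    have := D.last_pos
    omega
  have hk1 : 0 ≤ e.1 * D.p (k + 1) - e.2 * D.s (k + 1) := Nat.find_spec hex
  have hk2 : 0 ≤ e.2 * D.s k - e.1 * D.p k := by
    rcases Nat.eq_zero_or_pos k with h | h
    · rw [h, D.fanStart_spec.2.1, mul_zero, sub_zero]
      exact mul_nonneg h2 D.fanStart_spec.1.le
    · have := Nat.find_min hex (m := k - 1) (by omega)
      rw [Nat.sub_add_cancel h] at this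
      linarith
  obtain ⟨α, β, hab, hs, hp⟩ := D.exists_s_p_eq he k
  have hd := D.det_pos k
  have hα : 0 ≤ α := by
    refine nonneg_of_mul_nonneg_left ?_ hd
    rw [hs, hp] at hk1
    linarith
  have hβ : 0 ≤ β := by
    refine nonneg_of_mul_nonneg_left ?_ hd
    rw [hs, hp] at hk2
    linarith
  refine ⟨k, hkl, α, β, hα, hβ, ?_, hs, hp, fun j => ?_⟩
  · by_contra! hle
    have hα0 : α = 0 := by omega
    have hβ0 : β = 0 := by omega
    exact h0 (by rw [hab, hα0, hβ0]; simp)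
  · rw [hab, xPart_add (zsmul_mem (D.fan_mem k) _) (zsmul_mem (D.fan_mem _) _),
      xPart_zsmul (D.fan_mem _), xPart_zsmul (D.fan_mem _)]
    rfl

/-- Cones before ν have generators with larger or equal s. A coordinate at which r_{ν+1} is negative
rules out the later cones and forces ε_ν to occur in its own cone. -/
theorem s_nu_le {e : ℤ × ℤ} (he : e ∈ D.planeSubgroup) (h1 : 0 ≤ e.1) (h2 : 0 ≤ e.2)
    (h0 : e ≠ 0) (hx : ∀ j, 0 ≤ D.xPart e j) : D.s D.nu ≤ e.1 := by
  obtain ⟨k, hk, α, β, hα, hβ, hαβ, hs, hp, hr⟩ := exists_cone he h1 h2 h0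
  obtain ⟨j, hj⟩ := D.exists_r_neg
  have hxj := hx j
  rw [hr] at hxj
  have hnl := D.nu_lt_last
  have hs1 := D.s_nonneg (k := k + 1) (by omega)
  rw [hs]
  rcases lt_trichotomy k D.nu with h | h | h
  · have h3 := D.s_antitone (k := k) (l := D.nu) (by omega) hnl.le
    have h4 := D.s_antitone (k := k + 1) (l := D.nu) (by omega) hnl.le
    have h5 := D.s_pos hnl
    nlinarith
  · rw [h] at hxj hs1 ⊢
    have h5 := D.s_pos hnl
    have hα1 : 1 ≤ α := by
      by_contra! hlt
      have hα0 : α = 0 := by omega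
      have hβ1 : 0 < β := by omega
      rw [hα0] at hxj
      nlinarith
    nlinarith
  · have h3 := D.r_antitone (k := D.nu + 1) (l := k) (by omega) hk.le j
    have h4 := D.r_antitone (k := D.nu + 1) (l := k + 1) (by omega) (by omega) j
    nlinarith

theorem exists_r_pos_of_le_mu (hnm : D.nu < D.mu) : ∃ j, ∀ k ≤ D.mu, 0 < D.r k j := by
  obtain ⟨j, hj⟩ := D.exists_r_pos (k := D.mu - 1) (by omega) (by omega)
  rw [Nat.sub_add_cancel (by omega)] at hj
  exact ⟨j, fun k hk => hj.trans_le (D.r_antitone hk D.mu_lt_last.le j)⟩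

/-- It suffices that the cone expansion uses some ε_k with k > μ, as p increases. Otherwise only
vectors up to ε_μ occur: if ν < μ they share a positive coordinate, and if ν = μ all their
coordinates are nonnegative. -/
theorem p_mu_succ_le {e : ℤ × ℤ} (he : e ∈ D.planeSubgroup) (h1 : 0 ≤ e.1) (h2 : 0 ≤ e.2)
    (hx : ∀ j, D.xPart e j ≤ 0) (hx' : ∃ j, D.xPart e j < 0) : D.p (D.mu + 1) ≤ e.2 := by
  have h0 : e ≠ 0 := by
    rintro rfl
    obtain ⟨j, hj⟩ := hx'
    simp [xPart] at hj
  obtain ⟨k, hk, α, β, hα, hβ, hαβ, hs, hp, hr⟩ := exists_cone he h1 h2 h0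
  have hml := D.mu_lt_last
  have hp0 := D.p_nonneg hk.le
  have hp1 := D.p_succ_of_lt_last hk
  have hpm : 0 ≤ D.p (D.mu + 1) := D.p_nonneg (by omega)
  rw [hp]
  rcases lt_or_ge D.mu k with h | h
  · have h3 := D.p_monotone (k := D.mu + 1) (l := k) (by omega) hk.le
    nlinarith
  · by_cases hk' : k = D.mu ∧ 1 ≤ β
    · obtain ⟨rfl, hβ1⟩ := hk'
      nlinarith
    · exfalso
      rcases D.nu_le_mu.lt_or_eq with hnm | hnm
      · obtain ⟨j, hj⟩ := exists_r_pos_of_le_mu hnm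
        have h3 := hx j
        rw [hr] at h3
        have h4 := hj k h
        by_cases hkm : k = D.mu
        · have hβ0 : β = 0 := by
            by_contra hne
            exact hk' ⟨hkm, by omega⟩
          rw [hβ0] at h3 hαβ
          nlinarith
        · have h5 := hj (k + 1) (by omega)
          nlinarith
      · obtain ⟨j, hj⟩ := hx'
        have h4 := D.nu_spec.2 j
        have h5 := D.r_antitone (k := k) (l := D.nu) (by omega) D.nu_spec.1 j
        rw [hr] at hj
        by_cases hkm : k = D.mu
        · have hβ0 : β = 0 := by
            by_contra hne
            exact hk' ⟨hkm, by omega⟩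
          rw [hβ0] at hj
          nlinarith
        · have h6 := D.r_antitone (k := k + 1) (l := D.nu) (by omega) D.nu_spec.1 j
          nlinarith

/-- Mixed signs force the cone to lie between ν and μ. Its first generator works if it occurs in the
expansion, because r_{k+1} is even more negative wherever r_k is negative. Otherwise the vector is a
multiple of the second generator. -/
theorem exists_ray_le {e : ℤ × ℤ} (he : e ∈ D.planeSubgroup) (h1 : 0 ≤ e.1) (h2 : 0 ≤ e.2)
    (hx : ∃ j, D.xPart e j < 0) (hx' : ∃ j, 0 < D.xPart e j) :
    ∃ k, D.nu ≤ k ∧ k ≤ D.mu ∧ D.s k ≤ e.1 ∧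
      ∀ j, D.r k j < 0 → D.xPart e j ≤ D.r k j := by
  have h0 : e ≠ 0 := by
    rintro rfl
    obtain ⟨j, hj⟩ := hx
    simp [xPart] at hj
  obtain ⟨k, hk, α, β, hα, hβ, hαβ, hs, hp, hr⟩ := exists_cone he h1 h2 h0
  have hml := D.mu_lt_last
  have hnl := D.nu_lt_last
  obtain ⟨i, hi⟩ := hx
  obtain ⟨j, hj⟩ := hx'
  rw [hr] at hi hj
  have hs0 := D.s_nonneg hk.le
  have hs1 := D.s_nonneg (k := k + 1) (by omega)
  have hnk : D.nu ≤ k := by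
    by_contra! h
    have h3 := D.r_antitone (k := k) (l := D.nu) (by omega) hnl.le i
    have h4 := D.r_antitone (k := k + 1) (l := D.nu) (by omega) hnl.le i
    have h5 := D.nu_spec.2 i
    nlinarith
  have hkm : k ≤ D.mu := by
    by_contra! h
    have h3 := D.r_antitone (k := D.mu + 1) (l := k) (by omega) hk.le j
    have h4 := D.r_antitone (k := D.mu + 1) (l := k + 1) (by omega) (by omega) j
    have h5 := D.r_mu_succ_nonpos j
    nlinarith
  rcases hα.lt_or_eq with hα1 | hα0
  · refine ⟨k, hnk, hkm, by nlinarith, fun l hl => ?_⟩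
    have h3 := D.r_succ_lt hk l
    rw [hr]
    nlinarith
  · rw [← hα0] at hj hαβ hs
    have hkm' : k ≠ D.mu := by
      rintro rfl
      have := D.r_mu_succ_nonpos j
      nlinarith
    refine ⟨k + 1, by omega, by omega, by nlinarith, fun l hl => ?_⟩
    rw [hr, ← hα0]
    nlinarith

/-- The minimal vectors `ε_k - t ε_{k+1}` of the fourth quadrant. -/
theorem exists_mixed_le {e : ℤ × ℤ} (he : e ∈ D.planeSubgroup) (h1 : 0 ≤ e.1) (h2 : e.2 ≤ 0)
    (h0 : e ≠ 0) (hs : e.1 < D.s D.nu) (hp : -e.2 < D.p (D.mu + 1)) :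
    ∃ k t, D.nu ≤ k ∧ k ≤ D.mu ∧ 1 ≤ t ∧ (k < D.mu → t ≤ D.quot k - 1) ∧ (k = D.mu → t = 1) ∧
      D.s k - t * D.s (k + 1) ≤ e.1 ∧ t * D.p (k + 1) - D.p k ≤ -e.2 := by
  classical
  have hml := D.mu_lt_last
  -- In every fan basis, a fourth-quadrant vector has coefficients of opposite signs.
  have expand : ∀ k < D.last, ∃ α γ : ℤ, 0 ≤ α ∧ 0 ≤ γ ∧ 0 < α + γ ∧
      e.1 = α * D.s k - γ * D.s (k + 1) ∧ -e.2 = γ * D.p (k + 1) - α * D.p k := by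
    intro k hk
    obtain ⟨α, β, hab, hs, hp⟩ := D.exists_s_p_eq he k
    have hd := D.det_pos k
    have hp0 := D.p_succ_of_lt_last hk
    have hs0 := D.s_succ_of_lt_last hk
    have hα : 0 ≤ α := by
      refine nonneg_of_mul_nonneg_left ?_ hd
      have : α * (D.s k * D.p (k + 1) - D.s (k + 1) * D.p k) =
          e.1 * D.p (k + 1) + (-e.2) * D.s (k + 1) := by rw [hs, hp]; ring
      rw [this]
      exact add_nonneg (mul_nonneg h1 (by omega)) (mul_nonneg (by omega) hs0.1)
    have hβ : 0 ≤ -β := by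
      refine nonneg_of_mul_nonneg_left ?_ hd
      have : -β * (D.s k * D.p (k + 1) - D.s (k + 1) * D.p k) =
          e.1 * D.p k + (-e.2) * D.s k := by rw [hs, hp]; ring
      rw [this]
      exact add_nonneg (mul_nonneg h1 hp0.1) (mul_nonneg (by omega) (by omega))
    refine ⟨α, -β, hα, hβ, ?_, by rw [hs]; ring, by rw [hp]; ring⟩
    by_contra! hle
    have hα0 : α = 0 := by omega
    have hβ0 : β = 0 := by omega
    exact h0 (by rw [hab, hα0, hβ0]; simp)
  have hpm := D.p_succ_of_lt_last hml
  have hsm := D.s_succ_of_lt_last hml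
  rcases lt_or_ge e.1 (D.s (D.mu + 1)) with hlt | hge
  -- The bounds s < s_{μ+1} and -p < p_{μ+1} force γ = α, so the vector is a positive multiple of
  -- ε_μ - ε_{μ+1}.
  · obtain ⟨α, γ, hα, hγ, hαγ, hs1, hp1⟩ := expand D.mu hml
    refine ⟨D.mu, 1, D.nu_le_mu, le_rfl, le_rfl, fun h => absurd h (lt_irrefl _), fun _ => rfl, ?_⟩
    have hα1 : 1 ≤ α := by
      by_contra! hlt
      have hα0 : α = 0 := by omega
      rw [hα0] at hp1 hαγ
      nlinarith
    have hγα : α ≤ γ := by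
      by_contra! hlt
      have : (γ + 1) * D.s (D.mu + 1) ≤ α * D.s D.mu :=
        mul_le_mul (by omega) hsm.2.le hsm.1 hα
      nlinarith
    have hγα' : γ = α := by
      by_contra hne
      have : α + 1 ≤ γ := by omega
      nlinarith
    rw [hγα'] at hs1 hp1
    constructor <;> nlinarith
  -- The first such k locates s in the interval from s_{k+1} to s_k, which decides the family.
  · have hex : ∃ k, D.nu ≤ k ∧ D.s (k + 1) ≤ e.1 := ⟨D.mu, D.nu_le_mu, hge⟩
    set k := Nat.find hex with hk
    obtain ⟨hnk, hsk1⟩ : D.nu ≤ k ∧ D.s (k + 1) ≤ e.1 := Nat.find_spec hex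
    have hkm : k ≤ D.mu := Nat.find_min' hex ⟨D.nu_le_mu, hge⟩
    have hsk : e.1 < D.s k := by
      rcases hnk.lt_or_eq with h | h
      · have := Nat.find_min hex (m := k - 1) (by omega)
        rw [Nat.sub_add_cancel (by omega)] at this
        by_contra! hle
        exact this ⟨by omega, hle⟩
      · rwa [← h]
    clear_value k
    have hkl : k < D.last := by omega
    obtain ⟨α, γ, hα, hγ, hαγ, hs1, hp1⟩ := expand k hkl
    have hpk := D.p_succ_of_lt_last hkl
    have hssk := D.s_succ_of_lt_last hkl
    have hα1 : 1 ≤ α := by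
      by_contra! hlt
      have hα0 : α = 0 := by omega
      rw [hα0] at hp1 hs1 hαγ
      have hs0 : D.s (k + 1) = 0 := by nlinarith
      have hkm' : k = D.mu := by
        by_contra hne
        exact D.s_ne_zero_of_lt_last (k := k + 1) (by omega) hs0
      rw [hkm'] at hp1
      nlinarith
    have hspos : 0 < D.s (k + 1) := by
      refine lt_of_le_of_ne hssk.1 fun h => ?_
      rw [← h] at hs1
      nlinarith
    -- The least t for which z^{s_k - t s_{k+1}} divides z^s. The witness is a ceiling written as a
    -- negated floor.
    obtain ⟨t, ht1, ht2⟩ : ∃ t, D.s k - e.1 ≤ t * D.s (k + 1) ∧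
        (t - 1) * D.s (k + 1) < D.s k - e.1 := by
      refine ⟨-((e.1 - D.s k) / D.s (k + 1)), ?_, ?_⟩
      · have := Int.ediv_mul_le (e.1 - D.s k) hspos.ne'
        linarith
      · have := Int.lt_ediv_add_one_mul_self (e.1 - D.s k) hspos
        linarith
    have ht : 1 ≤ t := by
      by_contra! hlt
      nlinarith
    have htγ : t ≤ γ - α + 1 := by
      by_contra! hlt
      have h3 : (γ - (α - 1)) * D.s (k + 1) ≤ (t - 1) * D.s (k + 1) :=
        mul_le_mul_of_nonneg_right (by omega) hssk.1
      have h4 : (α - 1) * D.s (k + 1) ≤ (α - 1) * D.s k :=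
        mul_le_mul_of_nonneg_left hssk.2.le (by omega)
      linarith
    have hpt : t * D.p (k + 1) - D.p k ≤ -e.2 := by
      rw [hp1]
      have h3 : (α - 1) * D.p (k + 1) ≤ (γ - t) * D.p (k + 1) :=
        mul_le_mul_of_nonneg_right (by omega) (by omega)
      have h4 : (α - 1) * D.p k ≤ (α - 1) * D.p (k + 1) :=
        mul_le_mul_of_nonneg_left hpk.2.le (by omega)
      linarith
    -- For k < μ, minimality of t and s_{k+1} ≤ s give t s_{k+1} < s_k + s_{k+1} - s ≤ s_k ≤ q
    -- s_{k+1}. For k = μ, t ≥ 2 would make the power of y reach p_{μ+1}.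
    refine ⟨k, t, hnk, hkm, ht, fun hlt => ?_, fun heq => ?_, by linarith, hpt⟩
    · have h3 := D.s_nonneg (k := k + 2) (by omega)
      rw [s_add_two] at h3
      have h4 : t * D.s (k + 1) < D.quot k * D.s (k + 1) := by linarith
      have := lt_of_mul_lt_mul_right h4 hspos.le
      omega
    · subst heq
      by_contra hne
      have : 2 * D.p (D.mu + 1) ≤ t * D.p (D.mu + 1) :=
        mul_le_mul_of_nonneg_right (by omega) (by omega)
      linarith

end Finite

end SimplicialData

end FanCover

/-! ### The explicit binomials: Gröbner property and count. -/

noncomputable section FanBinomials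

namespace SimplicialData

variable {n : ℕ} {H : Type*} [AddCommGroup H] {D : SimplicialData n H} {K : Type*} [Field K]

theorem mono_congr {s p s' p' : ℤ} {v v' : Fin n → ℤ} (hs : s.toNat = s'.toNat)
    (hp : p.toNat = p'.toNat) (hv : ∀ j, (v j).toNat = (v' j).toNat) :
    mono n K s p v = mono n K s' p' v' := by
  simp only [mono, hs, hp, hv]

theorem posMonomial_eq_mono (u : Fin (n + 2) → ℤ) :
    posMonomial K u = mono n K (u 0) (u 1) fun j => u j.succ.succ := by
  rw [posMonomial, Fin.prod_univ_succ, Fin.prod_univ_succ, mono, mul_assoc]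
  rfl

theorem latticeBinomial_relVec (e : ℤ × ℤ) :
    latticeBinomial K (D.relVec e) =
      mono n K e.1 (-e.2) (-D.xPart e) - mono n K (-e.1) e.2 (D.xPart e) := by
  rw [latticeBinomial, posMonomial_eq_mono, posMonomial_eq_mono]
  simp only [Pi.neg_apply, relVec_zero, relVec_one, relVec_succ_succ, neg_neg]
  rfl

/-- The vector `ε_k - t ε_{k+1}` of the fourth quadrant. -/
def mixedVec (D : SimplicialData n H) (k : ℕ) (t : ℤ) : ℤ × ℤ := D.fan k - t • D.fan (k + 1)

theorem mixedVec_fst (k : ℕ) (t : ℤ) : (D.mixedVec k t).1 = D.s k - t * D.s (k + 1) := rfl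

theorem mixedVec_snd (k : ℕ) (t : ℤ) : (D.mixedVec k t).2 = D.p k - t * D.p (k + 1) := rfl

/-- The last vector for `k` is the first one for `k + 1`. -/
theorem mixedVec_quot_sub_one (k : ℕ) : D.mixedVec k (D.quot k - 1) = D.mixedVec (k + 1) 1 := by
  rw [mixedVec, mixedVec, fan_add_two]
  module

/-- The vectors of the generators with indices below `m`. -/
def genVec (D : SimplicialData n H) (m : ℕ) : Set (ℤ × ℤ) :=
  {D.fan D.nu, D.mixedVec D.nu 1, D.fan (D.nu + 1)} ∪
    ⋃ k ∈ Set.Ico D.nu m, (D.mixedVec k '' Set.Icc 2 (D.quot k - 1) ∪ {D.fan (k + 2)})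

theorem genVec_succ {m : ℕ} (hm : D.nu ≤ m) :
    D.genVec (m + 1) = D.genVec m ∪
      (D.mixedVec m '' Set.Icc 2 (D.quot m - 1) ∪ {D.fan (m + 2)}) := by
  have : Set.Ico D.nu (m + 1) = Set.Ico D.nu m ∪ {m} := by
    ext k
    simp only [Set.mem_Ico, Set.mem_union, Set.mem_singleton_iff]
    omega
  rw [genVec, genVec, this, Set.biUnion_union, Set.biUnion_singleton, Set.union_assoc]

theorem genVec_nu :
    D.genVec D.nu = {D.fan D.nu, D.mixedVec D.nu 1, D.fan (D.nu + 1)} := by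
  simp [genVec]

theorem fan_mem_genVec {k : ℕ} (h1 : D.nu ≤ k) (h2 : k ≤ D.mu + 1) : D.fan k ∈ D.genVec D.mu := by
  by_cases hk : k = D.nu
  · exact Or.inl (by simp [hk])
  by_cases hk' : k = D.nu + 1
  · exact Or.inl (by simp [hk'])
  · refine Or.inr (Set.mem_iUnion₂.2 ⟨k - 2, ⟨by omega, by omega⟩, Or.inr ?_⟩)
    rw [Nat.sub_add_cancel (by omega)]; rfl

section Finite

variable [Finite H]

theorem mixedVec_mem (k : ℕ) (t : ℤ) : D.mixedVec k t ∈ D.planeSubgroup :=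
  sub_mem (D.fan_mem k) (zsmul_mem (D.fan_mem _) t)

theorem xPart_mixedVec (k : ℕ) (t : ℤ) :
    D.xPart (D.mixedVec k t) = D.r k - t • D.r (k + 1) := by
  rw [mixedVec, xPart_sub (D.fan_mem k) (zsmul_mem (D.fan_mem _) t), xPart_zsmul (D.fan_mem _)]
  rfl

theorem mixedVec_fst_nonneg {k : ℕ} (hk : k < D.last) {t : ℤ} (ht : 1 ≤ t)
    (ht' : t = 1 ∨ k + 1 < D.last ∧ t ≤ D.quot k - 1) : 0 < (D.mixedVec k t).1 := by
  rw [mixedVec_fst]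
  have h1 := D.s_succ_of_lt_last hk
  rcases ht' with rfl | ⟨hk', ht'⟩
  · linarith
  · have h2 := D.s_succ_of_lt_last hk'
    rw [s_add_two] at h2
    have : t * D.s (k + 1) ≤ (D.quot k - 1) * D.s (k + 1) :=
      mul_le_mul_of_nonneg_right ht' h1.1
    linarith

theorem mixedVec_snd_neg {k : ℕ} (hk : k < D.last) {t : ℤ} (ht : 1 ≤ t) :
    (D.mixedVec k t).2 < 0 := by
  rw [mixedVec_snd]
  have h1 := D.p_succ_of_lt_last hk
  nlinarith

theorem mixedVec_ne_zero {k : ℕ} (hk : k < D.last) {t : ℤ} (ht : 1 ≤ t) : D.mixedVec k t ≠ 0 :=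
  fun h => by simpa [h] using mixedVec_snd_neg hk ht

theorem fan_ne_zero (k : ℕ) : D.fan k ≠ 0 := by
  intro h
  have h1 : D.s k = 0 := congrArg Prod.fst h
  have h2 : D.p k = 0 := congrArg Prod.snd h
  have h3 := D.det_pos k
  rw [h1, h2] at h3
  simp at h3

theorem rayBinomial_eq {k : ℕ} (hk : k ≤ D.last) :
    D.rayBinomial K k = latticeBinomial K (D.relVec (D.fan k)) := by
  have h1 : 0 ≤ (D.fan k).1 := D.s_nonneg hk
  have h2 : 0 ≤ (D.fan k).2 := D.p_nonneg hk
  rw [rayBinomial, latticeBinomial_relVec]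
  congr 1
  · refine mono_congr rfl (by omega) fun j => ?_
    simp only [minus, r_eq, Pi.neg_apply]
    omega
  · refine mono_congr (by omega) rfl fun j => ?_
    simp only [plus, r_eq]
    omega

theorem polyF_eq : D.polyF K = latticeBinomial K (D.relVec (D.fan D.nu)) := by
  have h1 : 0 ≤ (D.fan D.nu).1 := D.s_nonneg D.nu_spec.1
  have h2 : 0 ≤ (D.fan D.nu).2 := D.p_nonneg D.nu_spec.1
  rw [polyF, latticeBinomial_relVec]
  congr 1
  · refine mono_congr rfl (by omega) fun j => ?_
    have := D.nu_spec.2 j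
    simp only [r_eq, Pi.neg_apply, Pi.zero_apply] at *
    omega
  · exact mono_congr (by omega) rfl fun j => rfl

theorem polyG_eq (h : D.mu = D.nu) :
    D.polyG K = -latticeBinomial K (D.relVec (D.fan (D.nu + 1))) := by
  have hl := D.nu_lt_last
  have h1 : 0 ≤ (D.fan (D.nu + 1)).1 := D.s_nonneg (by omega)
  have h2 : 0 ≤ (D.fan (D.nu + 1)).2 := D.p_nonneg (by omega)
  rw [polyG, latticeBinomial_relVec, neg_sub]
  congr 1
  · refine mono_congr (by omega) rfl fun j => ?_
    have := D.r_mu_succ_nonpos j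
    rw [h] at this
    simp only [r_eq, Pi.zero_apply] at *
    omega
  · exact mono_congr rfl (by omega) fun j => rfl

theorem mixedBinomial_eq {k : ℕ} (hk : k < D.last) {t : ℤ} (ht : 1 ≤ t)
    (ht' : t = 1 ∨ k + 1 < D.last ∧ t ≤ D.quot k - 1) :
    D.mixedBinomial K k t = latticeBinomial K (D.relVec (D.mixedVec k t)) := by
  have h1 := mixedVec_fst_nonneg hk ht ht'
  have h2 := mixedVec_snd_neg hk ht
  have h3 := xPart_nonneg_of_nonpos (mixedVec_mem k t) h1.le h2.le
  rw [mixedBinomial, latticeBinomial_relVec, ← xPart_mixedVec, ← mixedVec_fst]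
  congr 1
  · refine mono_congr rfl ?_ fun j => ?_
    · rw [mixedVec_snd, neg_sub]
    · have := h3 j
      simp only [Pi.neg_apply, Pi.zero_apply]
      omega
  · exact mono_congr (by omega) (by omega) fun j => rfl

theorem polyH_eq : D.polyH K = latticeBinomial K (D.relVec (D.mixedVec D.nu 1)) := by
  rw [← mixedBinomial_eq D.nu_lt_last le_rfl (Or.inl rfl)]
  simp [polyH, mixedBinomial]

/-- From ν to μ the z-side of the ray binomial leads. At `mu + 1` no coordinate is positive, the
y-side leads, and signs must be reversed. -/
theorem fan_coverage (hslope : ∀ i j : Fin n, i ≤ j → D.b i * D.c j ≤ D.b j * D.c i) {k : ℕ}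
    (h1 : D.nu ≤ k) (h2 : k ≤ D.mu) : LastNeg (D.relVec (D.fan k)) := by
  have hl := D.mu_lt_last
  have hs : 0 ≤ (D.fan k).1 := D.s_nonneg (by omega)
  have hp : 0 ≤ (D.fan k).2 := D.p_nonneg (by omega)
  rcases h1.lt_or_eq with h | rfl
  · obtain ⟨j, hj⟩ := exists_r_pos_of_le_mu (D := D) (by omega)
    exact lastNeg_relVec_of_xPart_pos hslope (D.fan_mem k) hs hp ⟨j, hj k h2⟩
  · exact lastNeg_relVec_of_xPart_nonneg (D.fan_mem _) hs hp (fan_ne_zero _)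
      D.nu_spec.2

theorem lastNeg_neg_relVec_fan : LastNeg (-D.relVec (D.fan (D.mu + 1))) := by
  have hl := D.mu_lt_last
  have hn := D.nu_le_mu
  refine lastNeg_neg_relVec_of_xPart_nonpos (D.fan_mem _) D.r_mu_succ_nonpos ?_
  obtain ⟨j, hj⟩ := D.exists_r_neg
  exact ⟨j, (D.r_antitone (k := D.nu + 1) (l := D.mu + 1) (by omega) (by omega) j).trans_lt hj⟩

/-- Sufficient conditions for a set of binomials to be a basis. -/
theorem isBinomialBasis_of_fan
    (hslope : ∀ i j : Fin n, i ≤ j → D.b i * D.c j ≤ D.b j * D.c i)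
    {G : Set (MvPolynomial (Fin (n + 2)) K)} (hfin : G.Finite)
    (hG : ∀ g ∈ G, (∃ k, D.nu ≤ k ∧ k ≤ D.mu + 1 ∧
      (g = latticeBinomial K (D.relVec (D.fan k)) ∨
        g = -latticeBinomial K (D.relVec (D.fan k)))) ∨
      ∃ k t, k < D.last ∧ 1 ≤ t ∧ (t = 1 ∨ k + 1 < D.last ∧ t ≤ D.quot k - 1) ∧
        g = latticeBinomial K (D.relVec (D.mixedVec k t)))
    (hray : ∀ k, D.nu ≤ k → k ≤ D.mu + 1 → latticeBinomial K (D.relVec (D.fan k)) ∈ G ∨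
      -latticeBinomial K (D.relVec (D.fan k)) ∈ G)
    (hmixed : ∀ k t, D.nu ≤ k → k ≤ D.mu → 1 ≤ t → (k < D.mu → t ≤ D.quot k - 1) →
      (k = D.mu → t = 1) → latticeBinomial K (D.relVec (D.mixedVec k t)) ∈ G) :
    IsBinomialBasis D.lattice G := by
  have hml := D.mu_lt_last
  have hfan : ∀ k, D.relVec (D.fan k) ∈ D.lattice := fun k =>
    D.relVec_mem_lattice_iff.2 (D.fan_mem k)
  have hmix : ∀ k t, D.relVec (D.mixedVec k t) ∈ D.lattice := fun k t =>
    D.relVec_mem_lattice_iff.2 (mixedVec_mem k t)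
  refine ⟨hfin, fun g hg => ?_, fun u hu hun => ?_⟩
  · rcases hG g hg with ⟨k, hk1, hk2, hgk⟩ | ⟨k, t, hk, ht, ht', rfl⟩
    · by_cases hk : k ≤ D.mu
      · exact ⟨_, hfan k, fan_coverage hslope hk1 hk, hgk⟩
      · obtain rfl : k = D.mu + 1 := by omega
        refine ⟨_, D.lattice.neg_mem (hfan _), lastNeg_neg_relVec_fan, ?_⟩
        rw [latticeBinomial_neg, neg_neg]
        exact hgk.symm
    · exact ⟨_, hmix k t, lastNeg_relVec_of_nonpos (mixedVec_mem k t)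
        (mixedVec_fst_nonneg hk ht ht').le (mixedVec_snd_neg hk ht).le (mixedVec_ne_zero hk ht),
        Or.inl rfl⟩
  · obtain ⟨e, he, rfl⟩ := D.exists_eq_relVec hu
    have he0 : e ≠ 0 := by
      rintro rfl
      refine hun.ne_zero ?_
      ext i
      refine Fin.cases rfl (Fin.cases rfl fun j => ?_) i
      simp [xPart]
    have le_of : ∀ v : Fin (n + 2) → ℤ, (v 0).toNat ≤ e.1.toNat → (v 1).toNat ≤ (-e.2).toNat →
        (∀ j : Fin n, (v j.succ.succ).toNat ≤ (-D.xPart e j).toNat) →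
        posExp v ≤ posExp (D.relVec e) := by
      intro v hv0 hv1 hv i
      exact Fin.cases hv0 (Fin.cases hv1 hv) i
    have useRay : ∀ k, D.nu ≤ k → k ≤ D.mu → D.s k ≤ e.1 →
        (∀ j, D.r k j < 0 → D.xPart e j ≤ D.r k j) →
        ∃ v ∈ D.lattice, LastNeg v ∧ posExp v ≤ posExp (D.relVec e) ∧
          (latticeBinomial K v ∈ G ∨ -latticeBinomial K v ∈ G) := by
      intro k hk1 hk2 hs hr
      refine ⟨_, hfan k, fan_coverage hslope hk1 hk2, ?_, hray k hk1 (by omega)⟩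
      have hp : 0 ≤ (D.fan k).2 := D.p_nonneg (by omega)
      refine le_of _ (Int.toNat_le_toNat hs) ?_ fun j => ?_
      · rw [relVec_one]; omega
      · have := hr j
        rw [relVec_succ_succ, ← r_eq]
        omega
    have useLast : D.p (D.mu + 1) ≤ -e.2 →
        ∃ v ∈ D.lattice, LastNeg v ∧ posExp v ≤ posExp (D.relVec e) ∧
          (latticeBinomial K v ∈ G ∨ -latticeBinomial K v ∈ G) := by
      intro hp
      refine ⟨_, D.lattice.neg_mem (hfan _), lastNeg_neg_relVec_fan, ?_, ?_⟩
      · have hs : 0 ≤ (D.fan (D.mu + 1)).1 := D.s_nonneg (by omega)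
        refine le_of _ ?_ ?_ fun j => ?_
        · rw [Pi.neg_apply, relVec_zero]; omega
        · rw [Pi.neg_apply, relVec_one, neg_neg]; exact Int.toNat_le_toNat hp
        · have := D.r_mu_succ_nonpos j
          rw [Pi.neg_apply, relVec_succ_succ, ← r_eq]
          omega
      · rw [latticeBinomial_neg, neg_neg]
        exact (hray (D.mu + 1) (by have := D.nu_le_mu; omega) le_rfl).symm
    -- The four quadrants. With s < 0 ≤ p it is -e whose last nonzero entry is negative, so that
    -- case is void. With both negative, -e lies in the first quadrant and its y-side leads.
    rcases le_or_gt 0 e.1 with h1 | h1 <;> rcases le_or_gt 0 e.2 with h2 | h2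
    · by_cases hx : ∀ j, 0 ≤ D.xPart e j
      · refine useRay D.nu le_rfl D.nu_le_mu (s_nu_le he h1 h2 he0 hx) fun j hj => ?_
        exact absurd (D.nu_spec.2 j) (not_le.2 hj)
      · push Not at hx
        obtain ⟨i, hi⟩ := hx
        rcases lastNeg_relVec_cases hun with h | h | ⟨j, hj, -⟩
        · exact absurd h1 (not_le.2 h.1)
        · exact absurd (h.2 i) hi.ne
        · obtain ⟨k, hk1, hk2, hs, hr⟩ := exists_ray_le he h1 h2 ⟨i, hi⟩ ⟨j, hj⟩
          exact useRay k hk1 hk2 hs hr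
    · by_cases hs : D.s D.nu ≤ e.1
      · refine useRay D.nu le_rfl D.nu_le_mu hs fun j hj => ?_
        exact absurd (D.nu_spec.2 j) (not_le.2 hj)
      by_cases hp : D.p (D.mu + 1) ≤ -e.2
      · exact useLast hp
      obtain ⟨k, t, hk1, hk2, ht, ht1, ht2, hs', hp'⟩ :=
        exists_mixed_le he h1 h2.le he0 (not_le.1 hs) (not_le.1 hp)
      have hkl : k < D.last := by omega
      have ht' : t = 1 ∨ k + 1 < D.last ∧ t ≤ D.quot k - 1 := by
        rcases hk2.lt_or_eq with h | h
        · exact Or.inr ⟨by omega, ht1 h⟩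
        · exact Or.inl (ht2 h)
      have hm1 := mixedVec_fst_nonneg hkl ht ht'
      have hm2 := mixedVec_snd_neg hkl ht
      have hm3 := xPart_nonneg_of_nonpos (mixedVec_mem k t) hm1.le hm2.le
      refine ⟨_, hmix k t, lastNeg_relVec_of_nonpos (mixedVec_mem k t) hm1.le hm2.le
        (mixedVec_ne_zero hkl ht), ?_, Or.inl (hmixed k t hk1 hk2 ht ht1 ht2)⟩
      refine le_of _ (Int.toNat_le_toNat hs') ?_ fun j => ?_
      · rw [relVec_one, mixedVec_snd, neg_sub]
        exact Int.toNat_le_toNat hp'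
      · have := hm3 j
        rw [relVec_succ_succ]
        omega
    · refine absurd hun ?_
      have h := lastNeg_relVec_of_nonpos (neg_mem he) (by simpa using h1.le) (by simpa using h2)
        (neg_ne_zero.2 he0)
      have := h.not_lastNeg_neg
      rwa [relVec_neg he, neg_neg] at this
    · have hf1 : 0 ≤ (-e).1 := by simpa using h1.le
      have hf2 : 0 ≤ (-e).2 := by simpa using h2.le
      have hx := xPart_neg he
      refine useLast (p_mu_succ_le (neg_mem he) hf1 hf2 ?_ ?_)
      · intro i
        rcases lastNeg_relVec_cases hun with h | h | ⟨j, hj, hlast⟩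
        · exact absurd h.2.1 h2.ne
        · exact absurd h.1 (not_lt.2 h2.le)
        · by_contra! hi
          rw [hx, Pi.neg_apply] at hi
          rcases lt_or_ge j i with hji | hij
          · exact (neg_pos.1 hi).ne (hlast i hji)
          · have := xPart_nonneg_of_le hslope (neg_mem he) hf1 hf2 hij (by rwa [hx])
            rw [hx, Pi.neg_apply] at this
            omega
      · rcases lastNeg_relVec_cases hun with h | h | ⟨j, hj, hlast⟩
        · exact absurd h.2.1 h2.ne
        · exact absurd h.1 (not_lt.2 h2.le)
        · exact ⟨j, by rw [hx]; simpa using hj⟩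

/-! ### The two families of generators -/

theorem isBinomialBasis_of_mu_eq_nu
    (hslope : ∀ i j : Fin n, i ≤ j → D.b i * D.c j ≤ D.b j * D.c i) (h : D.mu = D.nu) :
    IsBinomialBasis D.lattice {D.polyF K, D.polyG K, D.polyH K} := by
  refine isBinomialBasis_of_fan hslope (Set.toFinite _) ?_ ?_ ?_
  · rintro g (rfl | rfl | rfl)
    · exact Or.inl ⟨D.nu, le_rfl, by omega, Or.inl polyF_eq⟩
    · exact Or.inl ⟨D.nu + 1, by omega, by omega, Or.inr (polyG_eq h)⟩
    · exact Or.inr ⟨D.nu, 1, D.nu_lt_last, le_rfl, Or.inl rfl, polyH_eq⟩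
  · intro k hk1 hk2
    by_cases hk : k = D.nu
    · subst hk
      rw [← polyF_eq]; simp
    · obtain rfl : k = D.nu + 1 := by omega
      rw [← polyG_eq h]; simp
  · intro k t hk1 hk2 _ _ ht
    obtain rfl : k = D.nu := by omega
    rw [ht h.symm, ← polyH_eq]; simp

theorem generators_eq_image :
    D.generators K = (fun e => latticeBinomial K (D.relVec e)) '' D.genVec D.mu := by
  have hml := D.mu_lt_last
  have hnl := D.nu_lt_last
  rw [generators, genVec, Set.image_union, Set.image_iUnion₂, Set.image_insert_eq,
    Set.image_insert_eq, Set.image_singleton, ← polyF_eq, ← polyH_eq, ← rayBinomial_eq (by omega)]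
  congr 1
  refine Set.iUnion₂_congr fun k hk => ?_
  have hkm : k < D.mu := hk.2
  rw [Set.image_union, Set.image_singleton, ← rayBinomial_eq (by omega), Set.image_image]
  congr 1
  ext f
  constructor
  · rintro ⟨t, ht1, ht2, rfl⟩
    exact ⟨t, ⟨ht1, ht2⟩, (mixedBinomial_eq (by omega) (by omega)
      (Or.inr ⟨by omega, ht2⟩)).symm⟩
  · rintro ⟨t, ⟨ht1, ht2⟩, rfl⟩
    exact ⟨t, ht1, ht2, (mixedBinomial_eq (by omega) (by omega)
      (Or.inr ⟨by omega, ht2⟩)).symm⟩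

/-- The number of vectors, and the range of their second coordinates. -/
theorem genVec_spec {m : ℕ} (h1 : D.nu ≤ m) (h2 : m ≤ D.mu) :
    (D.genVec m).Finite ∧
      ((D.genVec m).ncard : ℤ) = 3 + ∑ k ∈ Finset.Ico D.nu m, (D.quot k - 1) ∧
      ∀ e ∈ D.genVec m, D.p m - D.p (m + 1) ≤ e.2 ∧ e.2 ≤ D.p (m + 1) := by
  have hml := D.mu_lt_last
  induction m, h1 using Nat.le_induction with
  | base =>
    have hp := D.p_succ_of_lt_last (k := D.nu) (by omega)
    have hm := mixedVec_snd (D := D) D.nu 1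
    rw [one_mul] at hm
    rw [genVec_nu]
    refine ⟨Set.toFinite _, ?_, ?_⟩
    · have hd1 : D.fan D.nu ≠ D.mixedVec D.nu 1 := fun h => by
        have := congrArg Prod.snd h
        change D.p D.nu = _ at this
        omega
      have hd2 : D.fan D.nu ≠ D.fan (D.nu + 1) := fun h => by
        have : D.p D.nu = D.p (D.nu + 1) := congrArg Prod.snd h
        omega
      have hd3 : D.mixedVec D.nu 1 ≠ D.fan (D.nu + 1) := fun h => by
        have := congrArg Prod.snd h
        change _ = D.p (D.nu + 1) at this
        omega
      rw [Set.ncard_insert_of_notMem (by simp [hd1, hd2]), Set.ncard_pair hd3]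
      simp
    · rintro e (rfl | rfl | rfl)
      · change _ ≤ D.p D.nu ∧ D.p D.nu ≤ _
        omega
      · omega
      · change _ ≤ D.p (D.nu + 1) ∧ D.p (D.nu + 1) ≤ _
        omega
  | succ m hm ih =>
    obtain ⟨hfin, hcard, hran⟩ := ih (by omega)
    have hp := D.p_succ_of_lt_last (k := m) (by omega)
    have hp1 : 0 ≤ D.p (m + 1) ∧ D.p (m + 1) < D.p (m + 2) :=
      D.p_succ_of_lt_last (by omega)
    have hq := D.two_le_quot (k := m) (by omega)
    have hp2 := D.p_add_two m
    -- Distinctness is read off the second coordinate: the new mixed vectors lie below all earlier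
    -- values and the new ray above them.
    have hmix : ∀ t, 2 ≤ t → t ≤ D.quot m - 1 → (D.mixedVec m t).2 < D.p m - D.p (m + 1) ∧
        D.p (m + 1) - D.p (m + 2) ≤ (D.mixedVec m t).2 := by
      intro t ht1 ht2
      rw [mixedVec_snd, hp2]
      constructor <;> nlinarith
    have hinj : Function.Injective (D.mixedVec m) := fun t t' h => by
      have h' := congrArg Prod.snd h
      rw [mixedVec_snd, mixedVec_snd] at h'
      have : (t - t') * D.p (m + 1) = 0 := by linarith
      rcases mul_eq_zero.1 this with h | h <;> omega
    have hImfin : (D.mixedVec m '' Set.Icc 2 (D.quot m - 1)).Finite := (Set.finite_Icc _ _).image _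
    rw [genVec_succ hm]
    refine ⟨hfin.union (hImfin.union (Set.finite_singleton _)), ?_, ?_⟩
    · have hd1 : Disjoint (D.mixedVec m '' Set.Icc 2 (D.quot m - 1)) {D.fan (m + 2)} := by
        rw [Set.disjoint_singleton_right]
        rintro ⟨t, ⟨ht1, ht2⟩, h⟩
        have h3 := hmix t ht1 ht2
        have : (D.mixedVec m t).2 = D.p (m + 2) := congrArg Prod.snd h
        omega
      have hd2 : Disjoint (D.genVec m)
          (D.mixedVec m '' Set.Icc 2 (D.quot m - 1) ∪ {D.fan (m + 2)}) := by
        rw [Set.disjoint_left]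
        rintro e he (⟨t, ⟨ht1, ht2⟩, rfl⟩ | rfl)
        · have h3 := hmix t ht1 ht2
          have := hran _ he
          omega
        · have := (hran _ he).2
          change D.p (m + 2) ≤ _ at this
          omega
      rw [Set.ncard_union_eq hd2 hfin (hImfin.union (Set.finite_singleton _)),
        Set.ncard_union_eq hd1 hImfin (Set.finite_singleton _), Set.ncard_singleton,
        Set.ncard_image_of_injective _ hinj, Finset.sum_Ico_succ_top hm, ← add_assoc]
      -- There are q - 2 mixed vectors, none if q = 2, and the ray raises the contribution to q - 1.
      have : (Set.Icc 2 (D.quot m - 1)).ncard = (D.quot m - 1 + 1 - 2).toNat := by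
        rw [← Finset.coe_Icc, Set.ncard_coe_finset, Int.card_Icc]
      rw [this]
      push_cast
      omega
    · rintro e (he | ⟨t, ⟨ht1, ht2⟩, rfl⟩ | rfl)
      · have := hran e he
        have h3 : D.p (m + 1) - D.p (m + 2) ≤ D.p m - D.p (m + 1) := by
          rw [hp2]; nlinarith
        change D.p (m + 1) - D.p (m + 2) ≤ _ ∧ _ ≤ D.p (m + 2)
        omega
      · have h3 := hmix t ht1 ht2
        change D.p (m + 1) - D.p (m + 2) ≤ _ ∧ _ ≤ D.p (m + 2)
        omega
      · change D.p (m + 1) - D.p (m + 2) ≤ D.p (m + 2) ∧ D.p (m + 2) ≤ D.p (m + 2)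
        omega

theorem genVec_cases {e : ℤ × ℤ} (he : e ∈ D.genVec D.mu) :
    (∃ k, D.nu ≤ k ∧ k ≤ D.mu + 1 ∧ e = D.fan k) ∨
      ∃ k t, k < D.last ∧ 1 ≤ t ∧ (t = 1 ∨ k + 1 < D.last ∧ t ≤ D.quot k - 1) ∧
        e = D.mixedVec k t := by
  have hml := D.mu_lt_last
  have hnm := D.nu_le_mu
  rcases he with (rfl | rfl | rfl) | he
  · exact Or.inl ⟨D.nu, le_rfl, by omega, rfl⟩
  · exact Or.inr ⟨D.nu, 1, D.nu_lt_last, le_rfl, Or.inl rfl, rfl⟩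
  · exact Or.inl ⟨D.nu + 1, by omega, by omega, rfl⟩
  · simp only [Set.mem_iUnion] at he
    obtain ⟨k, ⟨hk1, hk2⟩, ⟨t, ⟨ht1, ht2⟩, rfl⟩ | rfl⟩ := he
    · exact Or.inr ⟨k, t, by omega, by omega, Or.inr ⟨by omega, ht2⟩, rfl⟩
    · exact Or.inl ⟨k + 2, by omega, by omega, rfl⟩

/-- The generators list only t ≥ 2 after ν, because t = 1 repeats the vector with t = q - 1 one
index earlier. If q = 2 that is again a vector with t = 1, and one descends further. -/
theorem mixedVec_one_mem_genVec {k : ℕ} (h1 : D.nu ≤ k) (h2 : k ≤ D.mu) :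
    D.mixedVec k 1 ∈ D.genVec D.mu := by
  have hml := D.mu_lt_last
  induction k, h1 using Nat.le_induction with
  | base => exact Or.inl (by simp)
  | succ k hk ih =>
    rw [← mixedVec_quot_sub_one]
    have hq := D.two_le_quot (k := k) (by omega)
    by_cases hq2 : D.quot k = 2
    · rw [hq2]
      exact ih (by omega)
    · exact Or.inr (Set.mem_iUnion₂.2 ⟨k, ⟨hk, by omega⟩, Or.inl ⟨_, ⟨by omega, le_rfl⟩, rfl⟩⟩)

theorem isBinomialBasis_generators
    (hslope : ∀ i j : Fin n, i ≤ j → D.b i * D.c j ≤ D.b j * D.c i) :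
    IsBinomialBasis D.lattice (D.generators K) := by
  rw [generators_eq_image]
  refine isBinomialBasis_of_fan hslope ((genVec_spec D.nu_le_mu le_rfl).1.image _) ?_ ?_ ?_
  · rintro _ ⟨e, he, rfl⟩
    rcases genVec_cases he with ⟨k, hk1, hk2, rfl⟩ | ⟨k, t, hk, ht, ht', rfl⟩
    · exact Or.inl ⟨k, hk1, hk2, Or.inl rfl⟩
    · exact Or.inr ⟨k, t, hk, ht, ht', rfl⟩
  · exact fun k hk1 hk2 => Or.inl ⟨_, fan_mem_genVec hk1 hk2, rfl⟩
  · intro k t hk1 hk2 ht ht1 ht2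
    refine ⟨_, ?_, rfl⟩
    by_cases ht' : t = 1
    · rw [ht']
      exact mixedVec_one_mem_genVec hk1 hk2
    · have hkm : k < D.mu := lt_of_le_of_ne hk2 fun h => ht' (ht2 h)
      exact Or.inr (Set.mem_iUnion₂.2 ⟨k, ⟨hk1, hkm⟩, Or.inl ⟨t, ⟨by omega, ht1 hkm⟩, rfl⟩⟩)

theorem ncard_generators : ((D.generators K).ncard : ℤ) = D.tau := by
  have hml := D.mu_lt_last
  rw [generators_eq_image, tau, ← (genVec_spec D.nu_le_mu le_rfl).2.1, Nat.cast_inj]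
  refine Set.InjOn.ncard_image fun e he f hf hef => ?_
  -- A binomial determines its vector only up to sign; these conditions describe a half-plane that
  -- contains no two opposite vectors.
  have sign : ∀ e ∈ D.genVec D.mu, e ≠ 0 ∧ 0 ≤ e.1 ∧ (e.1 = 0 → 0 ≤ e.2) := by
    intro e he
    rcases genVec_cases he with ⟨k, hk1, hk2, rfl⟩ | ⟨k, t, hk, ht, ht', rfl⟩
    · exact ⟨fan_ne_zero _, D.s_nonneg (by omega), fun _ => D.p_nonneg (by omega)⟩
    · have h := mixedVec_fst_nonneg hk ht ht'
      exact ⟨mixedVec_ne_zero hk ht, h.le, fun h' => absurd h' h.ne'⟩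
  obtain ⟨he0, he1, he2⟩ := sign e he
  obtain ⟨hf0, hf1, hf2⟩ := sign f hf
  rcases eq_or_eq_neg_of_latticeBinomial_eq (relVec_ne_zero he0) (relVec_ne_zero hf0) hef with h | h
  · refine Prod.ext ?_ ?_
    · simpa using congrFun h 0
    · simpa using congrFun h 1
  · exfalso
    have h1 : e.1 = -f.1 := by simpa using congrFun h 0
    have h2 : -e.2 = f.2 := by simpa using congrFun h 1
    refine he0 (Prod.ext ?_ ?_)
    · change e.1 = 0; omega
    · change e.2 = 0
      have := he2 (by omega)
      have := hf2 (by omega)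
      omega

end Finite

end SimplicialData

end FanBinomials

/-! ### Freeness over the polynomial ring in the x_i when μ = ν. -/

noncomputable section StandardMonomials

variable {K : Type*} [Field K] {n : ℕ}

/-- The inclusion of `K[x₁, …, xₙ]` into `K[z, y, x₁, …, xₙ]`. -/
def xIncl (K : Type*) [Field K] (n : ℕ) :
    MvPolynomial (Fin n) K →ₐ[K] MvPolynomial (Fin (n + 2)) K :=
  rename fun i => i.succ.succ

theorem succ_succ_injective : Function.Injective fun i : Fin n => i.succ.succ :=
  (Fin.succ_injective _).comp (Fin.succ_injective _)

/-- The inclusion of the exponents of the variables `x i`. -/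
def xExp (γ : Fin n →₀ ℕ) : Fin (n + 2) →₀ ℕ := γ.mapDomain fun i => i.succ.succ

@[simp] theorem xExp_succ_succ (γ : Fin n →₀ ℕ) (i : Fin n) : xExp γ i.succ.succ = γ i :=
  Finsupp.mapDomain_apply succ_succ_injective γ i

@[simp] theorem xExp_zero (γ : Fin n →₀ ℕ) : xExp γ 0 = 0 := by
  refine Finsupp.mapDomain_of_notMem_range _ _ ?_
  rintro ⟨i, hi⟩
  exact Fin.succ_ne_zero _ hi

@[simp] theorem xExp_one (γ : Fin n →₀ ℕ) : xExp γ 1 = 0 := by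
  refine Finsupp.mapDomain_of_notMem_range _ _ ?_
  rintro ⟨i, hi⟩
  exact Fin.succ_ne_zero _ (Fin.succ_injective _ hi)

theorem xIncl_monomial (γ : Fin n →₀ ℕ) (c : K) :
    xIncl K n (monomial γ c) = monomial (xExp γ) c :=
  rename_monomial _ _ _

/-- A quotient of `K[z, y, x₁, …, xₙ]` as an algebra over `K[x₁, …, xₙ]`. -/
@[reducible] def xAlgebra (J : Ideal (MvPolynomial (Fin (n + 2)) K)) :
    Algebra (MvPolynomial (Fin n) K) (MvPolynomial (Fin (n + 2)) K ⧸ J) :=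
  ((Ideal.Quotient.mk J).comp (xIncl K n : MvPolynomial (Fin n) K →+* _)).toAlgebra

/-- The module structure of `xAlgebra`, as a shortcut for instance search. -/
@[reducible] def xModule (J : Ideal (MvPolynomial (Fin (n + 2)) K)) :
    Module (MvPolynomial (Fin n) K) (MvPolynomial (Fin (n + 2)) K ⧸ J) :=
  (xAlgebra J).toModule

attribute [local instance] xAlgebra
attribute [local instance] xModule

variable {J : Ideal (MvPolynomial (Fin (n + 2)) K)}

theorem xAlgebraMap_apply (f : MvPolynomial (Fin n) K) :
    algebraMap _ (MvPolynomial (Fin (n + 2)) K ⧸ J) f = Ideal.Quotient.mk J (xIncl K n f) :=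
  rfl

theorem isScalarTower_xAlgebra :
    IsScalarTower K (MvPolynomial (Fin n) K) (MvPolynomial (Fin (n + 2)) K ⧸ J) := by
  refine IsScalarTower.of_algebraMap_eq fun c => ?_
  rw [xAlgebraMap_apply, AlgHom.commutes]
  rfl

theorem xAlgebra_smul_mk (f : MvPolynomial (Fin n) K) (g : MvPolynomial (Fin (n + 2)) K) :
    f • (Ideal.Quotient.mk J g) = Ideal.Quotient.mk J (xIncl K n f * g) := by
  rw [Algebra.smul_def, xAlgebraMap_apply, map_mul]

/-- The quotient is integral over `K[x₁, …, xₙ]` if powers of `z` and `y` lie in it. -/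
theorem isIntegral_xAlgebra {s p : ℕ} (hs : 0 < s) (hp : 0 < p) {f g : MvPolynomial (Fin n) K}
    (hf : X 0 ^ s - xIncl K n f ∈ J) (hg : X 1 ^ p - xIncl K n g ∈ J) :
    Algebra.IsIntegral (MvPolynomial (Fin n) K) (MvPolynomial (Fin (n + 2)) K ⧸ J) := by
  refine ⟨fun b => ?_⟩
  obtain ⟨q, rfl⟩ := Ideal.Quotient.mk_surjective b
  induction q using MvPolynomial.induction_on with
  | C a =>
    have h : Ideal.Quotient.mk J (C a) = algebraMap (MvPolynomial (Fin n) K) _ (C a) := by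
      rw [xAlgebraMap_apply, xIncl, rename_C]
    rw [h]
    exact isIntegral_algebraMap
  | add q r hq hr => rw [map_add]; exact hq.add hr
  | mul_X q i hq =>
    rw [map_mul]
    refine hq.mul ?_
    refine Fin.cases ?_ (Fin.cases ?_ fun j => ?_) i
    · refine IsIntegral.of_pow hs ?_
      rw [← map_pow, Ideal.Quotient.eq.2 hf]
      exact isIntegral_algebraMap (x := f)
    · refine IsIntegral.of_pow hp ?_
      rw [← map_pow]
      have : Ideal.Quotient.mk J (X (Fin.succ 0) ^ p) = Ideal.Quotient.mk J (xIncl K n g) :=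
        Ideal.Quotient.eq.2 hg
      rw [this]
      exact isIntegral_algebraMap (x := g)
    · have h : Ideal.Quotient.mk J (X j.succ.succ) =
          algebraMap (MvPolynomial (Fin n) K) _ (X j) := by
        rw [xAlgebraMap_apply, xIncl, rename_X]
      rw [h]
      exact isIntegral_algebraMap

variable {L : AddSubgroup (Fin (n + 2) → ℤ)}

/-- The standard monomials in `z` and `y` of the lattice ideal. -/
def stdExp (L : AddSubgroup (Fin (n + 2) → ℤ)) : Set (Fin (n + 2) →₀ ℕ) :=
  {α | (∀ i : Fin n, α i.succ.succ = 0) ∧ ∀ u ∈ L, LastNeg u → ¬ posExp u ≤ α}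

theorem exists_eq_xExp_add_of_mem_support {f : MvPolynomial (Fin n) K} {σ α : Fin (n + 2) →₀ ℕ}
    (hα : coeff α (xIncl K n f * monomial σ 1) ≠ 0) : ∃ γ, α = xExp γ + σ := by
  rw [coeff_mul_monomial'] at hα
  split_ifs at hα with hle
  · rw [mul_one] at hα
    obtain ⟨γ, hγ, -⟩ := coeff_rename_ne_zero _ _ _ hα
    exact ⟨γ, by rw [xExp, hγ, tsub_add_cancel_of_le hle]⟩
  · exact absurd rfl hα

theorem coeff_xIncl_mul_monomial [DecidableEq (Fin (n + 2) →₀ ℕ)] {f : MvPolynomial (Fin n) K}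
    {σ τ : Fin (n + 2) →₀ ℕ} (hσ : ∀ i : Fin n, σ i.succ.succ = 0)
    (hτ : ∀ i : Fin n, τ i.succ.succ = 0) (γ : Fin n →₀ ℕ) :
    coeff (xExp γ + τ) (xIncl K n f * monomial σ 1) = if σ = τ then coeff γ f else 0 := by
  split_ifs with h
  · rw [h, coeff_mul_monomial, mul_one]
    exact coeff_rename_mapDomain _ succ_succ_injective f γ
  · by_contra hne
    obtain ⟨δ, hδ⟩ := exists_eq_xExp_add_of_mem_support hne
    refine h (Finsupp.ext fun i => ?_)
    have hi := DFunLike.congr_fun hδ i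
    revert hi
    refine Fin.cases ?_ (Fin.cases ?_ fun j => ?_) i
    · intro hi
      simpa using hi.symm
    · intro hi
      have h1 : xExp γ 1 + τ 1 = xExp δ 1 + σ 1 := hi
      rw [xExp_one, xExp_one] at h1
      change σ 1 = τ 1
      omega
    · intro _
      rw [hσ, hτ]

/-- If leading monomials of the lattice ideal can be taken in `z` and `y` only, then the quotient
is free over `K[x₁, …, xₙ]`. -/
theorem free_quotient_latticeIdeal {w : Fin (n + 2) → ℕ} (hw : ∀ i, 0 < w i)
    (hL : ∀ u ∈ L, ∑ i, (w i : ℤ) * u i = 0)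
    (hcov : ∀ u ∈ L, LastNeg u → ∃ v ∈ L, LastNeg v ∧ posExp v ≤ posExp u ∧
      ∀ i : Fin n, v i.succ.succ ≤ 0) :
    Module.Free (MvPolynomial (Fin n) K)
      (MvPolynomial (Fin (n + 2)) K ⧸ latticeIdeal K L) := by
  classical
  let b : stdExp L → MvPolynomial (Fin (n + 2)) K ⧸ latticeIdeal K L :=
    fun σ => Ideal.Quotient.mk _ (monomial σ.1 1)
  have hli : LinearIndependent (MvPolynomial (Fin n) K) b := by
    rw [linearIndependent_iff]
    intro l hl
    set F : MvPolynomial (Fin (n + 2)) K := ∑ σ ∈ l.support, xIncl K n (l σ) * monomial σ.1 1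
      with hF
    have hFI : F ∈ latticeIdeal K L := by
      rw [← Ideal.Quotient.eq_zero_iff_mem, ← hl, Finsupp.linearCombination_apply, Finsupp.sum, hF,
        map_sum]
      exact Finset.sum_congr rfl fun σ _ => (xAlgebra_smul_mk _ _).symm
    -- Every monomial of F is x^γ times a standard one, and a leading monomial free of the x_i
    -- ignores x^γ. A nonzero F in the ideal would contradict this at its leading exponent.
    have hsupp : ∀ α ∈ F.support, ∀ v ∈ L, LastNeg v → (∀ i : Fin n, v i.succ.succ ≤ 0) →
        ¬ posExp v ≤ α := by
      intro α hα v hv hvn hvx hle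
      have hne : coeff α F ≠ 0 := mem_support_iff.1 hα
      rw [hF, coeff_sum] at hne
      obtain ⟨σ, -, hσ⟩ := Finset.exists_ne_zero_of_sum_ne_zero hne
      obtain ⟨γ, rfl⟩ := exists_eq_xExp_add_of_mem_support hσ
      refine σ.2.2 v hv hvn fun i => ?_
      have hi := hle i
      revert hi
      refine Fin.cases ?_ (Fin.cases ?_ fun j => ?_) i
      · intro hi
        simpa using hi
      · intro hi
        have h1 : posExp v 1 ≤ xExp γ 1 + σ.1 1 := hi
        rw [xExp_one, zero_add] at h1
        exact h1
      · intro _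
        rw [posExp_apply, Int.toNat_eq_zero.2 (hvx j)]
        exact Nat.zero_le _
    have hF0 : F = 0 := by
      by_contra hne
      obtain ⟨α, hα, hmax⟩ := exists_revLexLT_max w F.support (support_nonempty.2 hne)
      obtain ⟨β, hβ, hβα, hαβ⟩ :=
        exists_equiv_of_classMap_eq_zero (latticeIdeal_le_ker_classMap hFI) hα
      obtain ⟨v, hv, hvn, hle, hvx⟩ :=
        hcov _ hαβ ((revLexLT_iff_of_mem hL hαβ).1 (hmax β hβ hβα))
      exact hsupp α hα v hv hvn hvx (hle.trans (posExp_intExp_sub_le α β))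
    ext τ γ
    have h1 : coeff (xExp γ + τ.1) F = coeff γ (l τ) := by
      rw [hF, coeff_sum]
      have h2 : ∀ σ ∈ l.support, coeff (xExp γ + τ.1) (xIncl K n (l σ) * monomial σ.1 1) =
          if σ = τ then coeff γ (l σ) else 0 := fun σ _ => by
        rw [coeff_xIncl_mul_monomial σ.2.1 τ.2.1]
        simp only [Subtype.ext_iff]
      rw [Finset.sum_congr rfl h2, Finset.sum_ite_eq']
      split_ifs with h
      · rfl
      · rw [Finsupp.notMem_support_iff.1 h, coeff_zero]
    rw [← h1, hF0]
    simp
  have hspan : ⊤ ≤ Submodule.span (MvPolynomial (Fin n) K) (Set.range b) := by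
    have key : ∀ α : Fin (n + 2) →₀ ℕ, Ideal.Quotient.mk (latticeIdeal K L) (monomial α 1) ∈
        Submodule.span (MvPolynomial (Fin n) K) (Set.range b) := by
      intro α
      induction α using (wellFounded_revLexLT hw).induction with
      | _ α ih =>
        -- Either the monomial reduces to a smaller equivalent one, or its part in z and y is
        -- standard and x^γ becomes a scalar.
        by_cases hstd : ∃ u ∈ L, LastNeg u ∧ posExp u ≤ α
        · obtain ⟨u, hu, hun, hle⟩ := hstd
          obtain ⟨β, hβ, -, heq⟩ := IsBinomialBasis.exists_revLexLT_of_le (K := K) hL hu hun hle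
          have h1 : Ideal.Quotient.mk (latticeIdeal K L) (monomial α 1) =
              Ideal.Quotient.mk (latticeIdeal K L) (monomial β 1) := by
            rw [Ideal.Quotient.eq, heq]
            exact Ideal.mul_mem_left _ _ (latticeBinomial_mem hu)
          rw [h1]
          exact ih β hβ
        · push Not at hstd
          let γ : Fin n →₀ ℕ := Finsupp.equivFunOnFinite.symm fun i => α i.succ.succ
          have hγ : ∀ i, γ i = α i.succ.succ := fun i => rfl
          have hle : xExp γ ≤ α := by
            intro i
            refine Fin.cases ?_ (Fin.cases ?_ fun j => ?_) i
            · rw [xExp_zero]; exact Nat.zero_le _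
            · change xExp γ 1 ≤ _
              rw [xExp_one]; exact Nat.zero_le _
            · rw [xExp_succ_succ, hγ]
          have hσ : α - xExp γ ∈ stdExp L :=
            ⟨fun i => by rw [Finsupp.tsub_apply, xExp_succ_succ, hγ, tsub_self],
              fun u hu hun h => hstd u hu hun (h.trans tsub_le_self)⟩
          have h1 : Ideal.Quotient.mk (latticeIdeal K L) (monomial α 1) =
              (monomial γ 1 : MvPolynomial (Fin n) K) • b ⟨_, hσ⟩ := by
            rw [xAlgebra_smul_mk, xIncl_monomial, monomial_mul, add_tsub_cancel_of_le hle, mul_one]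
          rw [h1]
          exact Submodule.smul_mem _ _ (Submodule.subset_span ⟨_, rfl⟩)
    intro x _
    obtain ⟨f, rfl⟩ := Ideal.Quotient.mk_surjective x
    rw [f.as_sum, map_sum]
    refine Submodule.sum_mem _ fun α _ => ?_
    have h1 : Ideal.Quotient.mk (latticeIdeal K L) (monomial α (coeff α f)) =
        (C (coeff α f) : MvPolynomial (Fin n) K) •
          Ideal.Quotient.mk (latticeIdeal K L) (monomial α 1) := by
      rw [xAlgebra_smul_mk, xIncl, rename_C, C_mul_monomial, mul_one]
    rw [h1]
    exact Submodule.smul_mem _ _ (key α)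
  exact Module.Free.of_basis (Module.Basis.mk hli hspan)

namespace SimplicialData

variable {H : Type*} [AddCommGroup H] {D : SimplicialData n H} [Finite H]

theorem posMonomial_x (v : Fin n → ℤ) :
    mono n K 0 0 v = xIncl K n (∏ i, X i ^ (v i).toNat) := by
  simp [mono, xIncl]

variable (D K) in
/-- Some powers of `z` and `y` are monomials in the `x i` modulo the lattice ideal. -/
theorem exists_pow_sub_mem : (∃ s, 0 < s ∧ ∃ f, X 0 ^ s - xIncl K n f ∈ D.ideal K) ∧
    ∃ p, 0 < p ∧ ∃ g, X 1 ^ p - xIncl K n g ∈ D.ideal K := by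
  have hl := D.last_pos
  have hs0 : 0 < (D.fan 0).1 := D.fanStart_spec.1
  have hp0 : (D.fan 0).2 = 0 := D.fanStart_spec.2.1
  have hsl : (D.fan D.last).1 = 0 := D.s_last
  have hpl : 0 < (D.fan D.last).2 := by
    have := D.p_succ_of_lt_last (k := D.last - 1) (by omega)
    rw [Nat.sub_add_cancel hl] at this
    exact this.1.trans_lt this.2
  refine ⟨⟨(D.fan 0).1.toNat, by omega, ∏ i, X i ^ (D.r 0 i).toNat, ?_⟩,
    ⟨(D.fan D.last).2.toNat, by omega, ∏ i, X i ^ (-D.r D.last i).toNat, ?_⟩⟩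
  · have h : latticeBinomial K (D.relVec (D.fan 0)) ∈ D.ideal K :=
      latticeBinomial_mem (D.relVec_mem_lattice_iff.2 (D.fan_mem 0))
    rw [latticeBinomial_relVec, mono_congr (s := -(D.fan 0).1) (p := (D.fan 0).2)
      (s' := 0) (p' := 0) (by omega) (by omega) fun j => rfl, posMonomial_x,
      mono_congr (s := (D.fan 0).1) (s' := (D.fan 0).1) (p' := 0) (v' := 0) rfl (by omega)] at h
    · simpa [mono] using! h
    · intro j
      have := D.r_zero_nonneg j
      rw [Pi.neg_apply, ← r_eq, Pi.zero_apply]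
      omega
  · have h : latticeBinomial K (D.relVec (D.fan D.last)) ∈ D.ideal K :=
      latticeBinomial_mem (D.relVec_mem_lattice_iff.2 (D.fan_mem _))
    rw [← neg_mem_iff, latticeBinomial_relVec, neg_sub, mono_congr (s := (D.fan D.last).1)
      (p := -(D.fan D.last).2) (s' := 0) (p' := 0) (by omega) (by omega) fun j => rfl,
      posMonomial_x, mono_congr (p := (D.fan D.last).2) (s' := 0) (p' := (D.fan D.last).2)
      (v' := 0) (by omega) rfl] at h
    · simpa [mono] using! h
    · intro j
      have := D.r_last_nonpos j
      rw [← r_eq, Pi.zero_apply]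
      omega

theorem isIntegral_quotient : Algebra.IsIntegral (MvPolynomial (Fin n) K)
    (MvPolynomial (Fin (n + 2)) K ⧸ D.ideal K) := by
  obtain ⟨⟨s, hs, f, hf⟩, p, hp, g, hg⟩ := D.exists_pow_sub_mem K
  exact isIntegral_xAlgebra hs hp hf hg

/-- The leading monomials z^{s_ν}, y^{p_{ν+1}} and that of H contain no x_i. Since the basis
property yields v only through its binomial, `key` recovers v up to sign, and the last nonzero entry
fixes the sign. -/
theorem exists_standard_le (K : Type*) [Field K]
    (hslope : ∀ i j : Fin n, i ≤ j → D.b i * D.c j ≤ D.b j * D.c i) (h : D.mu = D.nu) :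
    ∀ u ∈ D.lattice, LastNeg u → ∃ v ∈ D.lattice, LastNeg v ∧ posExp v ≤ posExp u ∧
      ∀ i : Fin n, v i.succ.succ ≤ 0 := by
  intro u hu hun
  obtain ⟨v, hv, hvn, hle, hG⟩ :=
    (isBinomialBasis_of_mu_eq_nu (K := K) hslope h).exists_le u hu hun
  refine ⟨v, hv, hvn, hle, ?_⟩
  have hF := fan_coverage hslope (D := D) le_rfl D.nu_le_mu
  have hGn := D.lastNeg_neg_relVec_fan
  rw [h] at hGn
  have hm1 := mixedVec_fst_nonneg D.nu_lt_last le_rfl (Or.inl rfl)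
  have hm2 := mixedVec_snd_neg D.nu_lt_last le_rfl
  have hH := lastNeg_relVec_of_nonpos (mixedVec_mem (D := D) D.nu 1) hm1.le hm2.le
    (mixedVec_ne_zero D.nu_lt_last le_rfl)
  have key : ∀ x, LastNeg x → (∀ i : Fin n, x i.succ.succ ≤ 0) →
      (latticeBinomial K v = latticeBinomial K x ∨ -latticeBinomial K v = latticeBinomial K x) →
      ∀ i : Fin n, v i.succ.succ ≤ 0 := by
    intro x hxn hx hvx
    have : v = x ∨ v = -x := by
      rcases hvx with hvx | hvx
      · exact eq_or_eq_neg_of_latticeBinomial_eq hvn.ne_zero hxn.ne_zero hvx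
      · rw [← latticeBinomial_neg] at hvx
        rcases eq_or_eq_neg_of_latticeBinomial_eq (neg_ne_zero.2 hvn.ne_zero) hxn.ne_zero hvx
          with h | h
        · exact Or.inr (by rw [← h, neg_neg])
        · exact Or.inl (neg_inj.1 h)
    rcases this with rfl | rfl
    · exact hx
    · exact absurd hvn hxn.not_lastNeg_neg
  have kF := key _ hF fun i => by
    have := D.nu_spec.2 i
    rw [relVec_succ_succ, ← r_eq]; omega
  have kG := key _ hGn fun i => by
    have := D.r_mu_succ_nonpos i
    rw [h] at this
    rw [Pi.neg_apply, relVec_succ_succ, ← r_eq]; omega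
  have kH := key _ hH fun i => by
    have := xPart_nonneg_of_nonpos (mixedVec_mem (D := D) D.nu 1) hm1.le hm2.le i
    rw [relVec_succ_succ]; omega
  rw [polyF_eq, polyG_eq h, ← latticeBinomial_neg, polyH_eq] at hG
  rcases hG with (h | h | h) | h | h | h
  exacts [kF (Or.inl h), kG (Or.inl h), kH (Or.inl h), kF (Or.inr h), kG (Or.inr h),
    kH (Or.inr h)]

/-- The Cohen–Macaulay case. -/
theorem isCohenMacaulay_of_mu_eq_nu
    (hslope : ∀ i j : Fin n, i ≤ j → D.b i * D.c j ≤ D.b j * D.c i) (h : D.mu = D.nu) :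
    IsCohenMacaulay (MvPolynomial (Fin (n + 2)) K ⧸ D.ideal K) := by
  have hst : IsScalarTower K (MvPolynomial (Fin n) K)
    (MvPolynomial (Fin (n + 2)) K ⧸ D.ideal K) := isScalarTower_xAlgebra
  have hint : Algebra.IsIntegral (MvPolynomial (Fin n) K)
    (MvPolynomial (Fin (n + 2)) K ⧸ D.ideal K) := isIntegral_quotient
  have hfree : Module.Free (MvPolynomial (Fin n) K)
      (MvPolynomial (Fin (n + 2)) K ⧸ D.ideal K) :=
    free_quotient_latticeIdeal D.weight_pos (fun u hu => D.sum_weight_mul hu)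
      (exists_standard_le K hslope h)
  exact isCohenMacaulay_of_flat K n _

end SimplicialData

end StandardMonomials

/-! ### A criterion for failure of the Cohen–Macaulay property. -/

section NotCohenMacaulay

open RingTheory.Sequence IsLocalRing
open scoped Pointwise

/-- Lying over for the bottom prime, then going up, lifts a chain ending at P to one of equal length
ending over P, hence at Q by uniqueness. -/
theorem height_le_height_of_isIntegral {S B : Type*} [CommRing S] [CommRing B] [Algebra S B]
    [Algebra.IsIntegral S B] (hinj : Function.Injective (algebraMap S B)) (P : Ideal S) [P.IsPrime]
    (Q : Ideal B) [Q.IsPrime]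
    (hQ : ∀ Q' : Ideal B, Q'.IsPrime → Q'.comap (algebraMap S B) = P → Q' = Q) :
    P.height ≤ Q.height := by
  rw [(⟨P, ‹_›⟩ : PrimeSpectrum S).height_eq_orderHeight,
    (⟨Q, ‹_›⟩ : PrimeSpectrum B).height_eq_orderHeight]
  refine Order.height_le fun l hl => ?_
  obtain ⟨Q₀, -, hQ₀, hQ₀l⟩ := Ideal.exists_ideal_over_prime_of_isIntegral l.head.asIdeal
    (⊥ : Ideal B) (by
      rw [← RingHom.ker_eq_comap_bot, (RingHom.injective_iff_ker_eq_bot _).1 hinj]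
      exact bot_le)
  have : Q₀.LiesOver l.head.asIdeal := ⟨hQ₀l.symm⟩
  obtain ⟨L, hlen, -, hmap⟩ := Ideal.exists_ltSeries_of_hasGoingUp l Q₀
  rw [← hlen]
  refine Order.length_le_height (le_of_eq (PrimeSpectrum.ext (hQ _ L.last.2 ?_)))
  have h := congrArg (fun t => t.getLast?) hmap
  simp only [List.getLast?_map, List.getLast?_eq_some_getLast L.toList_ne_nil,
    List.getLast?_eq_some_getLast l.toList_ne_nil, RelSeries.getLast_toList, Option.map_some,
    Option.some.injEq, hl] at h
  exact congrArg PrimeSpectrum.asIdeal h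

/-- Primes of the localization contract injectively to B, and comparable primes of B stay distinct
in S by integrality. -/
theorem ringKrullDim_quotient_atPrime_le {S B : Type*} [CommRing S] [CommRing B] [Algebra S B]
    [Algebra.IsIntegral S B] (m : Ideal B) [m.IsPrime] (I : Ideal S)
    (J : Ideal (Localization.AtPrime m))
    (hIJ : ∀ f ∈ I, algebraMap B (Localization.AtPrime m) (algebraMap S B f) ∈ J) :
    ringKrullDim (Localization.AtPrime m ⧸ J) ≤ ringKrullDim (S ⧸ I) := by
  rw [ringKrullDim_quotient, ringKrullDim_quotient]
  refine Order.krullDim_le_of_strictMono (fun P => ⟨PrimeSpectrum.comap (algebraMap S B)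
    (PrimeSpectrum.comap (algebraMap B (Localization.AtPrime m)) P.1), ?_⟩) ?_
  · intro f hf
    exact P.2 (hIJ f hf)
  · intro P Q h
    refine Ideal.IsIntegral.comap_lt_comap (I := (PrimeSpectrum.comap _ P.1).asIdeal) ?_
    refine lt_of_le_of_ne (Ideal.comap_mono h.le) fun heq => h.ne (Subtype.ext ?_)
    exact PrimeSpectrum.localization_comap_injective _ m.primeCompl (PrimeSpectrum.ext heq)

/-- Locally at m the class of x modulo u is nonzero and is killed by u and v, so the depth is at
most dim S/(u, v) + 1, less than the height of m. -/
theorem not_isCohenMacaulayLocal_atPrime {S B : Type*} [CommRing S] [CommRing B] [Algebra S B]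
    [Algebra.IsIntegral S B] [IsNoetherianRing B] (m : Ideal B) [m.IsPrime] {u v : S} {x y : B}
    (hum : algebraMap S B u ∈ m) (hu : IsSMulRegular B (algebraMap S B u))
    (hx : ∀ h f : B, h * x = algebraMap S B u * f → h ∈ m)
    (hv : algebraMap S B v * x = algebraMap S B u * y)
    (hdim : ringKrullDim (S ⧸ Ideal.span {u, v}) + 2 ≤ m.height) :
    ¬ IsCohenMacaulayLocal (Localization.AtPrime m) := by
  rintro ⟨rs, hrs, hreg, hlen⟩
  have hnoeth : IsNoetherianRing (Localization.AtPrime m) :=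
    IsLocalization.isNoetherianRing m.primeCompl _ inferInstance
  set φ := algebraMap B (Localization.AtPrime m) with hφ
  have h := length_le_ringKrullDim_quotient_add_one rs hrs hreg.toIsWeaklyRegular
    (u := φ (algebraMap S B u)) (J := (Ideal.span {u, v}).map (φ.comp (algebraMap S B)))
    (x := φ x) ((IsLocalization.AtPrime.to_map_mem_maximal_iff _ m _).2 hum) hu.of_flat ?_ ?_
  · have h2 := ringKrullDim_quotient_atPrime_le m (Ideal.span {u, v})
      ((Ideal.span {u, v}).map (φ.comp (algebraMap S B)))
      fun f hf => Ideal.mem_map_of_mem (φ.comp (algebraMap S B)) hf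
    rw [hlen, IsLocalization.AtPrime.ringKrullDim_eq_height m] at h
    -- In a Noetherian ring the height is finite, which allows d + 2 ≤ k ≤ d + 1 to be refuted.
    obtain ⟨k, hk⟩ := ENat.ne_top_iff_exists.1 (Ideal.height_ne_top (I := m) ‹m.IsPrime›.ne_top)
    replace hdim := (add_le_add_left h2 2).trans hdim
    rw [← hk] at h hdim
    generalize ringKrullDim (Localization.AtPrime m ⧸
      (Ideal.span {u, v}).map (φ.comp (algebraMap S B))) = d at h hdim
    induction d using WithBot.recBotCoe with
    | bot => simp at h
    | coe d =>
      induction d using ENat.recTopCoe with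
      | top =>
        have : ((⊤ : ℕ∞) : WithBot ℕ∞) + 2 = ⊤ := rfl
        rw [this, top_le_iff] at hdim
        exact ENat.natCast_ne_top k (WithBot.coe_injective hdim)
      | coe d =>
        change (((d + 2 : ℕ) : ℕ∞) : WithBot ℕ∞) ≤ ((k : ℕ∞) : WithBot ℕ∞) at hdim
        norm_cast at h hdim
        omega
  · rw [Submodule.mem_smul_pointwise_iff_exists]
    rintro ⟨a, -, ha⟩
    obtain ⟨f, t, rfl⟩ := IsLocalization.exists_mk'_eq m.primeCompl a
    rw [smul_eq_mul, ← IsLocalization.mk'_one (M := m.primeCompl) _ x, hφ,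
      ← IsLocalization.mk'_one (M := m.primeCompl) _ (algebraMap S B u), ← IsLocalization.mk'_mul,
      IsLocalization.mk'_eq_iff_eq, IsLocalization.eq_iff_exists m.primeCompl] at ha
    obtain ⟨c, hc⟩ := ha
    refine (mul_mem c.2 t.2 : (c * t : B) ∈ m.primeCompl) (hx _ (c * f) ?_)
    simp only [Submonoid.coe_one, one_mul] at hc
    linear_combination -hc
  · intro a ha
    have hle : (Ideal.span {u, v}).map (φ.comp (algebraMap S B)) ≤
        Submodule.comap (LinearMap.toSpanSingleton _ _ (φ x))
          (φ (algebraMap S B u) • (⊤ : Submodule (Localization.AtPrime m) _)) := by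
      rw [Ideal.map_span, Set.image_pair]
      refine Ideal.span_le.2 ?_
      rintro _ (rfl | rfl)
      · exact Submodule.smul_mem_pointwise_smul (φ x) _ _ trivial
      · change φ (algebraMap S B v) * φ x ∈
          φ (algebraMap S B u) • (⊤ : Submodule (Localization.AtPrime m) _)
        rw [← map_mul, hv, map_mul]
        exact Submodule.smul_mem_pointwise_smul (φ y) _ _ trivial
    exact hle ha

/-- Coprimality makes v a nonzerodivisor modulo u, so each of the two quotients costs one dimension.
-/
theorem ringKrullDim_quotient_span_pair_add_two_le {S : Type*} [CommRing S] [IsDomain S]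
    [DecompositionMonoid S] {u v : S} (hu : u ≠ 0) (h : IsRelPrime u v) :
    ringKrullDim (S ⧸ Ideal.span {u, v}) + 2 ≤ ringKrullDim S := by
  have h1 : ringKrullDim (S ⧸ Ideal.span {u}) + 1 ≤ ringKrullDim S :=
    ringKrullDim_quotient_succ_le_of_nonZeroDivisor (mem_nonZeroDivisors_of_ne_zero hu)
  have hle : Ideal.span {u} ≤ Ideal.span {u, v} := Ideal.span_mono (by simp)
  have h2 : ringKrullDim (S ⧸ Ideal.span {u, v}) + 1 ≤ ringKrullDim (S ⧸ Ideal.span {u}) := by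
    refine ringKrullDim_succ_le_of_surjective (Ideal.Quotient.factor hle)
      (Ideal.Quotient.factor_surjective hle) (r := Ideal.Quotient.mk _ v) ?_ ?_
    · rw [mem_nonZeroDivisors_iff_right]
      intro a ha
      obtain ⟨f, rfl⟩ := Ideal.Quotient.mk_surjective a
      rw [← map_mul, Ideal.Quotient.eq_zero_iff_mem, Ideal.mem_span_singleton] at ha
      rw [Ideal.Quotient.eq_zero_iff_mem, Ideal.mem_span_singleton]
      exact h.dvd_of_dvd_mul_right ha
    · rw [Ideal.Quotient.factor_mk, Ideal.Quotient.eq_zero_iff_mem]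
      exact Ideal.subset_span (by simp)
  calc ringKrullDim (S ⧸ Ideal.span {u, v}) + 2 = ringKrullDim (S ⧸ Ideal.span {u, v}) + 1 + 1 := by
        rw [add_assoc]; norm_num
    _ ≤ _ := (add_le_add_left h2 1).trans h1

end NotCohenMacaulay

/-! ### Failure at the origin when ν < μ. -/

noncomputable section NotCohenMacaulayCase

section ClassMap

variable {K : Type*} [Field K] {N : ℕ} {L : AddSubgroup (Fin N → ℤ)}

theorem coeff_classMap_monomial_mul (σ : Fin N →₀ ℕ) (f : MvPolynomial (Fin N) K)
    (q : (Fin N → ℤ) ⧸ L) :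
    (classMap K L (monomial σ 1 * f)).coeff (((intExp N σ : Fin N → ℤ) : _ ⧸ L) + q) =
      (classMap K L f).coeff q := by
  rw [map_mul, classMap_monomial, AddMonoidAlgebra.coeff_single_mul_add, one_mul]

/-- The monomials are regular modulo a lattice ideal. -/
theorem isSMulRegular_monomial (σ : Fin N →₀ ℕ) :
    IsSMulRegular (MvPolynomial (Fin N) K ⧸ latticeIdeal K L)
      (Ideal.Quotient.mk (latticeIdeal K L) (monomial σ 1)) := by
  rw [isSMulRegular_iff_right_eq_zero_of_smul]
  intro b hb
  obtain ⟨f, rfl⟩ := Ideal.Quotient.mk_surjective b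
  rw [smul_eq_mul, ← map_mul, Ideal.Quotient.eq_zero_iff_mem, latticeIdeal_eq_ker_classMap,
    RingHom.mem_ker] at hb
  rw [Ideal.Quotient.eq_zero_iff_mem, latticeIdeal_eq_ker_classMap, RingHom.mem_ker]
  ext q
  rw [← coeff_classMap_monomial_mul σ, hb]
  rfl

theorem exists_mk_eq_of_coeff_classMap_ne_zero {f : MvPolynomial (Fin N) K}
    {q : (Fin N → ℤ) ⧸ L} (h : (classMap K L f).coeff q ≠ 0) :
    ∃ α : Fin N →₀ ℕ, ((intExp N α : Fin N → ℤ) : _ ⧸ L) = q := by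
  classical
  rw [coeff_classMap] at h
  obtain ⟨α, hα, -⟩ := Finset.exists_ne_zero_of_sum_ne_zero h
  exact ⟨α, (Finset.mem_filter.1 hα).2⟩

end ClassMap

section Variables

variable {K : Type*} [Field K] {n : ℕ}

theorem isRelPrime_prod_X_pow {r : Fin n → ℤ} :
    IsRelPrime (∏ i, X i ^ (r i).toNat : MvPolynomial (Fin n) K) (∏ i, X i ^ (-r i).toNat) := by
  refine IsRelPrime.prod_left fun i _ => IsRelPrime.prod_right fun j _ => ?_
  by_cases hij : i = j
  · subst hij
    rcases le_total (r i) 0 with h | h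
    · rw [Int.toNat_of_nonpos h, pow_zero]
      exact isRelPrime_one_left
    · rw [Int.toNat_of_nonpos (neg_nonpos.2 h), pow_zero]
      exact isRelPrime_one_right
  · refine IsRelPrime.pow ?_
    rw [Irreducible.isRelPrime_iff_not_dvd X_prime.irreducible, X_dvd_X]
    exact hij

theorem mem_of_constantCoeff_eq_zero {I : Ideal (MvPolynomial (Fin n) K)} (hI : ∀ i, X i ∈ I)
    {f : MvPolynomial (Fin n) K} (hf : constantCoeff f = 0) : f ∈ I := by
  have h : f ∈ Ideal.span (X '' (Set.univ : Set (Fin n)) : Set (MvPolynomial (Fin n) K)) := by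
    rw [mem_ideal_span_X_image]
    intro α hα
    by_contra! h
    have : α = 0 := Finsupp.ext fun i => h i trivial
    rw [this, mem_support_iff] at hα
    exact hα hf
  refine (Ideal.span_le.2 ?_) h
  rintro _ ⟨i, -, rfl⟩
  exact hI i

end Variables

namespace SimplicialData

variable {K : Type*} [Field K] {n : ℕ} {H : Type*} [AddCommGroup H] {D : SimplicialData n H}

/-- No other monomial has the degree of 1, since all variables have positive weight. -/
theorem coeff_classMap_zero (f : MvPolynomial (Fin (n + 2)) K) :
    (classMap K D.lattice f).coeff 0 = constantCoeff f := by
  classical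
  rw [coeff_classMap, constantCoeff_eq, Finset.sum_eq_single 0]
  · intro α hα hne
    refine absurd (intExp_injective ?_) hne
    rw [map_zero]
    exact D.eq_zero_of_nonneg ((QuotientAddGroup.eq_zero_iff _).1 (Finset.mem_filter.1 hα).2)
      fun i => Int.natCast_nonneg _
  · intro h
    by_contra hne
    exact h (Finset.mem_filter.2 ⟨mem_support_iff.2 hne, by rw [map_zero]; rfl⟩)

theorem constantCoeff_eq_zero_of_mem {f : MvPolynomial (Fin (n + 2)) K} (hf : f ∈ D.ideal K) :
    constantCoeff f = 0 := by
  rw [← coeff_classMap_zero (D := D), latticeIdeal_le_ker_classMap hf]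
  rfl

variable (D K) in
/-- Evaluation at the origin. -/
def evalOrigin : MvPolynomial (Fin (n + 2)) K ⧸ D.ideal K →+* K :=
  Ideal.Quotient.lift _ constantCoeff fun _ => constantCoeff_eq_zero_of_mem

theorem evalOrigin_mk (f : MvPolynomial (Fin (n + 2)) K) :
    D.evalOrigin K (Ideal.Quotient.mk _ f) = constantCoeff f := rfl

theorem isMaximal_ker_evalOrigin : (RingHom.ker (D.evalOrigin K)).IsMaximal :=
  RingHom.ker_isMaximal_of_surjective _ fun c =>
    ⟨Ideal.Quotient.mk _ (C c), by rw [evalOrigin_mk, constantCoeff_C]⟩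

attribute [local instance] xAlgebra
attribute [local instance] xModule

/-- Two x-monomials in one class differ by a relation with zero entries at z and y, which must be
zero. So no cancellation is possible. -/
theorem injective_xAlgebraMap : Function.Injective
    (algebraMap (MvPolynomial (Fin n) K) (MvPolynomial (Fin (n + 2)) K ⧸ D.ideal K)) := by
  rw [injective_iff_map_eq_zero]
  intro f hf
  rw [xAlgebraMap_apply, Ideal.Quotient.eq_zero_iff_mem] at hf
  by_contra hne
  obtain ⟨α, hα⟩ := support_nonempty.2 hne
  have hα' : xExp α ∈ (xIncl K n f).support := by
    rw [mem_support_iff] at hα ⊢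
    rwa [xIncl, xExp, coeff_rename_mapDomain _ succ_succ_injective]
  obtain ⟨β, hβ, hβα, hmem⟩ := exists_equiv_of_classMap_eq_zero
    (latticeIdeal_le_ker_classMap hf) hα'
  obtain ⟨γ, rfl, -⟩ := coeff_rename_ne_zero _ _ _ (mem_support_iff.1 hβ)
  change xExp γ ≠ _ at hβα
  change intExp _ _ - intExp _ (xExp γ) ∈ _ at hmem
  obtain ⟨e, he, hve⟩ := D.exists_eq_relVec hmem
  have e0 := congrFun hve 0
  have e1 := congrFun hve 1
  simp at e0 e1
  have : e = 0 := Prod.ext e0.symm e1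
  refine hβα (intExp_injective (sub_eq_zero.1 ?_)).symm
  rw [hve, this]
  ext i
  refine Fin.cases rfl (Fin.cases rfl fun i => ?_) i
  simp [xPart]

variable [Finite H]

/-- A power of `z` of exponent below `s_ν` is not a multiple of a nontrivial monomial in the
`x i`, locally at the origin. -/
theorem constantCoeff_eq_zero_of_mul_X_pow_sub_mem {s : ℕ} (hs : (s : ℤ) < D.s D.nu)
    {γ : Fin n →₀ ℕ} {j : Fin n} (hj : γ j ≠ 0) {h f : MvPolynomial (Fin (n + 2)) K}
    (hmem : h * X 0 ^ s - monomial (xExp γ) 1 * f ∈ D.ideal K) : constantCoeff h = 0 := by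
  set τ : Fin (n + 2) →₀ ℕ := Finsupp.single 0 s with hτ
  rw [X_pow_eq_monomial, mul_comm] at hmem
  have h0 := latticeIdeal_le_ker_classMap hmem
  rw [RingHom.mem_ker, map_sub, sub_eq_zero] at h0
  -- The constant term of h is the coefficient of z^s h in the class of z^s. If it is nonzero, x^γ f
  -- has a monomial there, so z^s is equivalent to some x^γ X^β.
  rw [← coeff_classMap_zero (D := D), ← coeff_classMap_monomial_mul τ, h0]
  by_contra hne
  have hq : ((intExp (n + 2) τ : Fin (n + 2) → ℤ) : _ ⧸ D.lattice) + 0 =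
      (intExp (n + 2) (xExp γ) : Fin (n + 2) → ℤ) +
        ((intExp (n + 2) τ - intExp (n + 2) (xExp γ) : Fin (n + 2) → ℤ) : _ ⧸ D.lattice) := by
    rw [← QuotientAddGroup.mk_add, add_sub_cancel, add_zero]
  rw [hq, coeff_classMap_monomial_mul] at hne
  obtain ⟨β, hβ⟩ := exists_mk_eq_of_coeff_classMap_ne_zero hne
  have hv : -intExp (n + 2) β + (intExp (n + 2) τ - intExp (n + 2) (xExp γ)) ∈ D.lattice :=
    QuotientAddGroup.eq.1 hβ
  obtain ⟨e, he, hve⟩ := D.exists_eq_relVec hv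
  have e0 := congrFun hve 0
  have e1 := congrFun hve 1
  have ex : ∀ i : Fin n, D.xPart e i = β i.succ.succ + γ i := fun i => by
    have := congrFun hve i.succ.succ
    simp [hτ] at this
    omega
  simp [hτ] at e0 e1
  have hne0 : e ≠ 0 := by
    rintro rfl
    have := ex j
    simp [xPart] at this
    omega
  -- The resulting vector has p ≥ 0 and r ≥ 0. If its s is nonnegative, minimality of s_ν is
  -- violated; if negative, the opposite relation has no negative entry and must vanish.
  by_cases hpos : 0 ≤ e.1
  · have := s_nu_le he hpos (by omega) hne0 fun i => by rw [ex]; positivity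
    omega
  · have := D.eq_zero_of_nonneg (D.lattice.neg_mem (D.relVec_mem_lattice_iff.2 he)) (by
      refine Fin.cases ?_ (Fin.cases ?_ fun i => ?_)
      · rw [Pi.neg_apply, relVec_zero]; omega
      · change 0 ≤ -(D.relVec e 1)
        rw [relVec_one]; omega
      · rw [Pi.neg_apply, relVec_succ_succ, ex]; omega)
    have := congrFun this 0
    rw [Pi.neg_apply, relVec_zero, Pi.zero_apply] at this
    omega

theorem constantCoeff_xIncl (f : MvPolynomial (Fin n) K) :
    constantCoeff (xIncl K n f) = constantCoeff f :=
  constantCoeff_rename _ _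

/-- Powers of z and y equal polynomials in the x_i without constant term, so z and y vanish wherever
the x_i do. This uniqueness lets going up bound the height at the origin from below. -/
theorem eq_ker_evalOrigin_of_comap_eq {Q : Ideal (MvPolynomial (Fin (n + 2)) K ⧸ D.ideal K)}
    (hQ : Q.IsPrime) (h : Q.comap (algebraMap (MvPolynomial (Fin n) K) _) =
      RingHom.ker (constantCoeff (R := K) (σ := Fin n))) : Q = RingHom.ker (D.evalOrigin K) := by
  have hx : ∀ f : MvPolynomial (Fin n) K, constantCoeff f = 0 →
      Ideal.Quotient.mk (D.ideal K) (xIncl K n f) ∈ Q := fun f hf => by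
    have : f ∈ Q.comap (algebraMap (MvPolynomial (Fin n) K) _) := by rw [h]; exact hf
    exact this
  have hpow : ∀ (i : Fin (n + 2)) (s : ℕ), 0 < s → ∀ f, X i ^ s - xIncl K n f ∈ D.ideal K →
      Ideal.Quotient.mk (D.ideal K) (X i) ∈ Q := by
    intro i s hs f hf
    refine hQ.mem_of_pow_mem s ?_
    rw [← map_pow, Ideal.Quotient.eq.2 hf]
    refine hx f ?_
    have := constantCoeff_eq_zero_of_mem hf
    rw [map_sub, map_pow, constantCoeff_X, zero_pow hs.ne', zero_sub, neg_eq_zero,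
      constantCoeff_xIncl] at this
    exact this
  obtain ⟨⟨s, hs, f, hf⟩, p, hp, g, hg⟩ := D.exists_pow_sub_mem K
  refine (isMaximal_ker_evalOrigin.eq_of_le hQ.ne_top fun b hb => ?_).symm
  obtain ⟨q, rfl⟩ := Ideal.Quotient.mk_surjective b
  rw [RingHom.mem_ker, evalOrigin_mk] at hb
  refine mem_of_constantCoeff_eq_zero (I := Q.comap (Ideal.Quotient.mk (D.ideal K))) ?_ hb
  refine Fin.cases (hpow 0 s hs f hf) (Fin.cases (hpow 1 p hp g hg) fun i => ?_)
  have := hx (X i) (constantCoeff_X _ _)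
  rwa [xIncl, rename_X] at this

variable (D K) in
theorem le_height_ker_evalOrigin : (n : ℕ∞) ≤ (RingHom.ker (D.evalOrigin K)).height := by
  have hint : Algebra.IsIntegral (MvPolynomial (Fin n) K)
    (MvPolynomial (Fin (n + 2)) K ⧸ D.ideal K) := isIntegral_quotient
  have h1 : (RingHom.ker (constantCoeff (R := K) (σ := Fin n))).IsPrime := RingHom.ker_isPrime _
  have h2 : (RingHom.ker (D.evalOrigin K)).IsPrime := RingHom.ker_isPrime _
  exact (le_height_ker_constantCoeff K n).trans
    (height_le_height_of_isIntegral injective_xAlgebraMap _ _ fun _ =>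
      eq_ker_evalOrigin_of_comap_eq)

/-- The obstruction is the ray binomial of ε_{ν+1}: its x-factors are u and v, and its pure powers
of z and y are x and y in the criterion. A positive coordinate of r_{ν+1} makes u nonconstant. -/
theorem not_isCohenMacaulay_of_nu_lt_mu (h : D.nu < D.mu) :
    ¬ IsCohenMacaulay (MvPolynomial (Fin (n + 2)) K ⧸ D.ideal K) := by
  rintro ⟨hnoeth, hcm⟩
  have hint : Algebra.IsIntegral (MvPolynomial (Fin n) K)
    (MvPolynomial (Fin (n + 2)) K ⧸ D.ideal K) := isIntegral_quotient
  have hmax : (RingHom.ker (D.evalOrigin K)).IsMaximal := isMaximal_ker_evalOrigin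
  have hnl := D.nu_lt_last
  obtain ⟨j, hj⟩ := D.exists_r_pos le_rfl h
  set r := D.r (D.nu + 1) with hr
  set γ : Fin n →₀ ℕ := Finsupp.equivFunOnFinite.symm fun i => (r i).toNat with hγ
  have hs := D.s_succ_of_lt_last hnl
  have hU : (∏ i, X i ^ (r i).toNat : MvPolynomial (Fin n) K) = monomial γ 1 := by
    rw [monomial_eq, C_1, one_mul, Finsupp.prod_fintype _ _ fun i => pow_zero _]
    rfl
  have hU' : algebraMap (MvPolynomial (Fin n) K) (MvPolynomial (Fin (n + 2)) K ⧸ D.ideal K)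
      (∏ i, X i ^ (r i).toNat) = Ideal.Quotient.mk _ (monomial (xExp γ) 1) := by
    rw [xAlgebraMap_apply, hU, xIncl_monomial]
  have hγj : γ j ≠ 0 := by
    change (r j).toNat ≠ 0
    omega
  refine not_isCohenMacaulayLocal_atPrime (RingHom.ker (D.evalOrigin K))
    (u := (∏ i, X i ^ (r i).toNat : MvPolynomial (Fin n) K)) (v := ∏ i, X i ^ (-r i).toNat)
    (x := Ideal.Quotient.mk _ (X 0 ^ (D.s (D.nu + 1)).toNat))
    (y := Ideal.Quotient.mk _ (X 1 ^ (D.p (D.nu + 1)).toNat)) ?_ ?_ ?_ ?_ ?_ (hcm _)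
  · rw [RingHom.mem_ker, xAlgebraMap_apply, evalOrigin_mk, constantCoeff_xIncl, hU,
      constantCoeff_monomial, if_neg]
    rintro h0
    exact hγj (by rw [h0]; rfl)
  · rw [hU']
    exact isSMulRegular_monomial _
  · intro g f hgf
    obtain ⟨g, rfl⟩ := Ideal.Quotient.mk_surjective g
    obtain ⟨f, rfl⟩ := Ideal.Quotient.mk_surjective f
    rw [hU', ← map_mul, ← map_mul, Ideal.Quotient.eq] at hgf
    rw [RingHom.mem_ker, evalOrigin_mk]
    exact constantCoeff_eq_zero_of_mul_X_pow_sub_mem (by omega) hγj hgf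
  · rw [xAlgebraMap_apply, xAlgebraMap_apply, ← map_mul, ← map_mul, Ideal.Quotient.eq]
    have := latticeBinomial_mem (K := K) (D.relVec_mem_lattice_iff.2 (D.fan_mem (D.nu + 1)))
    change _ ∈ D.ideal K at this
    rw [← rayBinomial_eq (by omega), rayBinomial] at this
    have hp : ∀ i, (plus r i).toNat = (r i).toNat := fun i => by
      simp only [plus]; omega
    have hm : ∀ i, (minus r i).toNat = (-r i).toNat := fun i => by
      simp only [minus]; omega
    rw [← hr] at this
    simp only [mono, hp, hm, Int.toNat_zero, pow_zero, mul_one, one_mul] at this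
    simp only [xIncl, map_prod, map_pow, rename_X]
    rwa [mul_comm _ (X 0 ^ _), mul_comm _ (X 1 ^ _)]
  · have h1 := ringKrullDim_quotient_span_pair_add_two_le
      (u := (∏ i, X i ^ (r i).toNat : MvPolynomial (Fin n) K)) (v := ∏ i, X i ^ (-r i).toNat)
      (Finset.prod_ne_zero_iff.2 fun i _ => pow_ne_zero _ (X_ne_zero i)) isRelPrime_prod_X_pow
    rw [MvPolynomial.ringKrullDim_of_isNoetherianRing] at h1
    have h2 := D.le_height_ker_evalOrigin K
    refine h1.trans ?_
    simp
    exact_mod_cast h2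

end SimplicialData

end NotCohenMacaulayCase

theorem theorem7 (K : Type*) [Field K] (n : ℕ) (H : Type*) [AddCommGroup H] [Finite H]
    (D : SimplicialData n H)
    (hslope : ∀ i j : Fin n, i ≤ j → D.b i * D.c j ≤ D.b j * D.c i) :
    (IsCohenMacaulay (MvPolynomial (Fin (n + 2)) K ⧸ D.ideal K) ↔ D.mu = D.nu) ∧
    (IsCohenMacaulay (MvPolynomial (Fin (n + 2)) K ⧸ D.ideal K) →
      Ideal.span {D.polyF K, D.polyG K, D.polyH K} = D.ideal K ∧
      ∀ w : Fin (n + 2) → ℕ, (∀ i, 0 < w i) →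
        (∀ u ∈ D.lattice, ∑ i, (w i : ℤ) * u i = 0) →
        IsGroebnerBasis (RevLexLT w) {D.polyF K, D.polyG K, D.polyH K} (D.ideal K)) ∧
    (¬ IsCohenMacaulay (MvPolynomial (Fin (n + 2)) K ⧸ D.ideal K) →
      Ideal.span (D.generators K) = D.ideal K ∧
      ((D.generators K).ncard : ℤ) = D.tau ∧
      ∀ w : Fin (n + 2) → ℕ, (∀ i, 0 < w i) →
        (∀ u ∈ D.lattice, ∑ i, (w i : ℤ) * u i = 0) →
        IsGroebnerBasis (RevLexLT w) (D.generators K) (D.ideal K)) := by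
  have hcm : IsCohenMacaulay (MvPolynomial (Fin (n + 2)) K ⧸ D.ideal K) ↔ D.mu = D.nu := by
    refine ⟨fun h => ?_, SimplicialData.isCohenMacaulay_of_mu_eq_nu hslope⟩
    by_contra hne
    exact SimplicialData.not_isCohenMacaulay_of_nu_lt_mu
      (lt_of_le_of_ne D.nu_le_mu (Ne.symm hne)) h
  refine ⟨hcm, fun h => ?_, fun h => ?_⟩
  · have hG := SimplicialData.isBinomialBasis_of_mu_eq_nu (K := K) hslope (hcm.1 h)
    -- Generation does not refer to weights; its proof runs with the particular ones `D.weight`, the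
    -- Gröbner property with arbitrary ones.
    exact ⟨hG.span_eq D.weight_pos fun u hu => D.sum_weight_mul hu,
      fun w _ hL => hG.isGroebnerBasis hL⟩
  · have hG := SimplicialData.isBinomialBasis_generators (K := K) hslope
    exact ⟨hG.span_eq D.weight_pos fun u hu => D.sum_weight_mul hu,
      SimplicialData.ncard_generators, fun w _ hL => hG.isGroebnerBasis hL⟩
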